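/- Let $I$ be a finite set. Write $\mathcal P$ for the set of all partitions (including the empty one), and for $\bm\lambda=(\lambda^i)_{i\in I}\in\mathcal P^I$ put $|\bm\lambda|=(|\lambda^i|)_{i\in I}\in\mathbb N^I$; for $\alpha\in\mathbb N^I$ put $(1^\alpha)=((1^{\alpha_i}))_{i\in I}$. **Multitypes.** A multitype is a finitely supported function $\omega:\mathbb N\times\mathcal P^I\to\mathbb N$ with $\omega(0,\bm\lambda)=\omega(d,0)=0$ for all $d,\bm\lambda$; it is also written as the unordered sequence $\omega=(d_1,\bm\lambda_1)\cdots(d_r,\bm\lambda_r)$ in which $(d,\bm\lambda)$ occurs $\omega(d,\bm\lambda)$ times. Put $|\omega|=\sum_j d_j|\bm\lambda_j|\in\mathbb N^I$ and $w(\omega)=\prod_{(d,\bm\lambda)}d^{\,\omega(d,\bm\lambda)}\,\omega(d,\bm\lambda)!$. Let $\mathbb T_I$ be the set of multitypes and $\mathbb T_\alpha$ the set of those with $|\omega|=\alpha$. Let $\omega_1\ast\omega_2$ be the sum of functions, and for $d\ge1$ let $\psi_d(\omega)=(dd_1,\bm\lambda_1)\cdots(dd_r,\bm\lambda_r)$.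 A multitype is semisimple if it has the form $\nu=(d_1,(1^{\beta_1}))\cdots(d_r,(1^{\beta_r}))$ with $\beta_j\in\mathbb N^I\setminus\{0\}$; then $P_\nu(t)=\prod_j(t^{d_j}-1)$, and $\nu$ is of level $V\subseteq\mathbb N^I$ if $\beta_j\in V$ for all $j$. **Admissible subtori.** Let $\mathbb F_q$ be a finite field with algebraic closure $\overline{\mathbb F}_q$. For $\alpha\in\mathbb N^I$ let $\mathrm{GL}_\alpha=\prod_{i\in I}\mathrm{GL}_{\alpha_i}$ over $\overline{\mathbb F}_q$, embedded block diagonally in $\mathrm{GL}_{|\alpha|}$, where $|\alpha|=\sum_i\alpha_i$, and let $F$ be the Frobenius raising matrix entries to the $q$-th power. A subtorus $S\subseteq\mathrm{GL}_\alpha$ is admissible if it is the centre of a Levi subgroup of $\mathrm{GL}_{|\alpha|}$ (a conjugate of a block diagonal subgroup $\mathrm{GL}_{n_0}\times\cdots\times\mathrm{GL}_{n_s}$). Let $\mathcal Z_\alpha$ be the set of $F$-stable admissible subtori of $\mathrm{GL}_\alpha$, ordered by inclusion; it is a locally finite poset, with Möbius function $\mu$. For $\omega=(d_1,\bm\lambda_1)\cdots(d_r,\bm\lambda_r)\in\mathbb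 T_\alpha$ with $\beta_j=|\bm\lambda_j|$, embed $\prod_j(\mathrm{GL}_{\beta_j})^{d_j}$ in $\mathrm{GL}_\alpha$ block diagonally (separately for each $i\in I$) by a map $\Delta$; let $J_\sigma\in\mathrm{GL}_\alpha$ be the permutation matrix which, for each $j$, cyclically permutes the $d_j$ blocks of $(\mathrm{GL}_{\beta_j})^{d_j}$ (the $k$-th to the $(k+1)$-st, modulo $d_j$); choose $g\in\mathrm{GL}_\alpha$ with $g^{-1}F(g)=J_\sigma$; and put $$S_\omega=g\,\Delta\Big(\prod_j (Z_{\beta_j})^{d_j}\Big)g^{-1}\in\mathcal Z_\alpha,\qquad Z_\beta=\{(\lambda I_{\beta_i})_{i\in I} : \lambda\in\overline{\mathbb F}_q^{\,*}\}\subseteq\mathrm{GL}_\beta .$$ Up to $\mathrm{GL}_\alpha(\mathbb F_q)$-conjugacy $S_\omega$ does not depend on the choices. For $S\in\mathcal Z_\alpha$ let $[S]\in\mathbb T_\alpha$ be the unique semisimple multitype such that $S$ is $\mathrm{GL}_\alpha(\mathbb F_q)$-conjugate to $S_{[S]}$; $S$ is of level $V$ if $[S]$ is. **Plethysm.** On $\mathbb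 Q(t)[[y_i]]_{i\in I}$ let $\psi_n\big(\sum_\alpha r_\alpha(t)y^\alpha\big)=\sum_\alpha r_\alpha(t^n)y^{n\alpha}$, and for $f$ without constant term let $\mathrm{Plexp}(f)=\exp\big(\sum_{n\ge1}\psi_n(f)/n\big)$. **Log compatible families.** A family $\{F_\omega(t)\}_{\omega\in\mathbb T_I}$ in $\mathbb Q(t)$ is Log compatible if $\prod_{j=1}^rF_{\nu_j}(t^{d_j})=F_\omega(t)$ whenever $r\ge0$, $\nu_1,\dots,\nu_r\in\mathbb T_I$, $d_1,\dots,d_r\ge1$ and $\omega=\psi_{d_1}(\nu_1)\ast\cdots\ast\psi_{d_r}(\nu_r)$ (the case $r=0$ says that $F_\emptyset=1$ for the empty multitype). For $V\subseteq\mathbb N^I$ and $\alpha\in\mathbb N^I$ put $$F_{\alpha,V}(t)=\sum_{\omega\in\mathbb T_\alpha}\frac{F_\omega(t)}{w(\omega)}\Big(\sum_{\substack{S'\in\mathcal Z_\alpha,\ S'\le S_\omega\\ S'\text{ of level }V}}P_{[S']}(t)\,\mu(S',S_\omega)\Big),\qquad F_{\alpha,gen}(t)=F_{\alpha,\{\alpha\}}(t).$$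 **Theorem.** Let $\{F_\omega(t)\}_{\omega\in\mathbb T_I}$ be a Log compatible family and let $V\subseteq\mathbb N^I$ be any subset. Then $$\mathrm{Plexp}\Big(\sum_{\beta\in V\setminus\{0\}}F_{\beta,gen}(t)\,y^\beta\Big)=\sum_{\alpha\in\mathbb N^I}F_{\alpha,V}(t)\,y^\alpha .$$ -/

import Mathlib

open scoped Nat

noncomputable section

namespace LogCompat

/-! ### Partitions, multipartitions and multitypes -/

/-- The set of all partitions (of all natural numbers). -/
abbrev Ptn : Type := (n : ℕ) × n.Partition

/-- The partition `(1^n)`. -/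
def onePtn (n : ℕ) : Ptn :=
  ⟨n, { parts := Multiset.replicate n 1
        parts_pos := fun h => by rw [Multiset.eq_of_mem_replicate h]; exact Nat.one_pos
        parts_sum := by simp }⟩

section Multitypes

variable {I : Type*} [Fintype I]

/-- The size `|𝛌| ∈ ℕ^I` of a multipartition `𝛌 = (λ^i)_{i ∈ I}`. -/
def msize (l : I → Ptn) : I →₀ ℕ := Finsupp.equivFunOnFinite.symm fun i => (l i).1

/-- The multipartition `(1^α)`. -/
def oneMP (α : I →₀ ℕ) : I → Ptn := fun i => onePtn (α i)

variable (I) in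
/-- Multitypes: finitely supported functions `ω : ℕ × 𝒫^I → ℕ` with `ω(0, 𝛌) = ω(d, 0) = 0`. The
only multipartition of size `0` is `0`. The operation `∗` on multitypes is the addition, and
`0` is the empty multitype. -/
def multitypes : AddSubmonoid (ℕ × (I → Ptn) →₀ ℕ) where
  carrier := {ω | (∀ l, ω (0, l) = 0) ∧ ∀ d l, msize l = 0 → ω (d, l) = 0}
  zero_mem' := by simp
  add_mem' := by
    rintro a b ⟨ha, ha'⟩ ⟨hb, hb'⟩
    refine ⟨fun l => by simp [ha l, hb l], fun d l h => by simp [ha' d l h, hb' d l h]⟩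

variable (I) in
/-- The set `𝕋_I` of multitypes. -/
abbrev Multitype : Type _ := ↥(multitypes I)

/-- The operation `ψ_d` on multitypes, sending `(d₁, 𝛌₁)⋯(d_r, 𝛌_r)` to
`(d d₁, 𝛌₁)⋯(d d_r, 𝛌_r)`. -/
def Multitype.psi (d : ℕ+) (ω : Multitype I) : Multitype I :=
  ⟨ω.1.mapDomain fun x => ((d : ℕ) * x.1, x.2), by
    classical
    have key : ∀ y, (ω.1.mapDomain fun x : ℕ × (I → Ptn) => ((d : ℕ) * x.1, x.2)) y ≠ 0 →
        ∃ x, ω.1 x ≠ 0 ∧ ((d : ℕ) * x.1, x.2) = y := by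
      intro y hy
      have := Finsupp.mapDomain_support (Finsupp.mem_support_iff.2 hy)
      obtain ⟨x, hx, rfl⟩ := Finset.mem_image.1 this
      exact ⟨x, Finsupp.mem_support_iff.1 hx, rfl⟩
    constructor
    · intro l
      by_contra h
      obtain ⟨⟨e, l'⟩, hx, hy⟩ := key _ h
      have he : e = 0 := by
        have := congrArg Prod.fst hy
        simpa using this
      exact hx (he ▸ ω.2.1 l')
    · intro k l hl
      by_contra h
      obtain ⟨⟨e, l'⟩, hx, hy⟩ := key _ h
      have he : l' = l := congrArg Prod.snd hy
      exact hx (ω.2.2 e l' (he ▸ hl))⟩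

/-- The size `|ω| = ∑ d ω(d, 𝛍) |𝛍|` of a multitype. -/
def Multitype.size (ω : Multitype I) : I →₀ ℕ := ω.1.sum fun x m => (x.1 * m) • msize x.2

/-- `w(ω) = ∏ d^{ω(d, 𝛍)} ω(d, 𝛍)!`. -/
def Multitype.w (ω : Multitype I) : ℕ := ω.1.prod fun x m => x.1 ^ m * m !

/-- A multitype is semisimple if its support consists of elements `(d, (1^α))`. -/
def Multitype.IsSemisimple (ω : Multitype I) : Prop :=
  ∀ x ∈ ω.1.support, ∃ α : I →₀ ℕ, x.2 = oneMP α

/-- For `ω = (d₁, (1^{α₁}))⋯(d_r, (1^{α_r}))`, the element `P_ω(t) = ∏ (t^{d_j} - 1)` of `ℚ(t)`. -/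
def Multitype.P (ω : Multitype I) : RatFunc ℚ :=
  ω.1.prod fun x m => ((RatFunc.X : RatFunc ℚ) ^ x.1 - 1) ^ m

/-- The multitype `(d₁, (1^{α₁}))⋯(d_r, (1^{α_r}))` is of level `V` if all `α_j` are in `V`. -/
def Multitype.IsOfLevel (V : Set (I →₀ ℕ)) (ω : Multitype I) : Prop :=
  ∀ x ∈ ω.1.support, msize x.2 ∈ V

/-- There are finitely many multitypes of size `α`. -/
theorem finite_ofSize (α : I →₀ ℕ) : {ω : Multitype I | ω.size = α}.Finite := by
  classical
  set N : ℕ := ∑ i, α i with hN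
  have hle : ∀ i, α i ≤ N := fun i => Finset.single_le_sum (fun _ _ => Nat.zero_le _)
    (Finset.mem_univ i)
  have hA : {x : ℕ × (I → Ptn) | x.1 ≤ N ∧ ∀ i, (x.2 i).1 ≤ N}.Finite := by
    have h1 : {p : Ptn | p.1 ≤ N}.Finite := by
      refine ((Finset.range (N + 1)).sigma fun n => (Finset.univ : Finset n.Partition)).finite_toSet.subset ?_
      intro p hp
      simpa [Nat.lt_succ_iff] using hp
    have h2 : (Set.univ.pi fun _ : I => {p : Ptn | p.1 ≤ N}).Finite :=
      Set.Finite.pi fun _ => h1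
    refine ((Set.finite_Iic N).prod h2).subset ?_
    rintro x ⟨h, h'⟩
    exact ⟨h, fun i _ => h' i⟩
  have hB : (Set.Iic (Finsupp.indicator hA.toFinset fun _ _ => N)).Finite := Set.finite_Iic _
  refine (hB.preimage (Subtype.val_injective.injOn)).subset ?_
  intro ω hω
  have hω' : Multitype.size ω = α := hω
  show ω.1 ≤ _
  intro x
  by_cases hx : ω.1 x = 0
  · simp [hx]
  have hs : ∀ i, x.1 * ω.1 x * (x.2 i).1 ≤ α i := by
    intro i
    rw [← hω', Multitype.size, Finsupp.sum, Finsupp.finsetSum_apply]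
    exact Finset.single_le_sum (f := fun y : ℕ × (I → Ptn) => ((y.1 * ω.1 y) • msize y.2) i)
      (fun _ _ => Nat.zero_le _) (Finsupp.mem_support_iff.2 hx)
  have hd : 0 < x.1 := Nat.pos_of_ne_zero fun h => hx (by
    have := ω.2.1 x.2
    rwa [show ((0 : ℕ), x.2) = x from Prod.ext h.symm rfl] at this)
  have hm : msize x.2 ≠ 0 := fun h => hx (ω.2.2 x.1 x.2 h)
  obtain ⟨i, hi⟩ := Finsupp.ne_iff.1 hm
  have hi' : 0 < (x.2 i).1 := Nat.pos_of_ne_zero hi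
  have hw : 0 < ω.1 x := Nat.pos_of_ne_zero hx
  have hbd := (hs i).trans (hle i)
  have hxA : x ∈ hA.toFinset := by
    refine hA.mem_toFinset.2 ⟨?_, fun k => ?_⟩
    · nlinarith [Nat.mul_le_mul hw hi', Nat.mul_le_mul_left x.1 (Nat.mul_le_mul hw hi')]
    · have := (hs k).trans (hle k)
      nlinarith [Nat.mul_le_mul_right (x.2 k).1 (Nat.mul_le_mul hd hw)]
  rw [Finsupp.indicator_of_mem hxA]
  nlinarith [Nat.mul_le_mul_left (ω.1 x) (Nat.mul_le_mul hd hi')]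

end Multitypes

/-! ### Plethysm -/

/-- The Adams operation `f(t) ↦ f(t^d)` on `ℚ(t)`. -/
def adams (d : ℕ+) : RatFunc ℚ →+* RatFunc ℚ :=
  RatFunc.mapRingHom (Polynomial.expand ℚ (d : ℕ)).toRingHom
    (nonZeroDivisors_le_comap_nonZeroDivisors_of_injective _
      (Polynomial.expand_injective d.pos))

section Plethysm

variable {I : Type*} [Fintype I]

/-- The Adams operation `∑ r_α y^α ↦ ∑ ψ_d(r_α) y^{dα}` on `ℚ(t)[[y_i]]_{i ∈ I}`. -/
def psiSeries (d : ℕ+) (f : MvPowerSeries I (RatFunc ℚ)) : MvPowerSeries I (RatFunc ℚ) :=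
  MvPowerSeries.expand (d : ℕ) d.ne_zero (MvPowerSeries.map (adams d) f)

/-- The series `∑_{n ≥ 1} ψ_n(f) / n`, for `f` without constant term (each coefficient is then a
finite sum). -/
def psiSum (f : MvPowerSeries I (RatFunc ℚ)) : MvPowerSeries I (RatFunc ℚ) :=
  fun γ => ∑ᶠ n : ℕ+, ((n : ℕ) : RatFunc ℚ)⁻¹ * MvPowerSeries.coeff γ (psiSeries n f)

/-- The plethystic exponential `Plexp(f) = exp (∑_{n ≥ 1} ψ_n(f) / n)` of a power series `f` without
constant term. -/
def Plexp (f : MvPowerSeries I (RatFunc ℚ)) : MvPowerSeries I (RatFunc ℚ) :=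
  (PowerSeries.exp (RatFunc ℚ)).subst (psiSum f)

/-- Log compatible families of rational functions. The empty product is allowed, so that the value
at the empty multitype is `1`. -/
def LogCompatible (F : Multitype I → RatFunc ℚ) : Prop :=
  ∀ (r : ℕ) (ν : Fin r → Multitype I) (d : Fin r → ℕ+),
    ∏ j, adams (d j) (F (ν j)) = F (∑ j, (ν j).psi (d j))

end Plethysm

/-! ### Levi subgroups of `GL_n` and admissible subtori of `GL_α` -/

section Levi

variable {n : Type*} [Fintype n] [DecidableEq n] {K : Type*} [Field K]

/-- The subgroup of `GL_n` of the matrices that are block diagonal for the decomposition of the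
index set `n` into the fibres of `f`. -/
def blockDiag (K : Type*) [Field K] (f : n → ℕ) : Subgroup (GL n K) where
  carrier := {g | ∀ a b, f a ≠ f b → (g : Matrix n n K) a b = 0}
  one_mem' := fun a b h => by
    simp [Matrix.one_apply_ne (fun e : a = b => h (congrArg f e))]
  mul_mem' := by
    intro g h hg hh a b hab
    simp only [Units.val_mul, Matrix.mul_apply]
    refine Finset.sum_eq_zero fun c _ => ?_
    by_cases hc : f a = f c
    · rw [hh c b (hc ▸ hab), mul_zero]
    · rw [hg a c hc, zero_mul]
  inv_mem' := by
    intro g hg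
    have h1 : (g : Matrix n n K).BlockTriangular f := fun a b hab => hg a b hab.ne'
    have h2 : (g : Matrix n n K).BlockTriangular (OrderDual.toDual ∘ f) :=
      fun a b hab => hg a b (OrderDual.toDual_lt_toDual.1 hab).ne
    let _ : Invertible (g : Matrix n n K) := g.invertible
    have h1' := Matrix.blockTriangular_inv_of_blockTriangular h1
    have h2' := Matrix.blockTriangular_inv_of_blockTriangular h2
    intro a b hab
    rw [Matrix.coe_units_inv]
    rcases lt_or_gt_of_ne hab with h | h
    · exact h2' (OrderDual.toDual_lt_toDual.2 h)
    · exact h1' h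

/-- Levi subgroups of `GL_n`: the conjugates of the block diagonal subgroups
`GL_{n_0} × ⋯ × GL_{n_s}`. -/
def IsLevi (L : Subgroup (GL n K)) : Prop :=
  ∃ (f : n → ℕ) (h : GL n K), L = (blockDiag K f).map (MulAut.conj h).toMonoidHom

end Levi

section Tori

variable {I : Type*} [Fintype I] [DecidableEq I]

/-- The group `GL_α = ∏_{i ∈ I} GL_{α_i}` (its group of `K`-points). -/
abbrev GLv (K : Type*) [Field K] (α : I →₀ ℕ) : Type _ := (i : I) → GL (Fin (α i)) K

/-- The block diagonal embedding `GL_α → GL_{|α|}`. -/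
def blockEmb (K : Type*) [Field K] (α : I →₀ ℕ) : GLv K α →* GL ((i : I) × Fin (α i)) K :=
  (Units.map (Matrix.blockDiagonal'RingHom (fun i => Fin (α i)) K).toMonoidHom).comp
    (MulEquiv.piUnits (M := fun i => Matrix (Fin (α i)) (Fin (α i)) K)).symm.toMonoidHom

/-- A subgroup `S` of `GL_α` is an admissible subtorus if it is, inside `GL_{|α|}`, the centre of
a Levi subgroup of `GL_{|α|}` (such a centre is always a torus). -/
def IsAdmissible {K : Type*} [Field K] {α : I →₀ ℕ} (S : Subgroup (GLv K α)) : Prop :=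
  ∃ L : Subgroup (GL ((i : I) × Fin (α i)) K),
    IsLevi L ∧ S.map (blockEmb K α) = (Subgroup.center L).map L.subtype

variable (Fq K : Type*) [Field Fq] [Fintype Fq] [Field K] [Algebra Fq K]

/-- The Frobenius `F` of `GL_α`, raising the entries of the matrices to the power `q = |𝔽_q|`. -/
def frob (α : I →₀ ℕ) : GLv K α →* GLv K α :=
  MonoidHom.pi fun i =>
    (Matrix.GeneralLinearGroup.map (FiniteField.frobeniusAlgHom Fq K).toRingHom).comp
      (Pi.evalMonoidHom (fun i => GL (Fin (α i)) K) i)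

/-- The set `𝒵_α` of `F`-stable admissible subtori of `GL_α`, ordered by inclusion. -/
abbrev AdmTori (α : I →₀ ℕ) : Type _ :=
  {S : Subgroup (GLv K α) // IsAdmissible S ∧ S.map (frob Fq K α) = S}

/-- Membership in the centre of a block diagonal subgroup. -/
theorem mem_center_blockDiag {n K : Type*} [Fintype n] [DecidableEq n] [Field K] (f : n → ℕ)
    (g : GL n K) : g ∈ (Subgroup.center (blockDiag K f)).map (blockDiag K f).subtype ↔
      ∃ z : ℕ → Kˣ, (g : Matrix n n K) = Matrix.diagonal fun a => (z (f a) : K) := by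
  constructor
  · rintro ⟨⟨g, hg⟩, hc, rfl⟩
    have hcomm : ∀ h ∈ blockDiag K f, h * g = g * h := fun h hh =>
      congrArg Subtype.val (Subgroup.mem_center_iff.1 hc ⟨h, hh⟩)
    have key : ∀ a b, a ≠ b → f a = f b →
        (g : Matrix n n K) b b = (g : Matrix n n K) a a ∧ (g : Matrix n n K) b a = 0 := by
      intro a b hab hf
      set T : GL n K := Matrix.GeneralLinearGroup.mkOfDetNeZero (Matrix.transvection a b (1 : K))
        (by rw [Matrix.det_transvection_of_ne a b hab]; exact one_ne_zero) with hT
      have hTm : T ∈ blockDiag K f := by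
        intro c d hcd
        have h1 : c ≠ d := fun e => hcd (congrArg f e)
        have h2 : ¬ (a = c ∧ b = d) := fun e => hcd (by rw [← e.1, ← e.2, hf])
        show (Matrix.transvection a b (1 : K)) c d = 0
        simp [Matrix.transvection, Matrix.one_apply_ne h1, h2]
      have h := congrArg (Units.val) (hcomm T hTm)
      have h' : Matrix.single a b (1 : K) * (g : Matrix n n K) =
          (g : Matrix n n K) * Matrix.single a b 1 := by
        have h'' : (1 + Matrix.single a b (1 : K)) * (g : Matrix n n K) =
          (g : Matrix n n K) * (1 + Matrix.single a b 1) := h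
        simpa [add_mul, mul_add] using h''
      constructor
      · have := congrFun (congrFun h' a) b
        simpa using this
      · have := congrFun (congrFun h' a) a
        simpa [hab.symm, hab] using this
    have hoff : ∀ a b, a ≠ b → (g : Matrix n n K) a b = 0 := by
      intro a b hab
      by_cases hf : f a = f b
      · exact (key b a hab.symm hf.symm).2
      · exact hg a b hf
    have hdiag : (g : Matrix n n K) = Matrix.diagonal fun a => (g : Matrix n n K) a a := by
      ext a b
      by_cases hab : a = b
      · subst hab; simp
      · simp [Matrix.diagonal_apply_ne _ hab, hoff a b hab]
    have hne : ∀ a, (g : Matrix n n K) a a ≠ 0 := by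
      have hdet : (g : Matrix n n K).det ≠ 0 := (Matrix.isUnits_det_units g).ne_zero
      rw [hdiag, Matrix.det_diagonal] at hdet
      exact fun a => Finset.prod_ne_zero_iff.1 hdet a (Finset.mem_univ a)
    classical
    refine ⟨fun m => if h : ∃ a, f a = m then Units.mk0 _ (hne h.choose) else 1, ?_⟩
    refine hdiag.trans (congrArg Matrix.diagonal (funext fun a => ?_))
    have hex : ∃ b, f b = f a := ⟨a, rfl⟩
    show _ = ((if h : ∃ b, f b = f a then Units.mk0 _ (hne h.choose) else 1 : Kˣ) : K)
    rw [dif_pos hex, Units.val_mk0]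
    by_cases hab : hex.choose = a
    · rw [hab]
    · exact ((key _ _ hab hex.choose_spec).1)
  · rintro ⟨z, hz⟩
    have hg : g ∈ blockDiag K f := by
      intro a b hab
      rw [hz, Matrix.diagonal_apply_ne _ (fun e => hab (congrArg f e))]
    refine ⟨⟨g, hg⟩, Subgroup.mem_center_iff.2 ?_, rfl⟩
    rintro ⟨h, hh⟩
    apply Subtype.ext
    apply Units.ext
    show (h : Matrix n n K) * (g : Matrix n n K) = (g : Matrix n n K) * (h : Matrix n n K)
    rw [hz]
    ext a b
    rw [Matrix.mul_diagonal, Matrix.diagonal_mul]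
    by_cases hab : f a = f b
    · rw [hab, mul_comm]
    · rw [hh a b hab]; simp

theorem center_map_conj {G : Type*} [Group G] (H : Subgroup G) (h x : G) :
    x ∈ (Subgroup.center (H.map (MulAut.conj h).toMonoidHom)).map
        (H.map (MulAut.conj h).toMonoidHom).subtype ↔
      h⁻¹ * x * h ∈ (Subgroup.center H).map H.subtype := by
  have hm : ∀ y, y ∈ H.map (MulAut.conj h).toMonoidHom ↔ h⁻¹ * y * h ∈ H := by
    intro y
    constructor
    · rintro ⟨z, hz, rfl⟩
      simpa [mul_assoc] using hz
    · intro hy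
      exact ⟨_, hy, by simp [mul_assoc]⟩
  have hc : ∀ (L : Subgroup G) (y : G), y ∈ (Subgroup.center L).map L.subtype ↔
      y ∈ L ∧ ∀ z ∈ L, z * y = y * z := by
    intro L y
    constructor
    · rintro ⟨y, hy, rfl⟩
      exact ⟨y.2, fun z hz => congrArg Subtype.val (Subgroup.mem_center_iff.1 hy ⟨z, hz⟩)⟩
    · rintro ⟨hy, h⟩
      exact ⟨⟨y, hy⟩, Subgroup.mem_center_iff.2 fun z => Subtype.ext (h z z.2), rfl⟩
  rw [hc, hc, hm]
  refine and_congr_right fun _ => ⟨fun H' z hz => ?_, fun H' z hz => ?_⟩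
  · have := H' (h * z * h⁻¹) ((hm _).2 (by simpa [mul_assoc] using hz))
    have h2 := congrArg (fun t => h⁻¹ * t * h) this
    simpa [mul_assoc] using h2
  · have := H' _ ((hm z).1 hz)
    have h2 := congrArg (fun t => h * t * h⁻¹) this
    simpa [mul_assoc] using h2

theorem blockEmb_coe {K : Type*} [Field K] {α : I →₀ ℕ} (g : GLv K α) :
    ((blockEmb K α g : GL ((i : I) × Fin (α i)) K) : Matrix _ _ K) =
      Matrix.blockDiagonal' fun i => (g i : Matrix (Fin (α i)) (Fin (α i)) K) := rfl

theorem blockEmb_injective {K : Type*} [Field K] {α : I →₀ ℕ} :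
    Function.Injective (blockEmb K α) := by
  intro g h hgh
  have := congrArg Units.val hgh
  rw [blockEmb_coe, blockEmb_coe] at this
  have := Matrix.blockDiagonal'_injective this
  funext i
  exact Units.ext (congrFun this i)

/-- An admissible subtorus is diagonalizable, with weight spaces given by the fibres of some `f`. -/
theorem IsAdmissible.exists_diag {K : Type*} [Field K] {α : I →₀ ℕ} {S : Subgroup (GLv K α)}
    (hS : IsAdmissible S) : ∃ (f : (i : I) × Fin (α i) → ℕ) (h : GL ((i : I) × Fin (α i)) K),
      (∀ x, x ∈ S ↔ ∃ z : ℕ → Kˣ, ((h⁻¹ * blockEmb K α x * h : GL _ K) : Matrix _ _ K) =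
        Matrix.diagonal fun a => (z (f a) : K)) ∧
      ∀ y : GL ((i : I) × Fin (α i)) K, (∃ z : ℕ → Kˣ, ((h⁻¹ * y * h : GL _ K) : Matrix _ _ K) =
        Matrix.diagonal fun a => (z (f a) : K)) → ∃ x ∈ S, blockEmb K α x = y := by
  obtain ⟨L, ⟨f, h, rfl⟩, hL⟩ := hS
  have key : ∀ y, y ∈ S.map (blockEmb K α) ↔ ∃ z : ℕ → Kˣ,
      ((h⁻¹ * y * h : GL _ K) : Matrix _ _ K) = Matrix.diagonal fun a => (z (f a) : K) := by
    intro y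
    rw [hL, center_map_conj, mem_center_blockDiag]
  refine ⟨f, h, fun x => ?_, fun y hy => ?_⟩
  · rw [← key, Subgroup.mem_map_iff_mem blockEmb_injective]
  · exact (key y).2 hy

/-- An admissible subtorus contains only finitely many admissible subtori. -/
theorem finite_admissible_le {K : Type*} [Field K] [Infinite K] {α : I →₀ ℕ}
    {S : Subgroup (GLv K α)} (hS : IsAdmissible S) :
    {S' : Subgroup (GLv K α) | IsAdmissible S' ∧ S' ≤ S}.Finite := by
  classical
  obtain ⟨f, h, hS1, hS2⟩ := hS.exists_diag
  have key : ∀ S' : Subgroup (GLv K α), IsAdmissible S' → S' ≤ S →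
      ∃ r : Setoid ((i : I) × Fin (α i)), ∀ x, x ∈ S' ↔ ∃ c : (i : I) × Fin (α i) → Kˣ,
        (∀ a b, r a b → c a = c b) ∧
        ((h⁻¹ * blockEmb K α x * h : GL _ K) : Matrix _ _ K) =
          Matrix.diagonal fun a => (c a : K) := by
    intro S' hS' hle
    obtain ⟨f', h', hS1', hS2'⟩ := hS'.exists_diag
    have : Infinite ({0}ᶜ : Set K) := (Set.finite_singleton (0 : K)).infinite_compl.to_subtype
    have : Infinite Kˣ := Infinite.of_injective
      (fun x : ({0}ᶜ : Set K) => Units.mk0 x.1 x.2)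
      (fun x y hxy => Subtype.ext (congrArg Units.val hxy))
    obtain ⟨z0⟩ : Nonempty (ℕ ↪ Kˣ) := ⟨Infinite.natEmbedding Kˣ⟩
    set v : GL ((i : I) × Fin (α i)) K := h'⁻¹ * h with hv
    -- entrywise form of the change of basis
    have ent : ∀ (y : GL ((i : I) × Fin (α i)) K) (p e : (i : I) × Fin (α i) → Kˣ),
        ((h⁻¹ * y * h : GL _ K) : Matrix _ _ K) = Matrix.diagonal (fun a => (e a : K)) →
        (((h'⁻¹ * y * h' : GL _ K) : Matrix _ _ K) = Matrix.diagonal (fun a => (p a : K)) ↔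
          ∀ k a, (v : Matrix _ _ K) k a ≠ 0 → p k = e a) := by
      intro y p e he
      have e1 : h'⁻¹ * y * h' * v = v * (h⁻¹ * y * h) := by rw [hv]; group
      have e2 : ((h'⁻¹ * y * h' : GL _ K) : Matrix _ _ K) * (v : Matrix _ _ K) =
          (v : Matrix _ _ K) * Matrix.diagonal (fun a => (e a : K)) := by
        rw [← he, ← Units.val_mul, ← Units.val_mul, e1]
      constructor
      · intro hp k a hka
        rw [hp] at e2
        have := congrFun (congrFun e2 k) a
        rw [Matrix.mul_diagonal, Matrix.diagonal_mul, mul_comm] at this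
        exact Units.ext (mul_left_cancel₀ hka this)
      · intro hp
        have e3 : Matrix.diagonal (fun a => (p a : K)) * (v : Matrix _ _ K) =
            (v : Matrix _ _ K) * Matrix.diagonal (fun a => (e a : K)) := by
          ext k a
          rw [Matrix.mul_diagonal, Matrix.diagonal_mul, mul_comm]
          by_cases hka : (v : Matrix _ _ K) k a = 0
          · simp [hka]
          · rw [hp k a hka]
        rw [← e3] at e2
        have := congrArg (· * ((v⁻¹ : GL _ K) : Matrix _ _ K)) e2
        simpa [mul_assoc] using this
    have col : ∀ a, ∃ k,
        (v : Matrix ((i : I) × Fin (α i)) ((i : I) × Fin (α i)) K) k a ≠ 0 := by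
      intro a
      by_contra hcon
      push Not at hcon
      have hdet :
          (v : Matrix ((i : I) × Fin (α i)) ((i : I) × Fin (α i)) K).det ≠ 0 := (Matrix.isUnits_det_units v).ne_zero
      exact hdet (Matrix.det_eq_zero_of_column_eq_zero (A := (v : Matrix _ _ K)) a hcon)
    -- a generic element of `S'`
    obtain ⟨x0, hx0, hx0'⟩ := hS2' (h' * Matrix.GeneralLinearGroup.mkOfDetNeZero
      (Matrix.diagonal fun a => (z0 (f' a) : K))
      (by rw [Matrix.det_diagonal]; exact Finset.prod_ne_zero_iff.2 fun a _ => (z0 (f' a)).ne_zero)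
      * h'⁻¹) ⟨z0, by
        simp only [mul_assoc, inv_mul_cancel_left, inv_mul_cancel, mul_one]; rfl⟩
    obtain ⟨z, hz⟩ := (hS1 x0).1 (hle hx0)
    have hx0d : ((h'⁻¹ * blockEmb K α x0 * h' : GL _ K) : Matrix _ _ K) =
        Matrix.diagonal fun a => (z0 (f' a) : K) := by
      rw [hx0']
      simp only [mul_assoc, inv_mul_cancel_left, inv_mul_cancel, mul_one]; rfl
    have hE := (ent _ (fun a => z0 (f' a)) (fun a => z (f a)) hz).1 hx0d
    refine ⟨Setoid.ker fun a => z (f a), fun x => ⟨fun hx => ?_, ?_⟩⟩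
    · obtain ⟨w, hw⟩ := (hS1 x).1 (hle hx)
      obtain ⟨u, hu⟩ := (hS1' x).1 hx
      have hU := (ent _ (fun a => u (f' a)) (fun a => w (f a)) hw).1 hu
      refine ⟨fun a => w (f a), fun a b hab => ?_, hw⟩
      obtain ⟨k, hk⟩ := col a
      obtain ⟨l, hl⟩ := col b
      have h1 : z0 (f' k) = z0 (f' l) := by
        rw [hE k a hk, hE l b hl]; exact hab
      show w (f a) = w (f b)
      rw [← hU k a hk, ← hU l b hl]
      exact congrArg u (z0.injective h1)
    · rintro ⟨c, hc, hcx⟩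
      refine (hS1' x).2 ⟨fun m => if hm : ∃ a, z (f a) = z0 m then c hm.choose else 1, ?_⟩
      refine (ent _ (fun k => if hm : ∃ a, z (f a) = z0 (f' k) then c hm.choose else 1) c hcx).2 ?_
      intro k a hka
      have hm : ∃ a, z (f a) = z0 (f' k) := ⟨a, (hE k a hka).symm⟩
      rw [dif_pos hm]
      exact hc _ _ (hm.choose_spec.trans (hE k a hka))
  choose! r hr using key
  have : Finite (Setoid ((i : I) × Fin (α i))) := Finite.of_injective
    (fun r : Setoid ((i : I) × Fin (α i)) => fun a b => r a b)
    (fun r r' h => Setoid.ext fun a b => by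
      have := congrFun (congrFun h a) b
      exact iff_of_eq this)
  refine Set.Finite.of_injOn (f := r) (t := Set.univ) (fun _ _ => Set.mem_univ _) ?_ Set.finite_univ
  rintro S1 ⟨h1, h1'⟩ S2 ⟨h2, h2'⟩ hr12
  ext x
  rw [hr S1 h1 h1' x, hr S2 h2 h2' x, hr12]

variable {Fq K} in
theorem AdmTori.finite_Iic [Infinite K] {α : I →₀ ℕ} (S : AdmTori Fq K α) :
    (Set.Iic S).Finite := by
  refine ((finite_admissible_le S.2.1).preimage Subtype.val_injective.injOn).subset ?_
  intro S' hS'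
  exact ⟨S'.2.1, hS'⟩

instance AdmTori.locallyFinite [Infinite K] (α : I →₀ ℕ) : LocallyFiniteOrder (AdmTori Fq K α) :=
  LocallyFiniteOrder.ofFiniteIcc fun _ T => (AdmTori.finite_Iic T).subset Set.Icc_subset_Iic_self

end Tori

/-! ### The tori `S_ω` -/

section Blocks

variable {I : Type*} [Fintype I]

/-- The set `{1, …, r}` indexing the elements of the sequence `ω = (d₁, 𝛌₁)⋯(d_r, 𝛌_r)`. -/
abbrev Multitype.Block (ω : Multitype I) : Type _ := (x : ω.1.support) × Fin (ω.1 x.1)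

/-- The integer `d_j`. -/
def Multitype.d (ω : Multitype I) (j : ω.Block) : ℕ := j.1.1.1

/-- The dimension vector `β_j = |𝛌_j|`. -/
def Multitype.β (ω : Multitype I) (j : ω.Block) : I →₀ ℕ := msize j.1.1.2

/-- The index set of the rows of the `i`-th component of `∏_j (GL_{β_j})^{d_j}`, embedded block
diagonally in `GL_{|ω|}`: the index `(j, k, b)` is the `b`-th row of the `k`-th copy of
`GL_{(β_j)_i}`. -/
abbrev Multitype.Idx (ω : Multitype I) (i : I) : Type _ :=
  (j : ω.Block) × (Fin (ω.d j) × Fin (ω.β j i))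

theorem Multitype.card_idx (ω : Multitype I) (i : I) : Fintype.card (ω.Idx i) = ω.size i := by
  have h1 : ∀ j : ω.Block, Fintype.card (Fin (ω.d j) × Fin (ω.β j i)) = ω.d j * ω.β j i :=
    fun j => by simp
  have h0 : Fintype.card (ω.Idx i) = ∑ j : ω.Block, ω.d j * ω.β j i :=
    Fintype.card_sigma.trans (Finset.sum_congr rfl fun j _ => h1 j)
  have h2 : ∀ x : ω.1.support, ∑ y : Fin (ω.1 x.1), ω.d ⟨x, y⟩ * ω.β ⟨x, y⟩ i =
      ((x.1.1 * ω.1 x.1) • msize x.1.2) i := fun x => by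
    simp only [Multitype.d, Multitype.β, Finset.sum_const, Finset.card_univ, Fintype.card_fin,
      Finsupp.smul_apply, smul_eq_mul]
    ring
  rw [h0, Multitype.size, Finsupp.sum, Finsupp.finsetSum_apply,
    Fintype.sum_sigma (fun j : ω.Block => ω.d j * ω.β j i), Finset.sum_congr rfl fun x _ => h2 x]
  exact Finset.sum_coe_sort ω.1.support fun x => ((x.1 * ω.1 x) • msize x.2) i

/-- An enumeration of the rows of the block decomposition. The enumeration chosen matters only up
to conjugation by permutation matrices. -/
def Multitype.enum {α : I →₀ ℕ} (ω : Multitype I) (h : ω.size = α) (i : I) :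
    Fin (α i) ≃ ω.Idx i :=
  (Fintype.equivFinOfCardEq ((ω.card_idx i).trans (by rw [h]))).symm

/-- The permutation `σ` of the rows which, for each `j`, permutes cyclically the `d_j` copies of
`GL_{β_j}`: `(j, k, b) ↦ (j, k + 1, b)`. -/
def Multitype.shift (ω : Multitype I) (i : I) : Equiv.Perm (ω.Idx i) :=
  Equiv.sigmaCongrRight fun j => (finRotate (ω.d j)).prodCongr (Equiv.refl _)

/-- The permutation `σ`, acting on the rows of `GL_{α_i}`. -/
def Multitype.perm {α : I →₀ ℕ} (ω : Multitype I) (h : ω.size = α) (i : I) :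
    Equiv.Perm (Fin (α i)) :=
  ((ω.enum h i).trans (ω.shift i)).trans (ω.enum h i).symm

/-- The permutation matrix `J_σ`, with `J_σ e_b = e_{σ(b)}`. -/
def Multitype.J (K : Type*) [Field K] {α : I →₀ ℕ} (ω : Multitype I) (h : ω.size = α) (i : I) :
    Matrix (Fin (α i)) (Fin (α i)) K :=
  Matrix.of fun a b => if a = ω.perm h i b then 1 else 0

/-- The torus `Δ(∏_j (Z_{β_j})^{d_j})` of `GL_α`: the block diagonal matrices whose block `(j, k)`
is a scalar `z j k`, the same one for all `i`. -/
def Multitype.diagTorus (K : Type*) [Field K] {α : I →₀ ℕ} (ω : Multitype I) (h : ω.size = α) :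
    Subgroup (GLv K α) where
  carrier := {s | ∃ z : (j : ω.Block) → Fin (ω.d j) → Kˣ, ∀ i,
    (s i : Matrix (Fin (α i)) (Fin (α i)) K) =
      Matrix.diagonal fun a => (z (ω.enum h i a).1 (ω.enum h i a).2.1 : K)}
  one_mem' := ⟨fun _ _ => 1, fun i => by simp⟩
  mul_mem' := by
    rintro s t ⟨z, hz⟩ ⟨z', hz'⟩
    refine ⟨fun j k => z j k * z' j k, fun i => ?_⟩
    rw [Pi.mul_apply, Units.val_mul, hz, hz', Matrix.diagonal_mul_diagonal]
    simp
  inv_mem' := by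
    rintro s ⟨z, hz⟩
    refine ⟨fun j k => (z j k)⁻¹, fun i => ?_⟩
    refine Units.inv_eq_of_mul_eq_one_right ?_
    rw [hz, Matrix.diagonal_mul_diagonal]
    simp

/-- There is `x` in the field with `q^d` elements with `d` distinct conjugates. -/
theorem exists_cyclic (Fq K : Type*) [Field Fq] [Fintype Fq] [Field K] [Algebra Fq K]
    [IsAlgClosed K] {d : ℕ} (hd : 0 < d) : ∃ x : K, x ^ (Fintype.card Fq ^ d) = x ∧
      Function.Injective fun k : Fin d => x ^ (Fintype.card Fq ^ (k : ℕ)) := by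
  set q := Fintype.card Fq with hq
  have hq1 : 1 < q := Fintype.one_lt_card
  have hq0 : (q : K) = 0 := by
    have := congrArg (algebraMap Fq K) (FiniteField.cast_card_eq_zero Fq)
    rwa [map_natCast, map_zero] at this
  have hqd : 1 < q ^ d := Nat.one_lt_pow hd.ne' hq1
  have hne : NeZero ((q ^ d - 1 : ℕ) : K) := ⟨by
    rw [Nat.cast_sub hqd.le, Nat.cast_pow, hq0, zero_pow hd.ne']
    simp⟩
  obtain ⟨x, hx⟩ := HasEnoughRootsOfUnity.exists_primitiveRoot K (q ^ d - 1)
  refine ⟨x, ?_, ?_⟩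
  · have : q ^ d = (q ^ d - 1) + 1 := by omega
    rw [this, pow_succ, hx.pow_eq_one, one_mul]
  · intro k l hkl
    by_cases hd1 : d = 1
    · subst hd1; exact Subsingleton.elim _ _
    have hlt : ∀ m : Fin d, q ^ (m : ℕ) < q ^ d - 1 := by
      intro m
      have h1 : q ^ (m : ℕ) ≤ q ^ (d - 1) := Nat.pow_le_pow_right (by omega) (by omega)
      have h2 : q ^ d = q ^ (d - 1) * q := by rw [← pow_succ]; congr 1; omega
      have h3 : 1 < q ^ (d - 1) := Nat.one_lt_pow (by omega) hq1
      have h4 : q ^ (d - 1) * 2 ≤ q ^ (d - 1) * q := Nat.mul_le_mul_left _ hq1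
      omega
    exact Fin.ext (Nat.pow_right_injective hq1 (hx.pow_inj (hlt k) (hlt l) hkl))

theorem Multitype.d_pos (ω : Multitype I) (j : ω.Block) : 0 < ω.d j :=
  Nat.pos_of_ne_zero fun h => Finsupp.mem_support_iff.1 j.1.2 (by
    have := ω.2.1 j.1.1.2
    rwa [show ((0 : ℕ), j.1.1.2) = j.1.1 from Prod.ext h.symm rfl] at this)

variable (Fq K : Type*) [Field Fq] [Fintype Fq] [Field K] [Algebra Fq K] [IsAlgClosed K]

theorem frob_apply {α : I →₀ ℕ} (g : GLv K α) (i : I) (a b : Fin (α i)) :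
    ((frob Fq K α g i : GL (Fin (α i)) K) : Matrix (Fin (α i)) (Fin (α i)) K) a b =
      (g i : Matrix (Fin (α i)) (Fin (α i)) K) a b ^ Fintype.card Fq := rfl

/-- There is an element `g` of `GL_α` such that `g⁻¹ F(g) = J_σ`. -/
theorem exists_twist {α : I →₀ ℕ} (ω : Multitype I) (h : ω.size = α) :
    ∃ g : GLv K α, ∀ i, (((g⁻¹ * frob Fq K α g) i : GL (Fin (α i)) K) :
      Matrix (Fin (α i)) (Fin (α i)) K) = ω.J K h i := by
  classical
  choose x hx hx' using fun j : ω.Block => exists_cyclic Fq K (ω.d_pos j)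
  have hA : ∀ (i : I) (j : ω.Block), (Matrix.kroneckerMap (· * ·)
      (Matrix.vandermonde fun k : Fin (ω.d j) => x j ^ (Fintype.card Fq ^ (k : ℕ))).transpose
      (1 : Matrix (Fin (ω.β j i)) (Fin (ω.β j i)) K)).det ≠ 0 := by
    intro i j
    rw [Matrix.det_kronecker, Matrix.det_transpose, Matrix.det_one, one_pow, mul_one]
    exact pow_ne_zero _ (Matrix.det_vandermonde_ne_zero_iff.2 (hx' j))
  let G : (i : I) → GL (ω.Idx i) K := fun i =>
    Units.map (Matrix.blockDiagonal'RingHom (fun j => Fin (ω.d j) × Fin (ω.β j i)) K).toMonoidHom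
      (MulEquiv.piUnits.symm fun j => Matrix.GeneralLinearGroup.mkOfDetNeZero _ (hA i j))
  have hG : ∀ i p r, (G i : Matrix (ω.Idx i) (ω.Idx i) K) p r ^ Fintype.card Fq =
      (G i : Matrix (ω.Idx i) (ω.Idx i) K) p (ω.shift i r) := by
    rintro i ⟨j, k, b⟩ ⟨j', k', b'⟩
    have hG' : (G i : Matrix (ω.Idx i) (ω.Idx i) K) = Matrix.blockDiagonal' fun j =>
      Matrix.kroneckerMap (· * ·)
      (Matrix.vandermonde fun k : Fin (ω.d j) => x j ^ (Fintype.card Fq ^ (k : ℕ))).transpose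
      (1 : Matrix (Fin (ω.β j i)) (Fin (ω.β j i)) K) := rfl
    have hs : ω.shift i ⟨j', k', b'⟩ = ⟨j', finRotate (ω.d j') k', b'⟩ := rfl
    rw [hs, hG']
    by_cases hj : j = j'
    · subst hj
      rw [Matrix.blockDiagonal'_apply_eq, Matrix.blockDiagonal'_apply_eq]
      simp only [Matrix.kroneckerMap_apply, Matrix.transpose_apply, Matrix.vandermonde_apply]
      rw [mul_pow]
      congr 1
      · rw [pow_right_comm]
        congr 1
        rw [← pow_mul, ← pow_succ]
        have hgen : ∀ (e : ℕ) (k' : Fin e) (y : K), y ^ Fintype.card Fq ^ e = y →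
            y ^ Fintype.card Fq ^ ((k' : ℕ) + 1) =
              y ^ Fintype.card Fq ^ ((finRotate e k' : Fin e) : ℕ) := by
          intro e k' y hy
          obtain _ | e := e
          · exact k'.elim0
          rw [coe_finRotate]
          split_ifs with hl
          · subst hl; simpa using hy
          · rfl
        exact hgen _ k' _ (hx j)
      · by_cases hb : b = b'
        · subst hb; simp
        · simp [Matrix.one_apply_ne hb, Fintype.card_ne_zero]
    · rw [Matrix.blockDiagonal'_apply_ne _ _ _ hj, Matrix.blockDiagonal'_apply_ne _ _ _ hj,
        zero_pow Fintype.card_ne_zero]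
  let g : GLv K α := fun i =>
    Units.map (Matrix.reindexRingEquiv K (ω.enum h i).symm).toMonoidHom (G i)
  have hg : ∀ i a b, (g i : Matrix (Fin (α i)) (Fin (α i)) K) a b =
      (G i : Matrix (ω.Idx i) (ω.Idx i) K) (ω.enum h i a) (ω.enum h i b) := fun _ _ _ => rfl
  refine ⟨g, fun i => ?_⟩
  have e : ((frob Fq K α g i : GL (Fin (α i)) K) : Matrix (Fin (α i)) (Fin (α i)) K) =
      (g i : Matrix (Fin (α i)) (Fin (α i)) K) * ω.J K h i := by
    ext a b
    rw [frob_apply, Matrix.mul_apply]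
    simp only [Multitype.J, Matrix.of_apply, mul_ite, mul_one, mul_zero]
    rw [Finset.sum_ite_eq' Finset.univ (ω.perm h i b)]
    simp only [Finset.mem_univ, if_true]
    rw [hg, hg, hG]
    simp [Multitype.perm]
  rw [Pi.mul_apply, Units.val_mul, e, Pi.inv_apply, Units.inv_mul_cancel_left]

/-- An element `g_σ` of `GL_α` such that `g_σ⁻¹ F(g_σ) = J_σ`. -/
def Multitype.twist {α : I →₀ ℕ} (ω : Multitype I) (h : ω.size = α) : GLv K α :=
  (exists_twist Fq K ω h).choose

variable {K} in
theorem mul_frob_eq {α : I →₀ ℕ} (ω : Multitype I) (h : ω.size = α) (g s t : GLv K α)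
    (hg : ∀ i, (((g⁻¹ * frob Fq K α g) i : GL (Fin (α i)) K) :
      Matrix (Fin (α i)) (Fin (α i)) K) = ω.J K h i)
    (z z' : (j : ω.Block) → Fin (ω.d j) → Kˣ)
    (hs : ∀ i, (s i : Matrix (Fin (α i)) (Fin (α i)) K) =
      Matrix.diagonal fun a => (z (ω.enum h i a).1 (ω.enum h i a).2.1 : K))
    (ht : ∀ i, (t i : Matrix (Fin (α i)) (Fin (α i)) K) =
      Matrix.diagonal fun a => (z' (ω.enum h i a).1 (ω.enum h i a).2.1 : K))
    (hz : ∀ j k, z' j (finRotate _ k) = z j k ^ Fintype.card Fq) :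
    frob Fq K α (g * s * g⁻¹) = g * t * g⁻¹ := by
  have key : (g⁻¹ * frob Fq K α g) * frob Fq K α s = t * (g⁻¹ * frob Fq K α g) := by
    funext i
    refine Units.ext ?_
    have hF : ((frob Fq K α s i : GL (Fin (α i)) K) : Matrix (Fin (α i)) (Fin (α i)) K) =
        Matrix.diagonal fun a =>
          (z (ω.enum h i a).1 (ω.enum h i a).2.1 : K) ^ Fintype.card Fq := by
      ext a b
      rw [frob_apply, hs]
      by_cases hab : a = b
      · subst hab; simp
      · simp [Matrix.diagonal_apply_ne _ hab, Fintype.card_ne_zero]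
    rw [Pi.mul_apply (g⁻¹ * frob Fq K α g), Pi.mul_apply t, Units.val_mul, Units.val_mul, hg, hF,
      ht]
    ext a b
    rw [Matrix.mul_diagonal, Matrix.diagonal_mul]
    simp only [Multitype.J, Matrix.of_apply]
    by_cases hab : a = ω.perm h i b
    · rw [if_pos hab, one_mul, mul_one]
      have : ω.enum h i a = ω.shift i (ω.enum h i b) := by rw [hab]; simp [Multitype.perm]
      rw [this]
      exact (congrArg Units.val (hz _ _)).symm
    · rw [if_neg hab, zero_mul, mul_zero]
  have h1 : frob Fq K α g * frob Fq K α s = g * t * (g⁻¹ * frob Fq K α g) := by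
    have := congrArg (g * ·) key
    simpa [mul_assoc] using this
  rw [map_mul, map_mul, map_inv, h1]
  group

variable {K} in
theorem Multitype.exists_diag {α : I →₀ ℕ} (ω : Multitype I) (h : ω.size = α)
    (z : (j : ω.Block) → Fin (ω.d j) → Kˣ) : ∃ s : GLv K α, ∀ i,
      (s i : Matrix (Fin (α i)) (Fin (α i)) K) =
        Matrix.diagonal fun a => (z (ω.enum h i a).1 (ω.enum h i a).2.1 : K) :=
  ⟨fun i => Matrix.GeneralLinearGroup.mkOfDetNeZero
    (Matrix.diagonal fun a => (z (ω.enum h i a).1 (ω.enum h i a).2.1 : K)) (by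
      rw [Matrix.det_diagonal]
      exact Finset.prod_ne_zero_iff.2 fun a _ => Units.ne_zero _), fun i => rfl⟩

/-- For a multitype `ω` of size `α`, the torus `S_ω = ∏_j (Z_{β_j})_{d_j} ⊆ GL_α`, where
`(GL_{β_j})_{d_j}` is embedded in `GL_{d_j β_j}` by means of `g_σ Δ g_σ⁻¹`. -/
def stdTorus [DecidableEq I] {α : I →₀ ℕ} (ω : Multitype I) (h : ω.size = α) : AdmTori Fq K α :=
  ⟨(ω.diagTorus K h).map (MulAut.conj (ω.twist Fq K h)).toMonoidHom, by
    classical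
    set g := ω.twist Fq K h with hgdef
    have hg := (exists_twist Fq K ω h).choose_spec
    constructor
    · let lab : ((j : ω.Block) × Fin (ω.d j)) → ℕ := fun p => (Fintype.equivFin _ p : ℕ)
      have hlab : Function.Injective lab := fun p r hpr =>
        (Fintype.equivFin _).injective (Fin.ext hpr)
      let f : (i : I) × Fin (α i) → ℕ := fun p =>
        lab ⟨(ω.enum h p.1 p.2).1, (ω.enum h p.1 p.2).2.1⟩
      refine ⟨_, ⟨f, blockEmb K α g, rfl⟩, ?_⟩
      ext y
      rw [center_map_conj, mem_center_blockDiag]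
      constructor
      · rintro ⟨_, ⟨s, ⟨z, hz⟩, rfl⟩, rfl⟩
        have : (blockEmb K α g)⁻¹ * blockEmb K α ((MulAut.conj g).toMonoidHom s) *
            blockEmb K α g = blockEmb K α s := by
          simp [mul_assoc]
        refine ⟨Function.extend lab (fun p => z p.1 p.2) 1, ?_⟩
        rw [this, blockEmb_coe]
        simp only [hz]
        rw [Matrix.blockDiagonal'_diagonal]
        congr 1
        funext p
        rw [hlab.extend_apply]
      · rintro ⟨z, hz⟩
        obtain ⟨s, hs⟩ := ω.exists_diag (K := K) h fun j k => z (lab ⟨j, k⟩)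
        refine ⟨_, ⟨s, ⟨fun j k => z (lab ⟨j, k⟩), hs⟩, rfl⟩, ?_⟩
        have : blockEmb K α s = (blockEmb K α g)⁻¹ * y * blockEmb K α g := by
          refine Units.ext ?_
          rw [hz, blockEmb_coe]
          simp only [hs]
          rw [Matrix.blockDiagonal'_diagonal]
        simp [this, mul_assoc]
    · ext y
      constructor
      · rintro ⟨_, ⟨s, ⟨z, hz⟩, rfl⟩, rfl⟩
        obtain ⟨t, ht⟩ := ω.exists_diag (K := K) h
          fun j k => z j ((finRotate _).symm k) ^ Fintype.card Fq
        exact ⟨t, ⟨fun j k => z j ((finRotate _).symm k) ^ Fintype.card Fq, ht⟩,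
          (mul_frob_eq Fq ω h g s t hg z
            (fun j k => z j ((finRotate _).symm k) ^ Fintype.card Fq) hz ht
            (fun j k => by rw [Equiv.symm_apply_apply])).symm⟩
      · rintro ⟨t, ⟨z', ht⟩, rfl⟩
        have hroot : ∀ u : Kˣ, ∃ v : Kˣ, v ^ Fintype.card Fq = u := by
          intro u
          obtain ⟨v, hv⟩ := IsAlgClosed.exists_pow_nat_eq (u : K) (Fintype.card_pos (α := Fq))
          have hv0 : v ≠ 0 := by
            rintro rfl
            rw [zero_pow Fintype.card_ne_zero] at hv
            exact u.ne_zero hv.symm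
          exact ⟨Units.mk0 v hv0, Units.ext hv⟩
        choose root hroot using hroot
        obtain ⟨s, hs⟩ := ω.exists_diag (K := K) h fun j k => root (z' j (finRotate _ k))
        exact ⟨_, ⟨s, ⟨fun j k => root (z' j (finRotate _ k)), hs⟩, rfl⟩,
          mul_frob_eq Fq ω h g s t hg (fun j k => root (z' j (finRotate _ k))) z' hs ht
            (fun j k => (hroot _).symm)⟩⟩

/-- `S` and `S'` are conjugate under `GL_α(𝔽_q) = (GL_α)^F`. -/
def RationallyConj {α : I →₀ ℕ} (S S' : Subgroup (GLv K α)) : Prop :=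
  ∃ g : GLv K α, frob Fq K α g = g ∧ S' = S.map (MulAut.conj g).toMonoidHom

variable {Fq K}

open scoped Classical in
/-- The multitype `[S]` of an `F`-stable admissible subtorus `S` of `GL_α`: the semisimple
multitype of size `α` such that `S` is `GL_α(𝔽_q)`-conjugate to `S_{[S]}`. -/
def AdmTori.multitype [DecidableEq I] {α : I →₀ ℕ} (S : AdmTori Fq K α) : Multitype I :=
  if H : ∃ ν : Multitype I, ν.IsSemisimple ∧ ∃ h : ν.size = α,
    RationallyConj Fq K (stdTorus Fq K ν h).1 S.1 then H.choose else 0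

open scoped Classical in
/-- The Möbius function of the poset `𝒵_α`. -/
def mobius [DecidableEq I] {α : I →₀ ℕ} (S S' : AdmTori Fq K α) : ℤ :=
  IncidenceAlgebra.mu ℤ S S'

end Blocks

section Main

variable {I : Type*} [Fintype I] [DecidableEq I]
variable (Fq K : Type*) [Field Fq] [Fintype Fq] [Field K] [Algebra Fq K] [IsAlgClosed K]

instance fintypeOfSize (α : I →₀ ℕ) : Fintype {ω : Multitype I // ω.size = α} :=
  (finite_ofSize α).fintype

open scoped Classical in
/-- `F_{α,V}(t) = ∑_{ω ∈ 𝕋_α} F_ω(t) / w(ω) (∑_{S' ≤ S_ω, S' of level V} P_{[S']}(t) μ(S', S_ω))`. -/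
def levelSum (F : Multitype I → RatFunc ℚ) (V : Set (I →₀ ℕ)) (α : I →₀ ℕ) : RatFunc ℚ :=
  ∑ ω : {ω : Multitype I // ω.size = α}, F ω.1 / (ω.1.w : RatFunc ℚ) *
    ∑ S' ∈ (stdTorus Fq K ω.1 ω.2).finite_Iic.toFinset with S'.multitype.IsOfLevel V,
      S'.multitype.P * (mobius S' (stdTorus Fq K ω.1 ω.2) : RatFunc ℚ)

/-- `F_{α,gen}(t) = F_{α,{α}}(t)`. -/
def genSum (F : Multitype I → RatFunc ℚ) (α : I →₀ ℕ) : RatFunc ℚ := levelSum Fq K F {α} α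

end Main

end LogCompat

end

/-!
Both sides are determined by the types of their summands. A semisimple multitype is a multiplicity
function `n` on labels `(d, β)`; write `Θ_n(k) = ∏_j k_{β_j}(t^{d_j})` over its labels. For a
family `k` of rational functions, the coefficient of `y^α` in `Plexp(∑_{β ≠ 0} k_β y^β)` is
`pexp k α = ∑_{|n| = α} Θ_n(k) / w(n)` (`coeff_Plexp`). So it has to be shown that `F_{α,V}` is
`pexp k α` for the family `k` with `k_β = F_{β,gen}` if `β ∈ V` and `k_β = 0` otherwise.

*Geometry.* Let `X_ω` be the set of weight spaces of the torus `S_ω`, with the permutation defined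
by the Frobenius and with a dimension vector at each point. An `F`-stable admissible torus
contained in `S_ω` is given by an equivalence relation on `X_ω` compatible with this permutation
(`exists_label_of_le_stdTorus`), and it is rationally conjugate to `S_ν` if and only if the
quotient is isomorphic to `X_ν` (`IsLabelMap.exists_torus`, `exists_labelMap_of_rationallyConj`).
The construction of a rational conjugation from an isomorphism is an instance of Lang's theorem,
proved by linear algebra (`exists_frobenius_frame`). Hence every torus in `S_ω` has a multitype,
which depends only on its rational conjugacy class, and the number of tori of type `ν` in `S_ω` is
the number `N(ω, ν)` of label maps `X_ω → X_ν` divided by `w(ν)` (`card_tori_mul`,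
`card_labelMap_self`).

*Möbius inversion.* The inner sums of `F_{α,V}` therefore depend only on the semisimple type of
`ω`. Let `G(n)` be their common value for the type `n` (`levelCoeff`). Möbius inversion on `𝒵_α`
says that `∑_n G(n) N(m, n) / w(n)` is `P_m(t)` if `m` is of level `V`, and `0` otherwise
(`levelP_eq_sum`).

*Generating functions.* Counting label maps cycle by cycle gives
`∑_m Θ_m(f) / w(m) · N(m, n) = Θ_n(pexp f)` (`sum_card_labelMap`), so that
`∑_n G(n) Θ_n(pexp f) / w(n) = pexp((t - 1) f 1_V)` (`sum_levelCoeff_pexp`). On the other hand, a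
Log compatible family is determined by its values at the multitypes `(1, 𝛌)`, and grouping the
multitypes `ω` by their semisimple type gives `F_{α,V} = ∑_n G(n) Θ_n(h) / w(n)` with `h_β` the
sum of the `F_{(1, 𝛌)}` over `|𝛌| = β` (`LogCompatible.levelSum_eq_sum`). Choose `f` with
`pexp f β = h_β` for all `β ≠ 0` (`exists_pexp_eq`). Then `F_{α,V} = pexp((t - 1) f 1_V) α`; for
`V = {β}` only the type `(1, β)` contributes, so that `F_{β,gen} = (t - 1) f_β`, and the theorem
follows.
-/

noncomputable section

namespace LogCompat

/-! ### Types of finite families and the multinomial formula -/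

section Families

variable {B B' L L' : Type*} [Fintype B] [Fintype B']

/-- The type of a finite family `x : B → L`: the multiset of its values, as a finitely supported
function. -/
def famType (x : B → L) : L →₀ ℕ := ∑ b, Finsupp.single (x b) 1

theorem famType_apply (x : B → L) (l : L) : famType x l = Nat.card {b // x b = l} := by
  classical
  rw [famType, Finsupp.finsetSum_apply, Nat.card_eq_fintype_card, Fintype.card_subtype]
  simp [Finsupp.single_apply]

theorem famType_comp_equiv (x : B → L) (e : B' ≃ B) : famType (fun b => x (e b)) = famType x :=
  e.sum_comp fun b => Finsupp.single (x b) 1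

theorem mapDomain_famType (x : B → L) (p : L → L') :
    (famType x).mapDomain p = famType fun b => p (x b) := by
  simp [famType, Finsupp.mapDomain_finsetSum, Finsupp.mapDomain_single]

theorem famType_prod {R : Type*} [CommMonoid R] (x : B → L) (h : L → R) :
    ((famType x).prod fun l m => h l ^ m) = ∏ b, h (x b) := by
  classical
  rw [famType, ← Finsupp.prod_finsetSum_index (by simp) (by simp [pow_add])]
  simp

theorem famType_sum {R : Type*} [AddCommMonoid R] (x : B → L) (h : L → R) :
    ((famType x).sum fun l m => m • h l) = ∑ b, h (x b) := by
  classical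
  rw [famType, ← Finsupp.sum_finsetSum_index (by simp) (by simp [add_smul])]
  simp

/-- Two families have the same type if and only if they differ by a reindexing. -/
theorem famType_eq_iff (x : B → L) (y : B' → L) :
    famType x = famType y ↔ ∃ e : B ≃ B', ∀ b, y (e b) = x b := by
  classical
  constructor
  · intro h
    have hc : ∀ l, Nonempty ({b // x b = l} ≃ {b // y b = l}) := fun l => by
      have := DFunLike.congr_fun h l
      rw [famType_apply, famType_apply] at this
      exact ⟨Fintype.equivOfCardEq (by
        rwa [Nat.card_eq_fintype_card, Nat.card_eq_fintype_card] at this)⟩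
    have e := fun l => (hc l).some
    refine ⟨(Equiv.sigmaFiberEquiv x).symm.trans
      ((Equiv.sigmaCongrRight e).trans (Equiv.sigmaFiberEquiv y)), fun b => ?_⟩
    exact (e (x b) ⟨b, rfl⟩).2
  · rintro ⟨e, he⟩
    rw [← famType_comp_equiv y e]
    simp [he]

/-- A finitely supported function `n` is the type of a family indexed by the disjoint union of the
sets `{1, …, n(l)}`. -/
theorem famType_sigma (n : L →₀ ℕ) :
    famType (fun b : (l : n.support) × Fin (n l) => (b.1 : L)) = n := by
  classical
  rw [famType, Fintype.sum_sigma]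
  simp only [Finset.sum_const, Finset.card_univ, Fintype.card_fin, Finsupp.smul_single,
    smul_eq_mul, mul_one]
  exact (Finset.sum_coe_sort n.support fun l => Finsupp.single l (n l)).trans n.sum_single

/-- The product `∏ n(l)!`. -/
def facto (n : L →₀ ℕ) : ℕ := n.prod fun _ m => m !

theorem facto_ne_zero (n : L →₀ ℕ) : facto n ≠ 0 :=
  Finset.prod_ne_zero_iff.2 fun _ _ => Nat.factorial_ne_zero _

/-- The stabilizer of a family under reindexing is a product of symmetric groups. -/
theorem card_perm_comp_eq [DecidableEq B] [DecidableEq L] (x : B → L) :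
    (Finset.univ.filter fun g : Equiv.Perm B => (fun b => x (g b)) = x).card =
      facto (famType x) := by
  have h := DomMulAct.stabilizer_card' (f := x)
  rw [Fintype.card_subtype] at h
  refine h.trans ?_
  have hs : (famType x).support = Finset.univ.image x := by
    ext l
    rw [Finsupp.mem_support_iff, famType_apply, Nat.card_ne_zero,
      and_iff_left (inferInstance : Finite {b // x b = l})]
    simp
  rw [facto, Finsupp.prod, hs]
  refine Finset.prod_congr rfl fun l _ => ?_
  rw [famType_apply, Nat.card_eq_fintype_card]

theorem exists_lift_famType (x : B → L) (p : L' → L) (n : L' →₀ ℕ)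
    (h : n.mapDomain p = famType x) : ∃ y : B → L', famType y = n ∧ ∀ b, p (y b) = x b := by
  rw [← famType_sigma n, mapDomain_famType, eq_comm, famType_eq_iff] at h
  obtain ⟨e, he⟩ := h
  exact ⟨fun b => (e b).1.1, (famType_comp_equiv
    (fun c : (l : n.support) × Fin (n l) => (c.1 : L')) e).trans (famType_sigma n), he⟩

/-- The number of families of the same type as `y₀` whose values lie in prescribed sets `fib (x b)`,
where the sets `fib l` are disjoint. -/
theorem card_lifts [DecidableEq B] [DecidableEq L'] (x : B → L) (p : L' → L) (fib : L → Finset L')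
    (hfib : ∀ l, ∀ l' ∈ fib l, p l' = l) (y₀ : B → L') (h : ∀ b, y₀ b ∈ fib (x b)) :
    ((Fintype.piFinset fun b => fib (x b)).filter fun y => famType y = famType y₀).card *
      facto (famType y₀) = facto (famType x) := by
  classical
  have hp : ∀ b, p (y₀ b) = x b := fun b => hfib _ _ (h b)
  rw [← card_perm_comp_eq x]
  have hmap : ∀ g ∈ (Finset.univ.filter fun g : Equiv.Perm B => (fun b => x (g b)) = x),
      (fun b => y₀ (g b)) ∈
        (Fintype.piFinset fun b => fib (x b)).filter fun y => famType y = famType y₀ := by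
    intro g hg
    rw [Finset.mem_filter] at hg ⊢
    refine ⟨Fintype.mem_piFinset.2 fun b => ?_, famType_comp_equiv y₀ g⟩
    rw [← congrFun hg.2 b]
    exact h (g b)
  rw [Finset.card_eq_sum_card_fiberwise hmap, Finset.sum_const_nat]
  intro y hy
  rw [Finset.mem_filter] at hy
  obtain ⟨g₀, hg₀⟩ := (famType_eq_iff y y₀).1 hy.2
  have hy' : ∀ b, p (y b) = x b := fun b => hfib _ _ (Fintype.mem_piFinset.1 hy.1 b)
  rw [← card_perm_comp_eq y₀]
  -- right translation by `g₀` identifies the fibre over `y` with the stabiliser of `y₀`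
  refine Finset.card_bij' (fun g _ => g * g₀⁻¹) (fun g _ => g * g₀) ?_ ?_ ?_ ?_
  · intro g hg
    simp only [Finset.mem_filter, Finset.mem_univ, true_and] at hg ⊢
    funext b
    have h1 := congrFun hg.2 (g₀⁻¹ b)
    have h2 := hg₀ (g₀⁻¹ b)
    simp only [Equiv.Perm.coe_mul, Function.comp_apply]
    rw [h1, ← h2]
    simp
  · intro g hg
    simp only [Finset.mem_filter, Finset.mem_univ, true_and] at hg ⊢
    have h3 : (fun b => y₀ ((g * g₀) b)) = y := by
      funext b
      exact (congrFun hg (g₀ b)).trans (hg₀ b)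
    refine ⟨?_, h3⟩
    funext b
    rw [← hp, ← hy' b]
    exact congrArg p (congrFun h3 b)
  · intro g _
    simp
  · intro g _
    simp

/-- The types of the lifts of a family along a map with finite fibres. -/
theorem mem_image_famType [DecidableEq B] [DecidableEq L'] (x : B → L) (p : L' → L)
    (fib : L → Finset L') (hfib : ∀ l l', l' ∈ fib l ↔ p l' = l) (n : L' →₀ ℕ) :
    (n ∈ (Fintype.piFinset fun b => fib (x b)).image famType) ↔ n.mapDomain p = famType x := by
  rw [Finset.mem_image]
  constructor
  · rintro ⟨y, hy, rfl⟩
    rw [mapDomain_famType]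
    congr 1
    funext b
    exact (hfib _ _).1 (Fintype.mem_piFinset.1 hy b)
  · intro h
    obtain ⟨y, hy, hp⟩ := exists_lift_famType x p n h
    exact ⟨y, Fintype.mem_piFinset.2 fun b => (hfib _ _).2 (hp b), hy⟩

/-- A sum over the types of the lifts of a family, weighted by the inverse factorials, is a sum over
the lifts. -/
theorem sum_lifts {R : Type*} [Field R] [CharZero R] [DecidableEq B] [DecidableEq L']
    (x : B → L) (p : L' → L) (fib : L → Finset L')
    (hfib : ∀ l, ∀ l' ∈ fib l, p l' = l) (H : (L' →₀ ℕ) → R) :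
    ∑ n ∈ (Fintype.piFinset fun b => fib (x b)).image famType, H n / facto n =
      (∑ y ∈ Fintype.piFinset fun b => fib (x b), H (famType y)) / facto (famType x) := by
  rw [← Finset.sum_fiberwise_of_maps_to (fun y hy => Finset.mem_image_of_mem famType hy),
    Finset.sum_div]
  refine Finset.sum_congr rfl fun n hn => ?_
  obtain ⟨y₀, hy₀, rfl⟩ := Finset.mem_image.1 hn
  have hc := card_lifts x p fib hfib y₀ (Fintype.mem_piFinset.1 hy₀)
  rw [Finset.sum_congr rfl fun y hy => by rw [(Finset.mem_filter.1 hy).2], Finset.sum_const,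
    nsmul_eq_mul, ← hc, Nat.cast_mul]
  have h1 : (facto (famType y₀) : R) ≠ 0 := Nat.cast_ne_zero.2 (facto_ne_zero _)
  have h2 : (((Fintype.piFinset fun b => fib (x b)).filter
      fun y => famType y = famType y₀).card : R) ≠ 0 :=
    Nat.cast_ne_zero.2 fun h0 => facto_ne_zero (famType x) (by rw [← hc, h0, zero_mul])
  field_simp

/-- The multinomial formula for a push-forward. -/
theorem sum_prod_pow_lifts {R : Type*} [Field R] [CharZero R] [DecidableEq B] [DecidableEq L']
    (x : B → L) (p : L' → L) (fib : L → Finset L')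
    (hfib : ∀ l, ∀ l' ∈ fib l, p l' = l) (a : L' → R) :
    ∑ n ∈ (Fintype.piFinset fun b => fib (x b)).image famType,
      (n.prod fun l m => a l ^ m) / facto n =
      (∏ b, ∑ l ∈ fib (x b), a l) / facto (famType x) := by
  rw [sum_lifts x p fib hfib, Finset.prod_univ_sum]
  simp only [famType_prod]

/-- There are finitely many finitely supported functions of a given weight, if the weights of the
labels are nonzero and finitely many labels have a weight below a given bound. -/
theorem finite_weight_eq {I : Type*} (s : L → I →₀ ℕ) (hs : ∀ l, s l ≠ 0)
    (hf : ∀ α, {l | s l ≤ α}.Finite) (α : I →₀ ℕ) :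
    {n : L →₀ ℕ | (n.sum fun l m => m • s l) = α}.Finite := by
  classical
  refine (Set.finite_Iic (Finsupp.indicator (hf α).toFinset fun _ _ => α.degree)).subset ?_
  intro n hn l
  by_cases hl : n l = 0
  · rw [hl]; exact Nat.zero_le _
  have h1 : n l • s l ≤ α := by
    rw [← (hn : _ = α)]
    exact Finset.single_le_sum (f := fun l => n l • s l) (fun _ _ => zero_le)
      (Finsupp.mem_support_iff.2 hl)
  have h2 : s l ≤ α := le_trans (by
    conv_lhs => rw [← one_smul ℕ (s l)]
    exact smul_le_smul_of_nonneg_right (Nat.one_le_iff_ne_zero.2 hl) zero_le) h1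
  rw [Finsupp.indicator_of_mem ((hf α).mem_toFinset.2 h2)]
  obtain ⟨i, hi⟩ := Finsupp.ne_iff.1 (hs l)
  have h3 : n l * s l i ≤ α i := h1 i
  have h4 : α i ≤ α.degree := Finsupp.le_degree i α
  have h5 : 1 ≤ s l i := Nat.one_le_iff_ne_zero.2 hi
  nlinarith [Nat.mul_le_mul_left (n l) h5]

end Families

/-! ### Plethystic exponentials -/

section Exponential

variable {I L : Type*}

/-- The coefficients of the exponential of a power series written as a sum of monomials
`a(l) y^{s(l)}`. -/
theorem coeff_exp_subst {R : Type*} [Field R] [CharZero R] [Algebra ℚ R]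
    (s : L → I →₀ ℕ) (hs : ∀ l, s l ≠ 0)
    (hf : ∀ α, {l | s l ≤ α}.Finite) (a : L → R) (f : MvPowerSeries I R)
    (hfa : ∀ γ (A : Finset L), (∀ l, l ∈ A ↔ s l = γ) → MvPowerSeries.coeff γ f = ∑ l ∈ A, a l)
    (α : I →₀ ℕ) :
    MvPowerSeries.coeff α ((PowerSeries.exp R).subst f) =
      ∑ n ∈ (finite_weight_eq s hs hf α).toFinset, (n.prod fun l m => a l ^ m) / facto n := by
  classical
  have hf0 : MvPowerSeries.constantCoeff f = 0 := by
    rw [← MvPowerSeries.coeff_zero_eq_constantCoeff_apply, hfa 0 ∅ (by simpa using hs)]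
    simp
  have hsub : PowerSeries.HasSubst f := PowerSeries.HasSubst.of_constantCoeff_zero hf0
  rw [PowerSeries.coeff_subst hsub]
  set S := (finite_weight_eq s hs hf α).toFinset with hS
  set T := (hf α).toFinset with hT
  have hST : ∀ n ∈ S, ∀ l ∈ n.support, l ∈ T := by
    intro n hn l hl
    have hn' : (n.sum fun l m => m • s l) = α :=
      (finite_weight_eq s hs hf α).mem_toFinset.1 hn
    have h1 : n l • s l ≤ α := by
      rw [← hn']
      exact Finset.single_le_sum (f := fun l => n l • s l) (fun _ _ => zero_le) hl
    refine (hf α).mem_toFinset.2 (le_trans ?_ h1)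
    conv_lhs => rw [← one_smul ℕ (s l)]
    exact smul_le_smul_of_nonneg_right
      (Nat.one_le_iff_ne_zero.2 (Finsupp.mem_support_iff.1 hl)) zero_le
  -- in degree `α` the series `f` may be replaced by the sum of its monomials of degree `≤ α`
  have hpow : ∀ k, MvPowerSeries.coeff α (f ^ k) =
      ∑ y ∈ Fintype.piFinset fun _ : Fin k => T,
        if ∑ b, s (y b) = α then ∏ b, a (y b) else 0 := by
    intro k
    have h1 : MvPowerSeries.coeff α (f ^ k) =
        MvPowerSeries.coeff α ((∑ l ∈ T, MvPowerSeries.monomial (s l) (a l)) ^ k) := by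
      rw [MvPowerSeries.coeff_pow, MvPowerSeries.coeff_pow]
      refine Finset.sum_congr rfl fun g hg => Finset.prod_congr rfl fun i hi => ?_
      rw [Finset.mem_finsuppAntidiag] at hg
      have hgi : g i ≤ α := by
        rw [← hg.1]
        exact Finset.single_le_sum (f := g) (fun _ _ => zero_le) hi
      rw [hfa (g i) (T.filter fun l => s l = g i) (fun l => by
        rw [Finset.mem_filter, hT, Set.Finite.mem_toFinset]
        exact ⟨fun h => h.2, fun h => ⟨(h ▸ hgi : s l ≤ α), h⟩⟩)]
      rw [map_sum, Finset.sum_filter]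
      refine Finset.sum_congr rfl fun l _ => ?_
      rw [MvPowerSeries.coeff_monomial]
      simp only [eq_comm]
    rw [h1, ← Fin.prod_const, Finset.prod_univ_sum, map_sum]
    refine Finset.sum_congr rfl fun y _ => ?_
    rw [MvPowerSeries.prod_monomial, MvPowerSeries.coeff_monomial]
    simp only [eq_comm]
  -- the types of the families of length `k` are the `n` of degree `k`
  have hk : ∀ k : ℕ, (PowerSeries.coeff k) (PowerSeries.exp R) • MvPowerSeries.coeff α (f ^ k) =
      ∑ n ∈ S.filter (fun n => n.degree = k), (n.prod fun l m => a l ^ m) / facto n := by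
    intro k
    have h2 := sum_lifts (R := R) (fun _ : Fin k => ()) (fun _ : L => ()) (fun _ => T)
      (fun _ _ _ => rfl)
      (fun n => if (n.sum fun l m => m • s l) = α then n.prod fun l m => a l ^ m else 0)
    simp only [famType_prod, famType_sum] at h2
    rw [← hpow] at h2
    have h3 : facto (famType fun _ : Fin k => ()) = k ! := by
      have : (famType fun _ : Fin k => ()) = Finsupp.single () k := by
        simp [famType]
      rw [this, facto, Finsupp.prod_single_index (by simp)]
    rw [PowerSeries.coeff_exp, smul_eq_mul, one_div, map_inv₀, map_natCast, mul_comm,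
      ← div_eq_mul_inv, ← h3, ← h2]
    simp only [ite_div, zero_div]
    rw [← Finset.sum_filter]
    refine Finset.sum_congr ?_ fun _ _ => rfl
    ext n
    rw [Finset.mem_filter, Finset.mem_filter, hS, Set.Finite.mem_toFinset, and_comm]
    refine and_congr_right fun hn => ?_
    rw [Finset.mem_image]
    constructor
    · rintro ⟨y, -, rfl⟩
      simp [famType, Finsupp.degree_single]
    · intro hd
      have hc : Fintype.card ((l : n.support) × Fin (n l)) = k := by
        rw [Fintype.card_sigma]
        simp only [Fintype.card_fin]
        rw [← hd, Finsupp.degree_apply]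
        exact Finset.sum_coe_sort n.support n
      let e := (Fintype.equivFinOfCardEq hc).symm
      refine ⟨fun b => (e b).1.1, Fintype.mem_piFinset.2 fun b => ?_, ?_⟩
      · exact hST n ((Set.Finite.mem_toFinset _).2 hn) _ (e b).1.2
      · exact (famType_comp_equiv (fun c : (l : n.support) × Fin (n l) => (c.1 : L)) e).trans
          (famType_sigma n)
  simp only [hk]
  rw [finsum_eq_sum_of_support_subset (s := S.image fun n => n.degree)]
  · exact Finset.sum_fiberwise_of_maps_to (fun n hn => Finset.mem_image_of_mem _ hn) _
  · intro k hk'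
    obtain ⟨n, hn, -⟩ := Finset.exists_ne_zero_of_sum_ne_zero hk'
    rw [Finset.mem_filter] at hn
    exact Finset.mem_coe.2 (Finset.mem_image.2 ⟨n, hn.1, hn.2⟩)

end Exponential

section SemisimpleTypes

variable {I : Type*}

variable (I) in
/-- The labels `(d, β)` with `d ≥ 1` and `β ≠ 0`, standing for `(d, (1^β))`. -/
abbrev Lab : Type _ := ℕ+ × {β : I →₀ ℕ // β ≠ 0}

/-- The size `dβ` of the label `(d, β)`. -/
def Lab.size (x : Lab I) : I →₀ ℕ := (x.1 : ℕ) • x.2.1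

theorem pnat_smul_ne_zero (d : ℕ+) {β : I →₀ ℕ} (h : β ≠ 0) : (d : ℕ) • β ≠ 0 :=
  smul_ne_zero d.ne_zero h

theorem Lab.size_ne_zero (x : Lab I) : x.size ≠ 0 := pnat_smul_ne_zero x.1 x.2.2

theorem finite_pnat_smul_le {Λ : Type*} (s : Λ → I →₀ ℕ) (hs : ∀ l, s l ≠ 0)
    (hf : ∀ α, {l | s l ≤ α}.Finite) (α : I →₀ ℕ) :
    {x : ℕ+ × Λ | (x.1 : ℕ) • s x.2 ≤ α}.Finite := by
  have h1 : {d : ℕ+ | (d : ℕ) ≤ α.degree}.Finite :=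
    (Set.finite_Iic α.degree).preimage PNat.coe_injective.injOn
  refine (h1.prod (hf α)).subset ?_
  rintro ⟨d, l⟩ h
  have hd := d.pos
  obtain ⟨i, hi⟩ := Finsupp.ne_iff.1 (hs l)
  have hi' : 0 < s l i := Nat.pos_of_ne_zero hi
  have h2 : ∀ k, (d : ℕ) * s l k ≤ α k := fun k => h k
  refine ⟨?_, fun k => ?_⟩
  · exact (Nat.le_mul_of_pos_right _ hi').trans ((h2 i).trans (Finsupp.le_degree i α))
  · exact (Nat.le_mul_of_pos_left _ hd).trans (h2 k)

theorem Lab.finite_size_le (α : I →₀ ℕ) : {x : Lab I | x.size ≤ α}.Finite := by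
  classical
  exact finite_pnat_smul_le (fun β : {β : I →₀ ℕ // β ≠ 0} => β.1) (fun β => β.2)
    (fun α => (Set.finite_Iic α).preimage Subtype.val_injective.injOn) α

variable (I) in
/-- Semisimple multitypes `(d₁, (1^{β₁}))⋯(d_r, (1^{β_r}))`, as multiplicity functions of the labels
`(d, β)`. -/
abbrev SType : Type _ := Lab I →₀ ℕ

/-- The size `∑ d_j β_j`. -/
def SType.size (n : SType I) : I →₀ ℕ := n.sum fun x m => m • x.size

/-- The number `w(n) = ∏ d^{n(d, β)} n(d, β)!`. -/
def SType.W (n : SType I) : ℕ := n.prod fun x m => (x.1 : ℕ) ^ m * m !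

/-- The semisimple types of size `α`. -/
def stypes (α : I →₀ ℕ) : Finset (SType I) :=
  (finite_weight_eq Lab.size Lab.size_ne_zero Lab.finite_size_le α).toFinset

theorem mem_stypes {α : I →₀ ℕ} {n : SType I} : n ∈ stypes α ↔ n.size = α :=
  Set.Finite.mem_toFinset _

/-- The product `∏_j k_{β_j}(t^{d_j})` over a semisimple type `(d₁, β₁)⋯(d_r, β_r)`. -/
def SType.Theta (n : SType I) (k : (I →₀ ℕ) → RatFunc ℚ) : RatFunc ℚ :=
  n.prod fun x m => adams x.1 (k x.2.1) ^ m

/-- The coefficients of the plethystic exponential of `∑_{β ≠ 0} k_β y^β`. -/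
def pexp (k : (I →₀ ℕ) → RatFunc ℚ) (α : I →₀ ℕ) : RatFunc ℚ :=
  ∑ n ∈ stypes α, n.Theta k / n.W

theorem SType.W_eq (n : SType I) : (n.W : RatFunc ℚ) =
    (n.prod fun x m => ((x.1 : ℕ) : RatFunc ℚ) ^ m) * (facto n : RatFunc ℚ) := by
  rw [SType.W, facto, Finsupp.prod, Finsupp.prod, Finsupp.prod, Finset.prod_mul_distrib]
  push_cast
  rfl

theorem SType.Theta_div_W (n : SType I) (k : (I →₀ ℕ) → RatFunc ℚ) :
    n.Theta k / n.W = (n.prod fun x m =>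
      (((x.1 : ℕ) : RatFunc ℚ)⁻¹ * adams x.1 (k x.2.1)) ^ m) / facto n := by
  rw [SType.W_eq, SType.Theta, ← div_div]
  congr 1
  rw [Finsupp.prod, Finsupp.prod, Finsupp.prod, ← Finset.prod_div_distrib]
  refine Finset.prod_congr rfl fun x _ => ?_
  rw [← div_pow, div_eq_inv_mul]

theorem coeff_psiSeries_smul (d : ℕ+) (f : MvPowerSeries I (RatFunc ℚ)) (β : I →₀ ℕ) :
    MvPowerSeries.coeff ((d : ℕ) • β) (psiSeries d f) = adams d (MvPowerSeries.coeff β f) := by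
  rw [psiSeries, MvPowerSeries.coeff_expand_smul, MvPowerSeries.coeff_map]

theorem coeff_psiSeries_ne_zero (d : ℕ+) (f : MvPowerSeries I (RatFunc ℚ)) (γ : I →₀ ℕ)
    (h : MvPowerSeries.coeff γ (psiSeries d f) ≠ 0) : ∃ β, (d : ℕ) • β = γ := by
  have h1 : ∀ i, (d : ℕ) ∣ γ i := by
    intro i
    by_contra hi
    exact h (MvPowerSeries.coeff_expand_of_not_dvd _ d.ne_zero _ hi)
  refine ⟨γ.mapRange (fun m => m / (d : ℕ)) (Nat.zero_div _), ?_⟩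
  ext i
  simp [Nat.mul_div_cancel' (h1 i)]

/-- The coefficients of `∑_n ψ_n(f) / n`. -/
theorem coeff_psiSum (f : MvPowerSeries I (RatFunc ℚ)) (hf : MvPowerSeries.coeff 0 f = 0)
    (γ : I →₀ ℕ) (A : Finset (Lab I)) (hA : ∀ x, x ∈ A ↔ x.size = γ) :
    MvPowerSeries.coeff γ (psiSum f) =
      ∑ x ∈ A, ((x.1 : ℕ) : RatFunc ℚ)⁻¹ * adams x.1 (MvPowerSeries.coeff x.2.1 f) := by
  classical
  have h0 : MvPowerSeries.coeff γ (psiSum f) =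
    ∑ᶠ n : ℕ+, ((n : ℕ) : RatFunc ℚ)⁻¹ * MvPowerSeries.coeff γ (psiSeries n f) := rfl
  have hinj : Set.InjOn (fun x : Lab I => x.1) A := by
    rintro ⟨d, β, hβ⟩ hx ⟨d', β', hβ'⟩ hx' (rfl : d = d')
    have h1 : (d : ℕ) • β = (d : ℕ) • β' := ((hA _).1 hx).trans ((hA _).1 hx').symm
    have h2 : β = β' := smul_right_injective _ d.ne_zero h1
    subst h2
    rfl
  rw [h0, finsum_eq_sum_of_support_subset (s := A.image fun x => x.1), Finset.sum_image hinj]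
  · refine Finset.sum_congr rfl fun x hx => ?_
    rw [← (hA x).1 hx, Lab.size, coeff_psiSeries_smul]
  · intro n hn
    have hn' : MvPowerSeries.coeff γ (psiSeries n f) ≠ 0 := right_ne_zero_of_mul hn
    obtain ⟨β, rfl⟩ := coeff_psiSeries_ne_zero n f γ hn'
    have hβ : β ≠ 0 := by
      rintro rfl
      rw [coeff_psiSeries_smul, hf, map_zero] at hn'
      exact hn' rfl
    exact Finset.mem_coe.2 (Finset.mem_image.2 ⟨(n, ⟨β, hβ⟩), (hA _).2 rfl, rfl⟩)

/-- The coefficients of the plethystic exponential. -/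
theorem coeff_Plexp (f : MvPowerSeries I (RatFunc ℚ)) (hf : MvPowerSeries.coeff 0 f = 0)
    (α : I →₀ ℕ) :
    MvPowerSeries.coeff α (Plexp f) = pexp (fun β => MvPowerSeries.coeff β f) α := by
  rw [Plexp, coeff_exp_subst Lab.size Lab.size_ne_zero Lab.finite_size_le
    (fun x => ((x.1 : ℕ) : RatFunc ℚ)⁻¹ * adams x.1 (MvPowerSeries.coeff x.2.1 f)) _
    (coeff_psiSum f hf)]
  exact Finset.sum_congr rfl fun n _ => (SType.Theta_div_W n _).symm

theorem Theta_congr (n : SType I) {k k' : (I →₀ ℕ) → RatFunc ℚ}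
    (h : ∀ x ∈ n.support, k x.2.1 = k' x.2.1) : n.Theta k = n.Theta k' :=
  Finset.prod_congr rfl fun x hx => by
    show adams x.1 _ ^ _ = adams x.1 _ ^ _
    rw [h x hx]

theorem pexp_congr {k k' : (I →₀ ℕ) → RatFunc ℚ} (h : ∀ β, β ≠ 0 → k β = k' β) (α : I →₀ ℕ) :
    pexp k α = pexp k' α :=
  Finset.sum_congr rfl fun n _ => by rw [Theta_congr n fun x _ => h _ x.2.2]

/-- The type `(1, β)`. -/
def SType.one {β : I →₀ ℕ} (h : β ≠ 0) : SType I := Finsupp.single (1, ⟨β, h⟩) 1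

theorem SType.one_mem {β : I →₀ ℕ} (h : β ≠ 0) : SType.one h ∈ stypes β := by
  rw [mem_stypes, SType.size, SType.one, Finsupp.sum_single_index (by simp)]
  simp [Lab.size]

theorem adams_algebraMap (d : ℕ+) (p : Polynomial ℚ) :
    adams d (algebraMap _ _ p) = algebraMap _ _ (Polynomial.expand ℚ d p) := by
  rw [adams, RatFunc.coe_mapRingHom_eq_coe_map]
  have := RatFunc.map_apply_div_ne_zero (Polynomial.expand ℚ (d : ℕ)).toRingHom
    (nonZeroDivisors_le_comap_nonZeroDivisors_of_injective _
      (Polynomial.expand_injective d.pos)) p 1 one_ne_zero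
  simpa using this

theorem adams_mul (d e : ℕ+) (r : RatFunc ℚ) : adams (d * e) r = adams d (adams e r) := by
  have : adams (d * e) = (adams d).comp (adams e) := by
    refine IsLocalization.ringHom_ext (nonZeroDivisors (Polynomial ℚ)) (RingHom.ext fun p => ?_)
    simp only [RingHom.comp_apply, adams_algebraMap]
    rw [PNat.mul_coe, Polynomial.expand_mul]
  rw [this]
  rfl

theorem adams_one (r : RatFunc ℚ) : adams 1 r = r := by
  have : adams 1 = RingHom.id _ := by
    refine IsLocalization.ringHom_ext (nonZeroDivisors (Polynomial ℚ)) (RingHom.ext fun p => ?_)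
    simp [adams_algebraMap]
  rw [this]
  rfl

theorem adams_X (d : ℕ+) : adams d RatFunc.X = RatFunc.X ^ (d : ℕ) := by
  rw [← RatFunc.algebraMap_X, adams_algebraMap]
  simp

theorem SType.one_term {β : I →₀ ℕ} (h : β ≠ 0) (k : (I →₀ ℕ) → RatFunc ℚ) :
    (SType.one h).Theta k / (SType.one h).W = k β := by
  rw [SType.Theta, SType.W, SType.one, Finsupp.prod_single_index (by simp),
    Finsupp.prod_single_index (by simp)]
  simp [adams_one]

/-- In a semisimple type of size `β`, every label `(d, γ)` has `γ ≤ β`, with equality only for the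
type `(1, β)`. -/
theorem SType.lt_of_mem_support {n : SType I} {x : Lab I} (hx : x ∈ n.support)
    (hβ : n.size ≠ 0) (hn : n ≠ SType.one hβ) : x.2.1 < n.size := by
  classical
  have hsplit : n.size = n x • x.size + SType.size (n.erase x) := by
    have h1 : n = Finsupp.single x (n x) + n.erase x := (Finsupp.single_add_erase x n).symm
    conv_lhs => rw [h1]
    rw [SType.size, Finsupp.sum_add_index' (by simp) (by simp [add_smul]),
      Finsupp.sum_single_index (by simp)]
    rfl
  have h0 : 1 ≤ n x * (x.1 : ℕ) :=
    Nat.mul_pos (Nat.pos_of_ne_zero (Finsupp.mem_support_iff.1 hx)) x.1.pos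
  have happ : ∀ i, n.size i = n x * (x.1 : ℕ) * x.2.1 i + SType.size (n.erase x) i := by
    intro i
    rw [hsplit, Lab.size, smul_smul]
    rfl
  refine lt_of_le_of_ne (fun i => ?_) fun heq => hn ?_
  · rw [happ]
    nlinarith [Nat.mul_le_mul_right (x.2.1 i) h0]
  obtain ⟨i, hi⟩ := Finsupp.ne_iff.1 x.2.2
  have hi' : 0 < x.2.1 i := Nat.pos_of_ne_zero hi
  have h2 : n x * (x.1 : ℕ) = 1 := by
    have := happ i
    rw [← heq] at this
    by_contra hne
    have h3 : 2 ≤ n x * (x.1 : ℕ) := by omega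
    have h4 := Nat.mul_le_mul_right (x.2.1 i) h3
    omega
  have h3 : SType.size (n.erase x) = 0 := by
    ext k
    have := happ k
    rw [← heq, h2] at this
    simp only [Finsupp.coe_zero, Pi.zero_apply]
    omega
  have h4 : n.erase x = 0 := by
    ext y
    by_contra hy
    have h5 : n.erase x y • y.size ≤ SType.size (n.erase x) :=
      Finset.single_le_sum (f := fun y => n.erase x y • y.size) (fun _ _ => zero_le)
        (Finsupp.mem_support_iff.2 hy)
    rw [h3] at h5
    exact smul_ne_zero hy y.size_ne_zero (le_antisymm h5 zero_le)
  have h6 : n x = 1 := Nat.eq_one_of_mul_eq_one_right h2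
  have h7 : x.1 = 1 := PNat.coe_injective (Nat.eq_one_of_mul_eq_one_left h2)
  have h8 : x = (1, ⟨n.size, hβ⟩) := Prod.ext h7 (Subtype.ext heq)
  have h9 : n = Finsupp.single x (n x) := by
    have := Finsupp.single_add_erase x n
    rw [h4, add_zero] at this
    exact this.symm
  rw [SType.one, ← h8, ← h6]
  exact h9

/-- Plethystic exponentiation is surjective: `pexp f β` is `f β` plus terms in the `f γ` with
`γ < β`. -/
theorem exists_pexp_eq (k : (I →₀ ℕ) → RatFunc ℚ) :
    ∃ f : (I →₀ ℕ) → RatFunc ℚ, ∀ β, β ≠ 0 → pexp f β = k β := by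
  classical
  let step : (β : I →₀ ℕ) → ((γ : I →₀ ℕ) → γ < β → RatFunc ℚ) → RatFunc ℚ := fun β g =>
    if h : β ≠ 0 then k β - ∑ n ∈ (stypes β).erase (SType.one h),
      n.Theta (fun γ => if hγ : γ < β then g γ hγ else 0) / n.W else 0
  have wf : WellFounded (fun a b : I →₀ ℕ => a < b) := wellFounded_lt
  refine ⟨wf.fix step, fun β hβ => ?_⟩
  rw [pexp, ← Finset.add_sum_erase _ _ (SType.one_mem hβ), SType.one_term, wf.fix_eq]
  simp only [step, dif_pos hβ]
  rw [sub_add_eq_add_sub, sub_eq_iff_eq_add, add_right_inj]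
  refine Finset.sum_congr rfl fun n hn => ?_
  rw [Finset.mem_erase, mem_stypes] at hn
  obtain ⟨hn, rfl⟩ := hn
  rw [Theta_congr n fun x hx => ?_]
  rw [dif_pos (SType.lt_of_mem_support hx hβ hn)]

end SemisimpleTypes

/-! ### Rational conjugation and Möbius inversion on `𝒵_α` -/

section MoebiusInversion

variable {I : Type*} [Fintype I] [DecidableEq I]
variable {Fq K : Type*} [Field Fq] [Fintype Fq] [Field K] [Algebra Fq K]

theorem mem_map_conj {G : Type*} [Group G] (S : Subgroup G) (g x : G) :
    x ∈ S.map (MulAut.conj g).toMonoidHom ↔ g⁻¹ * x * g ∈ S := by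
  constructor
  · rintro ⟨z, hz, rfl⟩
    simpa [mul_assoc] using hz
  · intro hx
    exact ⟨_, hx, by simp [mul_assoc]⟩

/-- The conjugate of an `F`-stable admissible subtorus by a rational element. -/
def AdmTori.conj {α : I →₀ ℕ} (r : GLv K α) (hr : frob Fq K α r = r) (S : AdmTori Fq K α) :
    AdmTori Fq K α :=
  ⟨S.1.map (MulAut.conj r).toMonoidHom, by
    obtain ⟨L, ⟨f, h, rfl⟩, hL⟩ := S.2.1
    refine ⟨_, ⟨f, blockEmb K α r * h, rfl⟩, ?_⟩
    ext y
    have hy : y ∈ (S.1.map (MulAut.conj r).toMonoidHom).map (blockEmb K α) ↔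
        (blockEmb K α r)⁻¹ * y * blockEmb K α r ∈ S.1.map (blockEmb K α) := by
      constructor
      · rintro ⟨_, ⟨s, hs, rfl⟩, rfl⟩
        exact ⟨s, hs, by simp [mul_assoc]⟩
      · rintro ⟨s, hs, hs'⟩
        refine ⟨_, ⟨s, hs, rfl⟩, ?_⟩
        simp [hs', mul_assoc]
    rw [hy, hL, center_map_conj, center_map_conj]
    simp only [mul_inv_rev, mul_assoc], by
    have h : (frob Fq K α).comp (MulAut.conj r).toMonoidHom =
        (MulAut.conj r).toMonoidHom.comp (frob Fq K α) := by
      ext1 x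
      simp [hr]
    rw [Subgroup.map_map, h, ← Subgroup.map_map, S.2.2]⟩

theorem AdmTori.mem_conj {α : I →₀ ℕ} (r : GLv K α) (hr : frob Fq K α r = r) (S : AdmTori Fq K α)
    (x : GLv K α) : x ∈ (S.conj r hr).1 ↔ r⁻¹ * x * r ∈ S.1 :=
  mem_map_conj _ _ _

omit [Fintype I] [DecidableEq I] in
theorem frob_inv_eq {α : I →₀ ℕ} {r : GLv K α} (hr : frob Fq K α r = r) :
    frob Fq K α r⁻¹ = r⁻¹ := by rw [map_inv, hr]

theorem AdmTori.conj_conj_inv {α : I →₀ ℕ} (r : GLv K α) (hr : frob Fq K α r = r)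
    (S : AdmTori Fq K α) : (S.conj r⁻¹ (frob_inv_eq hr)).conj r hr = S := by
  refine Subtype.ext (Subgroup.ext fun x => ?_)
  rw [mem_conj, mem_conj]
  simp [mul_assoc]

theorem AdmTori.conj_le_iff {α : I →₀ ℕ} (r : GLv K α) (hr : frob Fq K α r = r)
    (S T : AdmTori Fq K α) : S.conj r hr ≤ T.conj r hr ↔ S ≤ T := by
  constructor
  · intro h x hx
    have := (T.mem_conj r hr (r * x * r⁻¹)).1 (h ((S.mem_conj r hr _).2 (by simpa [mul_assoc])))
    simpa [mul_assoc] using this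
  · intro h x hx
    exact (T.mem_conj r hr x).2 (h ((S.mem_conj r hr x).1 hx))

/-- Conjugation by a rational element, as an automorphism of the poset `𝒵_α`. -/
def AdmTori.conjIso {α : I →₀ ℕ} (r : GLv K α) (hr : frob Fq K α r = r) :
    AdmTori Fq K α ≃o AdmTori Fq K α where
  toFun S := S.conj r hr
  invFun S := S.conj r⁻¹ (frob_inv_eq hr)
  left_inv S := by
    refine Subtype.ext (Subgroup.ext fun x => ?_)
    rw [mem_conj, mem_conj]
    simp [mul_assoc]
  right_inv S := S.conj_conj_inv r hr
  map_rel_iff' := AdmTori.conj_le_iff r hr _ _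

omit [Fintype I] [DecidableEq I] in
theorem RationallyConj.refl {α : I →₀ ℕ} (S : Subgroup (GLv K α)) : RationallyConj Fq K S S :=
  ⟨1, map_one _, by ext x; rw [mem_map_conj]; simp⟩

omit [Fintype I] [DecidableEq I] in
theorem RationallyConj.symm {α : I →₀ ℕ} {S T : Subgroup (GLv K α)}
    (h : RationallyConj Fq K S T) : RationallyConj Fq K T S := by
  obtain ⟨g, hg, rfl⟩ := h
  refine ⟨g⁻¹, frob_inv_eq hg, ?_⟩
  ext x
  rw [mem_map_conj, mem_map_conj]
  simp [mul_assoc]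

omit [Fintype I] [DecidableEq I] in
theorem RationallyConj.trans {α : I →₀ ℕ} {S T U : Subgroup (GLv K α)}
    (h : RationallyConj Fq K S T) (h' : RationallyConj Fq K T U) : RationallyConj Fq K S U := by
  obtain ⟨g, hg, rfl⟩ := h
  obtain ⟨g', hg', rfl⟩ := h'
  refine ⟨g' * g, by rw [map_mul, hg, hg'], ?_⟩
  ext x
  rw [mem_map_conj, mem_map_conj, mem_map_conj]
  simp [mul_assoc]

variable [IsAlgClosed K]

theorem AdmTori.multitype_congr {α : I →₀ ℕ} {S T : AdmTori Fq K α}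
    (h : RationallyConj Fq K S.1 T.1) : S.multitype = T.multitype := by
  have : (fun ν : Multitype I => ν.IsSemisimple ∧ ∃ h : ν.size = α,
      RationallyConj Fq K (stdTorus Fq K ν h).1 S.1) = fun ν : Multitype I =>
      ν.IsSemisimple ∧ ∃ h : ν.size = α, RationallyConj Fq K (stdTorus Fq K ν h).1 T.1 := by
    funext ν
    refine propext (and_congr_right fun _ => exists_congr fun _ => ⟨fun h' => h'.trans h,
      fun h' => h'.trans h.symm⟩)
  have key : ∀ p q : Multitype I → Prop, p = q →
      (open scoped Classical in if H : ∃ ν, p ν then H.choose else 0) =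
        (open scoped Classical in if H : ∃ ν, q ν then H.choose else 0) := by
    rintro p _ rfl
    rfl
  exact key _ _ this

open scoped Classical in
/-- The function `P_{[S]}(t)` on the tori `S` of level `V`, extended by zero. -/
def levelP (V : Set (I →₀ ℕ)) {α : I →₀ ℕ} (S : AdmTori Fq K α) : RatFunc ℚ :=
  if S.multitype.IsOfLevel V then S.multitype.P else 0

/-- The Möbius transform `∑_{S' ≤ S, S' of level V} P_{[S']}(t) μ(S', S)`. -/
def levelMu (V : Set (I →₀ ℕ)) {α : I →₀ ℕ} (S : AdmTori Fq K α) : RatFunc ℚ :=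
  ∑ S' ∈ S.finite_Iic.toFinset, levelP V S' * (mobius S' S : RatFunc ℚ)

theorem levelSum_eq (F : Multitype I → RatFunc ℚ) (V : Set (I →₀ ℕ)) (α : I →₀ ℕ) :
    levelSum Fq K F V α = ∑ ω : {ω : Multitype I // ω.size = α},
      F ω.1 / (ω.1.w : RatFunc ℚ) * levelMu V (stdTorus Fq K ω.1 ω.2) := by
  classical
  refine Finset.sum_congr rfl fun ω _ => ?_
  congr 1
  rw [levelMu, Finset.sum_filter]
  refine Finset.sum_congr rfl fun S _ => ?_
  rw [levelP]
  split_ifs <;> simp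

theorem mem_Iic_toFinset {α : I →₀ ℕ} {S T : AdmTori Fq K α} :
    T ∈ S.finite_Iic.toFinset ↔ T ≤ S := by
  rw [Set.Finite.mem_toFinset, Set.mem_Iic]

/-- Möbius inversion. -/
theorem sum_levelMu (V : Set (I →₀ ℕ)) {α : I →₀ ℕ} (S : AdmTori Fq K α) :
    ∑ T ∈ S.finite_Iic.toFinset, levelMu V T = levelP V S := by
  classical
  simp only [levelMu]
  rw [Finset.sum_sigma', Finset.sum_congr rfl fun _ _ => rfl]
  have h1 : ∑ x ∈ S.finite_Iic.toFinset.sigma fun T => T.finite_Iic.toFinset,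
      levelP V x.2 * (mobius x.2 x.1 : RatFunc ℚ) =
      ∑ x ∈ S.finite_Iic.toFinset.sigma fun T => Finset.Icc T S,
        levelP V x.1 * (mobius x.1 x.2 : RatFunc ℚ) := by
    refine Finset.sum_bij' (fun x _ => ⟨x.2, x.1⟩) (fun x _ => ⟨x.2, x.1⟩) ?_ ?_ ?_ ?_ ?_
    · rintro ⟨T, U⟩ h
      simp only [Finset.mem_sigma, mem_Iic_toFinset, Finset.mem_Icc] at h ⊢
      exact ⟨h.2.trans h.1, h.2, h.1⟩
    · rintro ⟨T, U⟩ h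
      simp only [Finset.mem_sigma, mem_Iic_toFinset, Finset.mem_Icc] at h ⊢
      exact ⟨h.2.2, h.2.1⟩
    · intros; rfl
    · intros; rfl
    · intros; rfl
  rw [h1, Finset.sum_sigma]
  have h2 : ∀ T : AdmTori Fq K α, ∑ U ∈ Finset.Icc T S, (mobius T U : RatFunc ℚ) =
      if T = S then 1 else 0 := by
    intro T
    have := IncidenceAlgebra.sum_Icc_mu_right (𝕜 := ℤ) T S
    have h3 : ∑ U ∈ Finset.Icc T S, mobius T U = if T = S then 1 else 0 := by
      rw [← this]
      refine Finset.sum_congr rfl fun U _ => ?_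
      rw [mobius]
    rw [← Int.cast_sum, h3]
    split_ifs <;> simp
  simp only [← Finset.mul_sum]
  simp [h2]

theorem levelP_conj (V : Set (I →₀ ℕ)) {α : I →₀ ℕ} (r : GLv K α) (hr : frob Fq K α r = r)
    (S : AdmTori Fq K α) : levelP V (S.conj r hr) = levelP V S := by
  have h : (S.conj r hr).multitype = S.multitype :=
    AdmTori.multitype_congr (RationallyConj.symm ⟨r, hr, rfl⟩)
  rw [levelP, levelP, h]

/-- The Möbius transform is invariant under rational conjugation, being determined by the invariant
function `levelP V` through Möbius inversion. -/
theorem levelMu_conj (V : Set (I →₀ ℕ)) {α : I →₀ ℕ} (r : GLv K α) (hr : frob Fq K α r = r)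
    (S : AdmTori Fq K α) : levelMu V (S.conj r hr) = levelMu V S := by
  classical
  induction hN : S.finite_Iic.toFinset.card using Nat.strong_induction_on generalizing S with
  | _ N ih =>
    have h1 := sum_levelMu V (S.conj r hr)
    rw [levelP_conj, ← sum_levelMu V S] at h1
    have h2 : ∑ T ∈ (S.conj r hr).finite_Iic.toFinset, levelMu V T =
        ∑ T ∈ S.finite_Iic.toFinset, levelMu V (T.conj r hr) := by
      refine (Finset.sum_equiv (AdmTori.conjIso r hr).toEquiv (fun T => ?_) fun T _ => rfl).symm
      rw [mem_Iic_toFinset, mem_Iic_toFinset]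
      exact (AdmTori.conj_le_iff r hr T S).symm
    rw [h2, ← Finset.add_sum_erase _ _ (mem_Iic_toFinset.2 le_rfl),
      ← Finset.add_sum_erase _ (fun T => levelMu V T) (mem_Iic_toFinset.2 le_rfl)] at h1
    refine add_right_cancel (h1.trans ?_)
    congr 1
    refine (Finset.sum_congr rfl fun T hT => ?_).symm
    rw [Finset.mem_erase, mem_Iic_toFinset] at hT
    refine ih _ ?_ T rfl
    rw [← hN]
    refine Finset.card_lt_card (Finset.ssubset_iff_of_subset ?_ |>.2
      ⟨S, mem_Iic_toFinset.2 le_rfl, fun h => ?_⟩)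
    · intro U hU
      rw [mem_Iic_toFinset] at hU ⊢
      exact hU.trans hT.2
    · exact hT.1 (le_antisymm hT.2 (mem_Iic_toFinset.1 h))

theorem levelMu_congr (V : Set (I →₀ ℕ)) {α : I →₀ ℕ} {S T : AdmTori Fq K α}
    (h : RationallyConj Fq K S.1 T.1) : levelMu V S = levelMu V T := by
  obtain ⟨r, hr, h⟩ := h
  have : T = S.conj r hr := Subtype.ext h
  rw [this, levelMu_conj]

end MoebiusInversion

/-! ### Vectors fixed by a twisted Frobenius -/

section Lang

variable (Fq : Type*) {K : Type*} [Field Fq] [Fintype Fq] [Field K] [Algebra Fq K]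

/-- The `k`-th power of the Frobenius endomorphism `x ↦ x^q` of `K`. -/
def frobPow (K : Type*) [Field K] [Algebra Fq K] (k : ℕ) : K →+* K :=
  ((FiniteField.frobeniusAlgHom Fq K : K →ₐ[Fq] K) ^ k).toRingHom

theorem frobPow_apply (k : ℕ) (x : K) : frobPow Fq K k x = x ^ Fintype.card Fq ^ k := by
  have h : ∀ k : ℕ, ((FiniteField.frobeniusAlgHom Fq K : K →ₐ[Fq] K) ^ k) x =
      x ^ Fintype.card Fq ^ k := by
    intro k
    induction k with
    | zero => simp
    | succ k ih =>
      rw [pow_succ', AlgHom.mul_apply, ih, FiniteField.coe_frobeniusAlgHom]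
      show (x ^ Fintype.card Fq ^ k) ^ Fintype.card Fq = _
      rw [← pow_mul, ← pow_succ]
  exact h k

omit [Field Fq] [Fintype Fq] [Field K] [Algebra Fq K] in
/-- A sequence with `u m = u 0` is compatible with the cyclic shift of `{0, …, m - 1}`. -/
theorem finRotate_step {X : Type*} {m : ℕ} (u : ℕ → X) (h : u m = u 0) (k : Fin m) :
    u ((k : ℕ) + 1) = u (finRotate m k : Fin m) := by
  obtain _ | m := m
  · exact k.elim0
  rw [coe_finRotate]
  split_ifs with hl
  · subst hl
    exact h
  · rfl

variable [IsAlgClosed K]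

/-- For a permutation `τ` of a finite set `Z`, the functions `v` on `Z` with
`v(τ a) = v(a)^{q^d}` span the space of all functions. On the orbit of `z`, of length `m`, such
functions are obtained from the powers of an element with `dm` distinct conjugates, and they are
separated by a Vandermonde determinant. -/
theorem span_frobenius_fixed {Z : Type*} [Finite Z] (τ : Equiv.Perm Z) {d : ℕ} (hd : 0 < d) :
    Submodule.span K {v : Z → K | ∀ a, v (τ a) = v a ^ Fintype.card Fq ^ d} = ⊤ := by
  classical
  have := Fintype.ofFinite Z
  by_contra hne
  obtain ⟨f, hf, hle⟩ := Submodule.exists_le_ker_of_lt_top _ (lt_top_iff_ne_top.2 hne)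
  obtain ⟨z, hz⟩ : ∃ z, f (Pi.single z 1) ≠ 0 := by
    by_contra hcon
    push Not at hcon
    refine hf (LinearMap.pi_ext' fun z => LinearMap.ext_ring ?_)
    simpa using hcon z
  set m := Function.minimalPeriod τ z with hm
  have hm0 : 0 < m := Function.minimalPeriod_pos_of_mem_periodicPts
    ((Function.mem_periodicPts).2 ⟨orderOf τ, orderOf_pos τ, by
      rw [Function.IsPeriodicPt, Function.IsFixedPt, ← Equiv.Perm.coe_pow, pow_orderOf_eq_one]
      rfl⟩)
  obtain ⟨x, hx, hinj⟩ := exists_cyclic Fq K (Nat.mul_pos hd hm0)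
  -- the conjugates of `x` along the orbit of `z`
  let y : Fin m → K := fun k => x ^ Fintype.card Fq ^ (d * (k : ℕ))
  have hy : Function.Injective y := by
    intro k l hkl
    have := @hinj ⟨d * k, Nat.mul_lt_mul_of_pos_left k.2 hd⟩
      ⟨d * l, Nat.mul_lt_mul_of_pos_left l.2 hd⟩ hkl
    exact Fin.ext (Nat.eq_of_mul_eq_mul_left hd (congrArg Fin.val this))
  let orb : Fin m → Z := fun k => τ^[k] z
  have horb : Function.Injective orb := by
    intro k l hkl
    have := (Function.iterate_eq_iterate_iff_of_lt_minimalPeriod k.2 l.2).1 hkl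
    exact Fin.ext this
  have hlam : (fun k => f (Pi.single (orb k) 1)) = 0 := by
    refine Matrix.eq_zero_of_forall_pow_sum_mul_pow_eq_zero hy fun s => ?_
    let v : Z → K := fun a => ∑ k : Fin m, if orb k = a then y k ^ (s : ℕ) else 0
    have hv : v ∈ {v : Z → K | ∀ a, v (τ a) = v a ^ Fintype.card Fq ^ d} := by
      intro a
      have hτ : ∀ k : Fin m, orb (finRotate m k) = τ (orb k) := fun k =>
        (finRotate_step (fun k => τ^[k] z) (Function.iterate_minimalPeriod) k).symm.trans
          (Function.iterate_succ_apply' _ _ _)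
      have hyr : ∀ k : Fin m, y (finRotate m k) = y k ^ Fintype.card Fq ^ d := fun k =>
        (finRotate_step (fun k => x ^ Fintype.card Fq ^ (d * k)) (by simpa using hx) k).symm.trans
          (by rw [mul_add, mul_one, pow_add, pow_mul])
      rw [← frobPow_apply]
      simp only [v]
      rw [map_sum, ← Equiv.sum_comp (finRotate m)]
      refine Finset.sum_congr rfl fun k _ => ?_
      rw [hτ, hyr]
      simp only [EmbeddingLike.apply_eq_iff_eq]
      split_ifs
      · rw [frobPow_apply]
        exact pow_right_comm _ _ _
      · rw [map_zero]
    have hfv : f v = 0 := hle (Submodule.subset_span hv)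
    have hv2 : v = ∑ k : Fin m, (y k ^ (s : ℕ)) • Pi.single (orb k) (1 : K) := by
      funext a
      simp only [v, Finset.sum_apply, Pi.smul_apply, Pi.single_apply, smul_eq_mul, mul_ite, mul_one,
        mul_zero, eq_comm]
    rw [hv2, map_sum] at hfv
    rw [← hfv]
    refine Finset.sum_congr rfl fun k _ => ?_
    rw [map_smul, smul_eq_mul, mul_comm]
  exact hz (congrFun hlam ⟨0, hm0⟩)

/-- There is a basis of the space of functions on `Z` consisting of functions `v` with
`v(τ a) = v(a)^{q^d}`. -/
theorem exists_frobenius_basis {Z C : Type*} [Finite Z] (τ : Equiv.Perm Z) {d : ℕ} (hd : 0 < d)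
    [Finite C] (hC : Nat.card C = Nat.card Z) :
    ∃ v : C → Z → K, LinearIndependent K v ∧ ∀ c a, v c (τ a) = v c a ^ Fintype.card Fq ^ d := by
  classical
  have := Fintype.ofFinite Z
  obtain ⟨b, hb, hspan, hli⟩ := exists_linearIndependent K
    {v : Z → K | ∀ a, v (τ a) = v a ^ Fintype.card Fq ^ d}
  rw [span_frobenius_fixed Fq τ hd] at hspan
  let B := Module.Basis.mk hli (by rw [Subtype.range_coe]; exact hspan.ge)
  have hfin : Finite b := Module.Finite.finite_basis B
  have hcard : Nat.card C = Nat.card b := by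
    rw [hC, ← Module.finrank_eq_nat_card_basis B, Module.finrank_fintype_fun_eq_card,
      Nat.card_eq_fintype_card]
  have := Fintype.ofFinite b
  have := Fintype.ofFinite C
  let e : C ≃ b := Fintype.equivOfCardEq (by
    rwa [Nat.card_eq_fintype_card, Nat.card_eq_fintype_card] at hcard)
  exact ⟨fun c => (e c).1, hli.comp e e.injective, fun c a => hb (e c).2 a⟩

omit [Field Fq] [Fintype Fq] [Field K] [Algebra Fq K] [IsAlgClosed K] in
/-- The element `(j, k)` is obtained from `(j, 0)` by `k` cyclic shifts. -/
theorem finRotate_pow_zero {d : ℕ} (hd : 0 < d) (k : Fin d) :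
    (finRotate d ^ (k : ℕ)) ⟨0, hd⟩ = k := by
  obtain _ | d := d
  · exact k.elim0
  have h : ∀ m (hm : m < d + 1), (finRotate (d + 1) ^ m) ⟨0, hd⟩ = ⟨m, hm⟩ := by
    intro m
    induction m with
    | zero => intro _; rfl
    | succ m ih =>
      intro hm
      rw [pow_succ', Equiv.Perm.mul_apply, ih (by omega)]
      exact finRotate_of_lt (by omega)
  exact h k k.2

/-- Let `π` be a permutation of a finite set `A` lying over the cyclic shift of `⋃_j {(j, 0), …, (j,
d_j - 1)}`. There is a nonsingular matrix `(M_{b,a})` with entries in `K`, block diagonal over this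
set, in which `a` runs through `A`, while the indices `b` are permuted by the shift alone; the
Frobenius carries it to its translate by the two permutations. This trivializes the monodromy of `π`
on the fibres, and is an instance of Lang's theorem. -/
theorem exists_frobenius_frame {A J : Type*} [Finite A] [Fintype J] {d : J → ℕ}
    (hd : ∀ j, 0 < d j) {C : J → Type*} [∀ j, Fintype (C j)] (π : Equiv.Perm A)
    (ζ : A → (j : J) × Fin (d j))
    (hζ : ∀ a, ζ (π a) = ⟨(ζ a).1, finRotate _ (ζ a).2⟩)
    (hC : ∀ j, Nat.card {a // ζ a = ⟨j, ⟨0, hd j⟩⟩} = Fintype.card (C j)) :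
    ∃ M : ((j : J) × (Fin (d j) × C j)) → A → K, LinearIndependent K M ∧
      (∀ a b, M b a ≠ 0 → ζ a = ⟨b.1, b.2.1⟩) ∧
      ∀ a b, M ⟨b.1, finRotate _ b.2.1, b.2.2⟩ (π a) = M b a ^ Fintype.card Fq := by
  classical
  have := Fintype.ofFinite A
  have hpow : ∀ (k : ℕ) a, ζ ((π ^ k) a) = ⟨(ζ a).1, (finRotate _ ^ k) (ζ a).2⟩ := by
    intro k a
    induction k with
    | zero => rfl
    | succ k ih =>
      rw [pow_succ', Equiv.Perm.mul_apply, hζ, ih, pow_succ']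
      rfl
  have hrot : ∀ m, finRotate m ^ m = 1 := by
    intro m
    ext k
    have hm : 0 < m := k.pos
    conv_lhs => rw [← finRotate_pow_zero hm k]
    rw [← Equiv.Perm.mul_apply, ← pow_add, add_comm, pow_add, Equiv.Perm.mul_apply]
    have h1 : (finRotate m ^ m) ⟨0, hm⟩ = ⟨0, hm⟩ := by
      obtain ⟨m, rfl⟩ : ∃ n, m = n + 1 := ⟨m - 1, by omega⟩
      rw [pow_succ']
      have := finRotate_pow_zero hm (Fin.last m)
      rw [Fin.val_last] at this
      rw [Equiv.Perm.mul_apply, this, finRotate_last]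
      rfl
    rw [h1, finRotate_pow_zero hm k]
    rfl
  -- the first return map on the fibre over `(j, 0)`
  have hstab : ∀ j a, ζ a = ⟨j, ⟨0, hd j⟩⟩ ↔ ζ ((π ^ d j) a) = ⟨j, ⟨0, hd j⟩⟩ := by
    intro j a
    rw [hpow]
    constructor
    · intro h
      rw [h]
      simp [hrot]
    · intro h
      obtain ⟨j', k', h'⟩ : ∃ j' k', ζ a = ⟨j', k'⟩ := ⟨_, _, rfl⟩
      rw [h'] at h ⊢
      obtain rfl : j' = j := congrArg Sigma.fst h
      rw [hrot] at h
      exact h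
  let τ : (j : J) → Equiv.Perm {a // ζ a = ⟨j, ⟨0, hd j⟩⟩} := fun j =>
    (π ^ d j).subtypePerm fun a => (hstab j a).symm
  have hbasis := fun j => exists_frobenius_basis (K := K) Fq (τ j) (hd j) (C := C j)
    (by rw [hC, Nat.card_eq_fintype_card])
  choose v hvli hv using hbasis
  let u : (j : J) → C j → A → K := fun j c a =>
    if h : ζ a = ⟨j, ⟨0, hd j⟩⟩ then v j c ⟨a, h⟩ else 0
  have hu0 : ∀ j c a, u j c a ≠ 0 → ζ a = ⟨j, ⟨0, hd j⟩⟩ := by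
    intro j c a h
    by_contra hcon
    exact h (dif_neg hcon)
  have huF : ∀ j c a, u j c ((π ^ d j) a) = u j c a ^ Fintype.card Fq ^ d j := by
    intro j c a
    by_cases h : ζ a = ⟨j, ⟨0, hd j⟩⟩
    · simp only [u]
      rw [dif_pos h, dif_pos ((hstab j a).1 h)]
      exact hv j c ⟨a, h⟩
    · simp only [u]
      rw [dif_neg h, dif_neg (fun h' => h ((hstab j a).2 h')),
        zero_pow (pow_ne_zero _ Fintype.card_ne_zero)]
  refine ⟨fun b a => u b.1 b.2.2 ((π ^ (b.2.1 : ℕ))⁻¹ a) ^ Fintype.card Fq ^ (b.2.1 : ℕ),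
    ?_, ?_, ?_⟩
  · rw [Fintype.linearIndependent_iff]
    intro g hg b
    obtain ⟨j, k, c⟩ := b
    -- taking `q^k`-th roots turns a relation over `(j, k)` into one over `(j, 0)`
    choose r hr using fun c => IsAlgClosed.exists_pow_nat_eq (g ⟨j, k, c⟩)
      (pow_pos (Fintype.card_pos (α := Fq)) (k : ℕ))
    have hz : ∀ c, r c = 0 := by
      refine Fintype.linearIndependent_iff.1 (hvli j) r (funext fun a => ?_)
      have h1 := congrFun hg ((π ^ (k : ℕ)) a.1)
      have h2 : ∑ c, r c * v j c a = 0 := by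
        refine pow_eq_zero_iff (pow_ne_zero k (Fintype.card_ne_zero (α := Fq))) |>.1 ?_
        refine Eq.trans ?_ h1
        rw [← frobPow_apply, map_sum, Finset.sum_apply]
        -- only the columns over `(j, k)` contribute
        rw [Fintype.sum_sigma, Finset.sum_eq_single j, Fintype.sum_prod_type,
          Finset.sum_eq_single k]
        · refine Finset.sum_congr rfl fun c _ => ?_
          rw [Pi.smul_apply, smul_eq_mul, map_mul, frobPow_apply, frobPow_apply, hr]
          simp only [← Equiv.Perm.mul_apply, inv_mul_cancel, Equiv.Perm.one_apply, u]
          rw [dif_pos a.2]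
        · intro k' _ hk'
          refine Finset.sum_eq_zero fun c _ => ?_
          rw [Pi.smul_apply, smul_eq_mul, mul_eq_zero]
          right
          refine (pow_eq_zero_iff (pow_ne_zero _ (Fintype.card_ne_zero (α := Fq)))).2 ?_
          by_contra hne
          have h3 := hu0 _ _ _ hne
          have h4 := hpow (k' : ℕ) ((π ^ (k' : ℕ))⁻¹ ((π ^ (k : ℕ)) a.1))
          rw [← Equiv.Perm.mul_apply, mul_inv_cancel, Equiv.Perm.one_apply, hpow, a.2, h3] at h4
          have h5 := eq_of_heq (Sigma.mk.inj h4).2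
          rw [finRotate_pow_zero, finRotate_pow_zero] at h5
          exact hk' h5.symm
        · simp
        · intro j' _ hj'
          refine Finset.sum_eq_zero fun b _ => ?_
          rw [Pi.smul_apply, smul_eq_mul, mul_eq_zero]
          right
          refine (pow_eq_zero_iff (pow_ne_zero _ (Fintype.card_ne_zero (α := Fq)))).2 ?_
          by_contra hne
          have h3 := hu0 _ _ _ hne
          have h4 := hpow (b.1 : ℕ) ((π ^ (b.1 : ℕ))⁻¹ ((π ^ (k : ℕ)) a.1))
          rw [← Equiv.Perm.mul_apply, mul_inv_cancel, Equiv.Perm.one_apply, hpow, a.2, h3] at h4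
          exact hj' (congrArg Sigma.fst h4).symm
        · simp
      simpa using h2
    rw [← hr, hz, zero_pow (pow_ne_zero _ Fintype.card_ne_zero)]
  · rintro a ⟨j, k, c⟩ h
    have h1 := hu0 _ _ _ ((pow_ne_zero_iff (pow_ne_zero _ (Fintype.card_ne_zero (α := Fq)))).1 h)
    have h2 := hpow (k : ℕ) ((π ^ (k : ℕ))⁻¹ a)
    rw [← Equiv.Perm.mul_apply, mul_inv_cancel, Equiv.Perm.one_apply, h1] at h2
    rw [h2, finRotate_pow_zero]
  · rintro a ⟨j, k, c⟩
    have h := finRotate_step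
      (fun k : ℕ => u j c ((π ^ k)⁻¹ (π a)) ^ Fintype.card Fq ^ k) (by
        have h1 := huF j c ((π ^ d j)⁻¹ (π a))
        rw [← Equiv.Perm.mul_apply, mul_inv_cancel, Equiv.Perm.one_apply] at h1
        simp [h1]) k
    refine h.symm.trans ?_
    show u j c ((π ^ ((k : ℕ) + 1))⁻¹ (π a)) ^ Fintype.card Fq ^ ((k : ℕ) + 1) = _
    rw [pow_succ π, mul_inv_rev, Equiv.Perm.mul_apply, pow_succ, pow_mul]
    have h2 : ∀ x, π⁻¹ ((π ^ (k : ℕ))⁻¹ (π x)) = (π ^ (k : ℕ))⁻¹ x := by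
      intro x
      rw [← Equiv.Perm.mul_apply, ← Equiv.Perm.mul_apply, ← mul_inv_rev, ← pow_succ, pow_succ',
        mul_inv_rev, inv_mul_cancel_right]
    rw [h2]

end Lang

/-! ### The tori contained in `S_ω` -/

section Points

variable {I : Type*} [Fintype I]

/-- The set `X_ω` of the pairs `(j, k)`, `0 ≤ k < d_j`, indexing the weight spaces of the torus
`S_ω`; the weight space of `(j, k)` has dimension vector `β_j`. -/
abbrev Multitype.Pt (ω : Multitype I) : Type _ := (j : ω.Block) × Fin (ω.d j)

/-- The action of the Frobenius on the weight spaces, `(j, k) ↦ (j, k + 1)`. -/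
def Multitype.rot (ω : Multitype I) : Equiv.Perm ω.Pt :=
  Equiv.sigmaCongrRight fun j => finRotate (ω.d j)

/-- The weight space to which a row belongs. -/
def Multitype.pt {α : I →₀ ℕ} (ω : Multitype I) (h : ω.size = α) (i : I) (a : Fin (α i)) : ω.Pt :=
  ⟨(ω.enum h i a).1, (ω.enum h i a).2.1⟩

theorem Multitype.pt_perm {α : I →₀ ℕ} (ω : Multitype I) (h : ω.size = α) (i : I)
    (a : Fin (α i)) : ω.pt h i (ω.perm h i a) = ω.rot (ω.pt h i a) := by
  have e : ω.enum h i (ω.perm h i a) = ω.shift i (ω.enum h i a) := by simp [perm]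
  rw [pt, e]
  rfl

theorem Multitype.card_pt {α : I →₀ ℕ} (ω : Multitype I) (h : ω.size = α) (i : I) (x : ω.Pt) :
    Nat.card {a // ω.pt h i a = x} = ω.β x.1 i := by
  have e : {a // ω.pt h i a = x} ≃ Fin (ω.β x.1 i) :=
    ((ω.enum h i).subtypeEquiv (q := fun r : ω.Idx i => (⟨r.1, r.2.1⟩ : ω.Pt) = x)
      fun a => Iff.rfl).trans
    { toFun := fun r => Fin.cast (congrArg (fun p : ω.Pt => ω.β p.1 i) r.2) r.1.2.2
      invFun := fun b => ⟨⟨x.1, x.2, b⟩, rfl⟩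
      left_inv := by
        rintro ⟨⟨j, k, b⟩, rfl⟩
        rfl
      right_inv := fun b => rfl }
  rw [Nat.card_congr e, Nat.card_eq_fintype_card, Fintype.card_fin]

theorem Multitype.β_ne_zero (ω : Multitype I) (j : ω.Block) : ω.β j ≠ 0 := fun h =>
  Finsupp.mem_support_iff.1 j.1.2 (ω.2.2 j.1.1.1 j.1.1.2 h)

theorem Multitype.exists_pt {α : I →₀ ℕ} (ω : Multitype I) (h : ω.size = α) (x : ω.Pt) :
    ∃ i a, ω.pt h i a = x := by
  obtain ⟨i, hi⟩ := Finsupp.ne_iff.1 (ω.β_ne_zero x.1)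
  have := ω.card_pt h i x
  have hne : Nonempty {a // ω.pt h i a = x} := by
    by_contra hcon
    rw [not_nonempty_iff] at hcon
    rw [Nat.card_of_isEmpty] at this
    exact hi this.symm
  obtain ⟨a, ha⟩ := hne
  exact ⟨i, a, ha⟩

open scoped Classical in
/-- The maps of labelled sets with permutation `X_ω → X_ν` for which the label of a point is the sum
of the labels in its fibre. They parametrize, up to automorphisms of `X_ν`, the tori of type `ν`
contained in `S_ω`. -/
structure IsLabelMap (ω ν : Multitype I) (f : ω.Pt → ν.Pt) : Prop where
  equivariant : ∀ x, f (ω.rot x) = ν.rot (f x)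
  sum_eq : ∀ y, ∑ x with f x = y, ω.β x.1 = ν.β y.1

theorem IsLabelMap.surjective {ω ν : Multitype I} {f : ω.Pt → ν.Pt} (hf : IsLabelMap ω ν f) :
    Function.Surjective f := by
  classical
  intro y
  by_contra hcon
  push Not at hcon
  have := hf.sum_eq y
  rw [Finset.filter_false_of_mem fun x _ => hcon x, Finset.sum_empty] at this
  exact ν.β_ne_zero y.1 this.symm

theorem card_fiber_eq {α : I →₀ ℕ} (ω : Multitype I) (h : ω.size = α) {Y : Type*}
    [DecidableEq Y] (f : ω.Pt → Y) (y : Y) (i : I) :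
    Nat.card {a // f (ω.pt h i a) = y} = (∑ x with f x = y, ω.β x.1) i := by
  classical
  rw [Finsupp.finsetSum_apply, Nat.card_eq_fintype_card, Fintype.card_subtype,
    Finset.card_eq_sum_card_fiberwise (f := ω.pt h i) (t := Finset.univ.filter fun x => f x = y)]
  · refine Finset.sum_congr rfl fun x hx => ?_
    rw [← ω.card_pt h i x, Nat.card_eq_fintype_card, Fintype.card_subtype, Finset.filter_filter]
    congr 1
    ext a
    simp only [Finset.mem_filter, Finset.mem_univ, true_and] at hx ⊢
    exact ⟨fun h => h.2, fun h => ⟨h ▸ hx, h⟩⟩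
  · intro a ha
    simpa using ha

end Points

section Diagonal

variable {n K Y : Type*} [Fintype n] [DecidableEq n] [Field K]

/-- An invertible matrix whose nonzero entries match two labellings of the rows and columns
intertwines the corresponding diagonal matrices. -/
theorem conj_eq_diagonal (M X : GL n K) (ψ χ : n → Y)
    (hM : ∀ a b, (M : Matrix n n K) a b ≠ 0 → ψ a = χ b) (z : Y → K) :
    ((M⁻¹ * X * M : GL n K) : Matrix n n K) = Matrix.diagonal (fun a => z (χ a)) ↔
      (X : Matrix n n K) = Matrix.diagonal fun a => z (ψ a) := by
  have hD : Matrix.diagonal (fun a => z (ψ a)) * (M : Matrix n n K) =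
      (M : Matrix n n K) * Matrix.diagonal fun a => z (χ a) := by
    ext a b
    rw [Matrix.mul_diagonal, Matrix.diagonal_mul, mul_comm]
    by_cases hab : (M : Matrix n n K) a b = 0
    · simp [hab]
    · rw [hM a b hab]
  have hX : (X : Matrix n n K) * (M : Matrix n n K) =
      (M : Matrix n n K) * ((M⁻¹ * X * M : GL n K) : Matrix n n K) := by
    rw [← Units.val_mul, ← Units.val_mul]
    congr 1
    group
  constructor
  · intro h
    rw [h, ← hD] at hX
    have := congrArg (· * ((M⁻¹ : GL n K) : Matrix n n K)) hX
    simpa [mul_assoc] using this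
  · intro h
    rw [h, hD] at hX
    have := congrArg (((M⁻¹ : GL n K) : Matrix n n K) * ·) hX
    simpa [← mul_assoc] using this.symm

theorem entry_eq_of_intertwine (M X Z : GL n K) (w z : n → K)
    (hX : (X : Matrix n n K) = Matrix.diagonal w) (hZ : (Z : Matrix n n K) = Matrix.diagonal z)
    (h : X * M = M * Z) (a b : n) (hab : (M : Matrix n n K) a b ≠ 0) : w a = z b := by
  have h1 := congrArg (fun T : GL n K => (T : Matrix n n K) a b) h
  simp only [Units.val_mul] at h1
  rw [hX, hZ, Matrix.mul_diagonal, Matrix.diagonal_mul, mul_comm] at h1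
  exact mul_left_cancel₀ hab h1

theorem exists_entry_ne_zero (M : GL n K) (a : n) : ∃ b, (M : Matrix n n K) a b ≠ 0 := by
  by_contra hcon
  push Not at hcon
  have hdet : (M : Matrix n n K).det ≠ 0 := (Matrix.isUnits_det_units M).ne_zero
  exact hdet (Matrix.det_eq_zero_of_row_eq_zero (A := (M : Matrix n n K)) a hcon)

/-- If the nonzero entries of an invertible matrix match two labellings of the rows and columns, the
diagonal blocks are square. -/
theorem card_fiber_eq_of_support (M : GL n K) (ψ χ : n → Y)
    (hM : ∀ a b, (M : Matrix n n K) a b ≠ 0 → ψ a = χ b) (y : Y) :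
    Nat.card {a // ψ a = y} = Nat.card {a // χ a = y} := by
  classical
  let ev : Y → K := fun y' => if y' = y then 1 else 0
  have hD : Matrix.diagonal (fun a => ev (ψ a)) * (M : Matrix n n K) =
      (M : Matrix n n K) * Matrix.diagonal fun a => ev (χ a) := by
    ext a b
    rw [Matrix.mul_diagonal, Matrix.diagonal_mul, mul_comm]
    by_cases hab : (M : Matrix n n K) a b = 0
    · simp [hab]
    · rw [hM a b hab]
  have hdet : IsUnit (M : Matrix n n K).det := Matrix.isUnits_det_units M
  have h1 := congrArg Matrix.rank hD
  rw [Matrix.rank_mul_eq_left_of_isUnit_det _ _ hdet,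
    Matrix.rank_mul_eq_right_of_isUnit_det _ _ hdet, Matrix.rank_diagonal,
    Matrix.rank_diagonal] at h1
  simpa [ev, Nat.card_eq_fintype_card] using h1

end Diagonal

/-- A relation along which every function on `Y` pulls back to a function on `X` is contained in the
graph of a map `X → Y`. -/
theorem exists_map_of_relation {X Y R C E : Type*} (ξ : R → X) (χ : C → Y) (rel : R → C → Prop)
    (hrel : ∀ x, ∃ a b, ξ a = x ∧ rel a b) (Z : Y ↪ E)
    (h : ∀ z : Y → E, ∃ w : X → E, ∀ a b, rel a b → w (ξ a) = z (χ b)) :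
    ∃ f : X → Y, ∀ a b, rel a b → f (ξ a) = χ b := by
  obtain ⟨w, hw⟩ := h Z
  choose a b hab using hrel
  refine ⟨fun x => χ (b x), fun c e hce => Z.injective ?_⟩
  rw [← hw _ _ hce, ← hw _ _ (hab (ξ c)).2, (hab (ξ c)).1]

theorem infinite_units (K : Type*) [Field K] [Infinite K] : Infinite Kˣ := by
  have : Infinite ({0}ᶜ : Set K) := (Set.finite_singleton (0 : K)).infinite_compl.to_subtype
  exact Infinite.of_injective (fun x : ({0}ᶜ : Set K) => Units.mk0 x.1 x.2)
    (fun x y hxy => Subtype.ext (congrArg Units.val hxy))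

theorem exists_embedding_units (K : Type*) [Field K] [Infinite K] (Y : Type*) [Countable Y] :
    Nonempty (Y ↪ Kˣ) := by
  have := infinite_units K
  obtain ⟨e, he⟩ := exists_injective_nat Y
  exact ⟨(⟨e, he⟩ : Y ↪ ℕ).trans (Infinite.natEmbedding Kˣ)⟩

section LabelTorus

variable {I : Type*} [Fintype I] [DecidableEq I]
variable (Fq K : Type*) [Field Fq] [Fintype Fq] [Field K] [Algebra Fq K] [IsAlgClosed K]

/-- The subtorus of `S_ω` of the elements whose weights on `(j, k)` and `(j', k')` agree whenever
these points have the same image under `f`. -/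
def labelTorus {α : I →₀ ℕ} (ω : Multitype I) (h : ω.size = α) {Y : Type*} (f : ω.Pt → Y) :
    Set (GLv K α) :=
  {x | ∃ z : Y → Kˣ, ∀ i, ((((ω.twist Fq K h)⁻¹ * x * ω.twist Fq K h) i : GL (Fin (α i)) K) :
    Matrix (Fin (α i)) (Fin (α i)) K) = Matrix.diagonal fun a => (z (f (ω.pt h i a)) : K)}

variable {Fq K}

theorem mem_stdTorus {α : I →₀ ℕ} (ω : Multitype I) (h : ω.size = α) (x : GLv K α) :
    x ∈ (stdTorus Fq K ω h).1 ↔ x ∈ labelTorus Fq K ω h id := by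
  refine (mem_map_conj _ _ _).trans ?_
  constructor
  · rintro ⟨z, hz⟩
    exact ⟨fun p => z p.1 p.2, hz⟩
  · rintro ⟨z, hz⟩
    exact ⟨fun j k => z ⟨j, k⟩, hz⟩

omit [DecidableEq I] in
theorem labelTorus_subset {α : I →₀ ℕ} (ω : Multitype I) (h : ω.size = α) {Y : Type*}
    (f : ω.Pt → Y) : labelTorus Fq K ω h f ⊆ labelTorus Fq K ω h id := by
  rintro x ⟨z, hz⟩
  exact ⟨fun p => z (f p), hz⟩

omit [DecidableEq I] in
/-- There is an element of `labelTorus` with prescribed weights. -/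
theorem exists_mem_labelTorus {α : I →₀ ℕ} (ω : Multitype I) (h : ω.size = α) (z : ω.Pt → Kˣ) :
    ∃ x : GLv K α, ∀ i, ((((ω.twist Fq K h)⁻¹ * x * ω.twist Fq K h) i : GL (Fin (α i)) K) :
      Matrix (Fin (α i)) (Fin (α i)) K) = Matrix.diagonal fun a => (z (ω.pt h i a) : K) := by
  obtain ⟨s, hs⟩ := ω.exists_diag (K := K) h fun j k => z ⟨j, k⟩
  refine ⟨ω.twist Fq K h * s * (ω.twist Fq K h)⁻¹, fun i => ?_⟩
  have : (ω.twist Fq K h)⁻¹ * (ω.twist Fq K h * s * (ω.twist Fq K h)⁻¹) * ω.twist Fq K h = s := by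
    group
  rw [this]
  exact hs i

omit [DecidableEq I] in
theorem labelTorus_subset_iff {α : I →₀ ℕ} (ω : Multitype I) (h : ω.size = α) {Y Y' : Type*}
    [Countable Y] (f : ω.Pt → Y) (f' : ω.Pt → Y') :
    labelTorus Fq K ω h f ⊆ labelTorus Fq K ω h f' ↔ ∀ x x', f' x = f' x' → f x = f x' := by
  constructor
  · intro hle x x' hxx
    obtain ⟨Z⟩ := exists_embedding_units K Y
    obtain ⟨g, hg⟩ := exists_mem_labelTorus (Fq := Fq) ω h fun p => Z (f p)
    obtain ⟨z, hz⟩ := hle ⟨Z, hg⟩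
    have key : ∀ p, Z (f p) = z (f' p) := by
      intro p
      obtain ⟨i, a, rfl⟩ := ω.exists_pt h p
      have := congrFun (Matrix.diagonal_injective ((hg i).symm.trans (hz i))) a
      exact Units.ext this
    apply Z.injective
    rw [key, key, hxx]
  · rintro hff x ⟨z, hz⟩
    refine ⟨Function.extend f' (fun p => z (f p)) 1, fun i => ?_⟩
    rw [hz]
    congr 1
    funext a
    have : Function.FactorsThrough (fun p => z (f p)) f' := fun p q hpq => congrArg z (hff p q hpq)
    rw [this.extend_apply]

omit [DecidableEq I] in
theorem twist_J {α : I →₀ ℕ} (ω : Multitype I) (h : ω.size = α) (i : I) :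
    (((((ω.twist Fq K h)⁻¹ * frob Fq K α (ω.twist Fq K h)) i : GL (Fin (α i)) K)) :
      Matrix (Fin (α i)) (Fin (α i)) K) = ω.J K h i :=
  (exists_twist Fq K ω h).choose_spec i

omit [DecidableEq I] in
/-- Rationality of `g_ω m g_ν⁻¹` in terms of the matrix `m`. -/
theorem frob_twist_mul_eq_iff {α : I →₀ ℕ} (ω ν : Multitype I) (h : ω.size = α) (h' : ν.size = α)
    (m : GLv K α) :
    frob Fq K α (ω.twist Fq K h * m * (ν.twist Fq K h')⁻¹) =
        ω.twist Fq K h * m * (ν.twist Fq K h')⁻¹ ↔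
      ∀ i a b, (m i : Matrix (Fin (α i)) (Fin (α i)) K) (ω.perm h i a) (ν.perm h' i b) =
        (m i : Matrix (Fin (α i)) (Fin (α i)) K) a b ^ Fintype.card Fq := by
  set g := ω.twist Fq K h with hg
  set g' := ν.twist Fq K h' with hg'
  set A := g⁻¹ * frob Fq K α g with hA
  set B := g'⁻¹ * frob Fq K α g' with hB
  have h1 : frob Fq K α (g * m * g'⁻¹) = g * m * g'⁻¹ ↔ A * frob Fq K α m = m * B := by
    have e1 : frob Fq K α (g * m * g'⁻¹) = g * (A * frob Fq K α m) * (g' * B)⁻¹ := by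
      rw [map_mul, map_mul, map_inv, hA, hB]
      group
    rw [e1, mul_inv_eq_iff_eq_mul]
    constructor
    · intro h2
      have h3 := congrArg (g⁻¹ * ·) h2
      simpa [mul_assoc] using h3
    · intro h2
      rw [h2]
      group
  rw [h1]
  have h2 : A * frob Fq K α m = m * B ↔ ∀ i a b,
      (frob Fq K α m i : Matrix (Fin (α i)) (Fin (α i)) K) ((ω.perm h i).symm a) b =
        (m i : Matrix (Fin (α i)) (Fin (α i)) K) a (ν.perm h' i b) := by
    rw [funext_iff]
    refine forall_congr' fun i => ?_
    rw [Units.ext_iff, ← Matrix.ext_iff]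
    refine forall₂_congr fun a b => ?_
    rw [Pi.mul_apply, Pi.mul_apply, Units.val_mul, Units.val_mul, hA, hB, twist_J, twist_J]
    rw [Matrix.mul_apply, Matrix.mul_apply]
    simp only [Multitype.J, Matrix.of_apply, mul_ite, mul_one, mul_zero, ite_mul, one_mul, zero_mul]
    rw [Finset.sum_ite_eq' Finset.univ (ν.perm h' i b), if_pos (Finset.mem_univ _),
      Finset.sum_eq_single ((ω.perm h i).symm a)]
    · simp
    · intro c _ hc
      rw [if_neg]
      rintro rfl
      exact hc (by simp)
    · simp
  rw [h2]
  refine forall_congr' fun i => ⟨fun H a b => ?_, fun H a b => ?_⟩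
  · rw [← H, frob_apply, Equiv.symm_apply_apply]
  · rw [frob_apply, ← H, Equiv.apply_symm_apply]

/-- Conjugation by `g_ω m g_ν⁻¹` carries `S_ν` to the torus defined by `f`, if the nonzero entries
of `m` are compatible with `f`. -/
theorem mem_conj_stdTorus {α : I →₀ ℕ} (ω ν : Multitype I) (h : ω.size = α) (h' : ν.size = α)
    (f : ω.Pt → ν.Pt) (m : GLv K α)
    (hm : ∀ i a b, (m i : Matrix (Fin (α i)) (Fin (α i)) K) a b ≠ 0 →
      f (ω.pt h i a) = ν.pt h' i b) (x : GLv K α) :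
    x ∈ (stdTorus Fq K ν h').1.map
        (MulAut.conj (ω.twist Fq K h * m * (ν.twist Fq K h')⁻¹)).toMonoidHom ↔
      x ∈ labelTorus Fq K ω h f := by
  rw [mem_map_conj, mem_stdTorus]
  refine exists_congr fun z => forall_congr' fun i => ?_
  have e : (ν.twist Fq K h')⁻¹ * ((ω.twist Fq K h * m * (ν.twist Fq K h')⁻¹)⁻¹ * x *
      (ω.twist Fq K h * m * (ν.twist Fq K h')⁻¹)) * ν.twist Fq K h' =
      m⁻¹ * ((ω.twist Fq K h)⁻¹ * x * ω.twist Fq K h) * m := by group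
  rw [e]
  exact conj_eq_diagonal (m i) (((ω.twist Fq K h)⁻¹ * x * ω.twist Fq K h) i)
    (fun a => f (ω.pt h i a)) (fun b => ν.pt h' i b) (hm i) fun p => (z p : K)

/-- A label map `X_ω → X_ν` defines a torus contained in `S_ω` and rationally conjugate to `S_ν`. -/
theorem IsLabelMap.exists_torus {α : I →₀ ℕ} {ω ν : Multitype I} (h : ω.size = α)
    (h' : ν.size = α) {f : ω.Pt → ν.Pt} (hf : IsLabelMap ω ν f) :
    ∃ T : AdmTori Fq K α, RationallyConj Fq K (stdTorus Fq K ν h').1 T.1 ∧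
      ∀ x, x ∈ T.1 ↔ x ∈ labelTorus Fq K ω h f := by
  classical
  have hex : ∀ i, ∃ m : GL (Fin (α i)) K,
      (∀ a b, (m : Matrix (Fin (α i)) (Fin (α i)) K) a b ≠ 0 → f (ω.pt h i a) = ν.pt h' i b) ∧
      ∀ a b, (m : Matrix (Fin (α i)) (Fin (α i)) K) (ω.perm h i a) (ν.perm h' i b) =
        (m : Matrix (Fin (α i)) (Fin (α i)) K) a b ^ Fintype.card Fq := by
    intro i
    obtain ⟨M, hli, hsupp, hF⟩ := exists_frobenius_frame Fq (K := K) (A := Fin (α i))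
      (J := ν.Block) ν.d_pos (C := fun j => Fin (ν.β j i)) (ω.perm h i)
      (fun a => f (ω.pt h i a)) (fun a => by rw [ω.pt_perm, hf.equivariant]; rfl)
      (fun j => by rw [card_fiber_eq ω h, hf.sum_eq, Fintype.card_fin])
    let N : Matrix (Fin (α i)) (Fin (α i)) K := Matrix.of fun b a => M (ν.enum h' i b) a
    have hN : IsUnit N := by
      rw [← Matrix.linearIndependent_rows_iff_isUnit]
      exact hli.comp (ν.enum h' i) (ν.enum h' i).injective
    have hNT : IsUnit N.transpose := (Matrix.isUnit_transpose N).2 hN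
    refine ⟨hNT.unit, fun a b hab => hsupp a _ hab, fun a b => ?_⟩
    show M (ν.enum h' i (ν.perm h' i b)) (ω.perm h i a) = M (ν.enum h' i b) a ^ Fintype.card Fq
    rw [← hF]
    congr 1
    simp only [Multitype.perm, Equiv.trans_apply]
    rw [Equiv.apply_symm_apply]
    rfl
  choose m hm hmF using hex
  have hr := (frob_twist_mul_eq_iff (Fq := Fq) ω ν h h' m).2 hmF
  exact ⟨(stdTorus Fq K ν h').conj _ hr, ⟨_, hr, rfl⟩,
    mem_conj_stdTorus ω ν h h' f m hm⟩

/-- A torus contained in `S_ω` and rationally conjugate to `S_ν` is defined by a label map. -/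
theorem exists_labelMap_of_rationallyConj {α : I →₀ ℕ} (ω ν : Multitype I) (h : ω.size = α)
    (h' : ν.size = α) (T : Subgroup (GLv K α)) (hT : RationallyConj Fq K (stdTorus Fq K ν h').1 T)
    (hle : T ≤ (stdTorus Fq K ω h).1) :
    ∃ f, IsLabelMap ω ν f ∧ ∀ x, x ∈ T ↔ x ∈ labelTorus Fq K ω h f := by
  classical
  obtain ⟨r, hr, rfl⟩ := hT
  obtain ⟨m, rfl⟩ : ∃ m, r = ω.twist Fq K h * m * (ν.twist Fq K h')⁻¹ :=
    ⟨(ω.twist Fq K h)⁻¹ * r * ν.twist Fq K h', by group⟩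
  rw [frob_twist_mul_eq_iff] at hr
  -- nonzero entries of `m` force equal weights, so that a generic element of `S_ν` yields `f`
  obtain ⟨Z⟩ := exists_embedding_units K ν.Pt
  obtain ⟨f, hf⟩ := exists_map_of_relation (X := ω.Pt) (Y := ν.Pt) (R := (i : I) × Fin (α i))
    (C := (i : I) × Fin (α i)) (fun p => ω.pt h p.1 p.2) (fun p => ν.pt h' p.1 p.2)
    (fun p p' => Matrix.blockDiagonal'
      (fun i => (m i : Matrix (Fin (α i)) (Fin (α i)) K)) p p' ≠ 0)
    (by
      intro x
      obtain ⟨i, a, rfl⟩ := ω.exists_pt h x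
      obtain ⟨b, hb⟩ := exists_entry_ne_zero (m i) a
      exact ⟨⟨i, a⟩, ⟨i, b⟩, rfl, by rwa [Matrix.blockDiagonal'_apply_eq]⟩) Z
    (by
      intro z
      obtain ⟨s, hs⟩ := exists_mem_labelTorus (Fq := Fq) ν h' z
      have hs' := (mem_stdTorus ν h' s).2 ⟨z, hs⟩
      obtain ⟨w, hw⟩ := (mem_stdTorus ω h _).1 (hle ⟨s, hs', rfl⟩)
      refine ⟨w, ?_⟩
      rintro ⟨i, a⟩ ⟨i', b⟩ hab
      obtain rfl : i = i' := by
        by_contra hne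
        exact hab (Matrix.blockDiagonal'_apply_ne _ _ _ hne)
      rw [Matrix.blockDiagonal'_apply_eq] at hab
      refine Units.ext (entry_eq_of_intertwine (m i) _ _ _ _ (hw i) (hs i) ?_ a b hab)
      rw [← Pi.mul_apply, ← Pi.mul_apply]
      simp only [MulEquiv.toMonoidHom_eq_coe, MonoidHom.coe_coe, MulAut.conj_apply]
      group)
  have hm : ∀ i a b, (m i : Matrix (Fin (α i)) (Fin (α i)) K) a b ≠ 0 →
      f (ω.pt h i a) = ν.pt h' i b := fun i a b hab =>
    hf ⟨i, a⟩ ⟨i, b⟩ (by rwa [Matrix.blockDiagonal'_apply_eq])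
  refine ⟨f, ⟨fun x => ?_, fun y => ?_⟩, mem_conj_stdTorus ω ν h h' f m hm⟩
  · obtain ⟨i, a, rfl⟩ := ω.exists_pt h x
    obtain ⟨b, hb⟩ := exists_entry_ne_zero (m i) a
    have hb' : (m i : Matrix (Fin (α i)) (Fin (α i)) K) (ω.perm h i a) (ν.perm h' i b) ≠ 0 := by
      rw [hr]
      exact pow_ne_zero _ hb
    rw [← ω.pt_perm, hm i _ _ hb', hm i _ _ hb, ν.pt_perm]
  · ext i
    rw [← card_fiber_eq ω h f y i, ← ν.card_pt h' i y]
    exact card_fiber_eq_of_support (m i) _ _ (hm i) y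

/-- Every `F`-stable admissible torus contained in `S_ω` is defined by an equivariant equivalence
relation on `X_ω`. -/
theorem exists_label_of_le_stdTorus {α : I →₀ ℕ} (ω : Multitype I) (h : ω.size = α)
    (T : AdmTori Fq K α) (hle : T ≤ stdTorus Fq K ω h) :
    ∃ f : ω.Pt → ℕ, (∀ x, x ∈ T.1 ↔ x ∈ labelTorus Fq K ω h f) ∧
      ∀ x x', f x = f x' → f (ω.rot x) = f (ω.rot x') := by
  classical
  obtain ⟨c, u, hu1, hu2⟩ := T.2.1.exists_diag
  set G := blockEmb K α (ω.twist Fq K h) with hG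
  set m := G⁻¹ * u with hm
  obtain ⟨Z⟩ := exists_embedding_units K ℕ
  have hdiag : ∀ (x : GLv K α) (w : ω.Pt → Kˣ),
      (∀ i, ((((ω.twist Fq K h)⁻¹ * x * ω.twist Fq K h) i : GL (Fin (α i)) K) :
        Matrix (Fin (α i)) (Fin (α i)) K) = Matrix.diagonal fun a => (w (ω.pt h i a) : K)) ↔
      ((G⁻¹ * blockEmb K α x * G : GL ((i : I) × Fin (α i)) K) :
        Matrix ((i : I) × Fin (α i)) ((i : I) × Fin (α i)) K) =
        Matrix.diagonal fun p => (w (ω.pt h p.1 p.2) : K) := by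
    intro x w
    rw [hG, ← map_inv, ← map_mul, ← map_mul, blockEmb_coe,
      ← Matrix.blockDiagonal'_diagonal (fun i a => (w (ω.pt h i a) : K))]
    rw [Matrix.blockDiagonal'_injective.eq_iff, funext_iff]
  obtain ⟨f, hf⟩ := exists_map_of_relation (fun p : (i : I) × Fin (α i) => ω.pt h p.1 p.2) c
    (fun p p' => (m : Matrix ((i : I) × Fin (α i)) ((i : I) × Fin (α i)) K) p p' ≠ 0)
    (by
      intro x
      obtain ⟨i, a, rfl⟩ := ω.exists_pt h x
      obtain ⟨b, hb⟩ := exists_entry_ne_zero m ⟨i, a⟩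
      exact ⟨⟨i, a⟩, b, rfl, hb⟩) Z
    (by
      intro z
      let D : GL ((i : I) × Fin (α i)) K := Matrix.GeneralLinearGroup.mkOfDetNeZero
        (Matrix.diagonal fun p => (z (c p) : K)) (by
          rw [Matrix.det_diagonal]
          exact Finset.prod_ne_zero_iff.2 fun p _ => Units.ne_zero _)
      obtain ⟨x, hx, hxD⟩ := hu2 (u * D * u⁻¹) ⟨z, by
        simp only [mul_assoc, inv_mul_cancel_left, inv_mul_cancel, mul_one]; rfl⟩
      obtain ⟨w, hw⟩ := (mem_stdTorus ω h x).1 (hle hx)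
      refine ⟨w, fun p p' hpp => Units.ext ?_⟩
      refine entry_eq_of_intertwine m (G⁻¹ * blockEmb K α x * G) D
        (fun p => (w (ω.pt h p.1 p.2) : K)) (fun p => (z (c p) : K)) ((hdiag x w).1 hw) rfl ?_
        p p' hpp
      rw [hm, hxD]
      group)
  have hT : ∀ x, x ∈ T.1 ↔ x ∈ labelTorus Fq K ω h f := by
    intro x
    rw [hu1]
    refine exists_congr fun z => ?_
    rw [hdiag x fun p => z (f p)]
    rw [← conj_eq_diagonal m (G⁻¹ * blockEmb K α x * G) (fun p => f (ω.pt h p.1 p.2)) c hf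
      fun k => (z k : K)]
    rw [hm]
    have e : (G⁻¹ * u)⁻¹ * (G⁻¹ * blockEmb K α x * G) * (G⁻¹ * u) =
      u⁻¹ * blockEmb K α x * u := by group
    rw [e]
  refine ⟨f, hT, ?_⟩
  -- compare the weights of a generic element `F(y)` of `T` with those of `y`
  obtain ⟨x, hx⟩ := exists_mem_labelTorus (Fq := Fq) ω h fun p => Z (f p)
  have hxT : x ∈ T.1 := (hT x).2 ⟨Z, hx⟩
  rw [← T.2.2] at hxT
  obtain ⟨y, hy, rfl⟩ := hxT
  obtain ⟨z, hz⟩ := (hT y).1 hy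
  set g := ω.twist Fq K h with hg
  let w : ω.Pt → Kˣ := fun p => z (f (ω.rot.symm p)) ^ Fintype.card Fq
  obtain ⟨t, ht⟩ := exists_mem_labelTorus (Fq := Fq) ω h w
  have hFy : frob Fq K α y = t := by
    have := mul_frob_eq Fq ω h g (g⁻¹ * y * g) (g⁻¹ * t * g) (twist_J ω h)
      (fun j k => z (f ⟨j, k⟩)) (fun j k => w ⟨j, k⟩) hz ht (by
        intro j k
        simp only [w]
        congr 3
        rw [Equiv.symm_apply_eq]
        rfl)
    have e : ∀ y, g * (g⁻¹ * y * g) * g⁻¹ = y := fun y => by group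
    rwa [e, e] at this
  have key : ∀ p, Z (f p) = w p := by
    intro p
    obtain ⟨i, a, rfl⟩ := ω.exists_pt h p
    have h1 := hx i
    rw [hFy] at h1
    have := congrFun (Matrix.diagonal_injective (h1.symm.trans (ht i))) a
    exact Units.ext this
  intro p p' hpp
  apply Z.injective
  rw [key, key]
  simp only [w, Equiv.symm_apply_apply, hpp]

end LabelTorus

/-! ### Labelled permutations and semisimple types -/

theorem val_finRotate_pow {d : ℕ} (m : ℕ) (k : Fin d) :
    ((finRotate d ^ m) k : Fin d).val = ((k : ℕ) + m) % d := by
  induction m with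
  | zero => simp [Nat.mod_eq_of_lt k.2]
  | succ m ih =>
    obtain _ | d := d
    · exact k.elim0
    rw [pow_succ', Equiv.Perm.mul_apply, finRotate_apply, Fin.val_add, ih]
    simp [add_assoc]

theorem finRotate_pow_eq_iff {d : ℕ} (m : ℕ) (k : Fin d) :
    (finRotate d ^ m) k = k ↔ d ∣ m := by
  rw [Fin.ext_iff, val_finRotate_pow]
  constructor
  · intro h
    have h1 := Nat.mod_add_div ((k : ℕ) + m) d
    rw [h] at h1
    exact ⟨_, (Nat.add_left_cancel h1).symm⟩
  · rintro ⟨q, rfl⟩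
    rw [Nat.add_mul_mod_self_left, Nat.mod_eq_of_lt k.2]

/-- A permutation of a finite set is a disjoint union of cyclic shifts. -/
theorem exists_cycle_decomposition {Y : Type*} [Finite Y] (σ : Equiv.Perm Y) :
    ∃ (J : Type) (_ : Fintype J) (d : J → ℕ+) (e : ((j : J) × Fin (d j)) ≃ Y),
      ∀ j k, e ⟨j, finRotate _ k⟩ = σ (e ⟨j, k⟩) := by
  classical
  have := Fintype.ofFinite Y
  let s := Equiv.Perm.SameCycle.setoid σ
  let J' := Quotient s
  have : Fintype J' := Fintype.ofFinite J'
  let r : J' → Y := Quotient.out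
  have hper : ∀ y, 0 < Function.minimalPeriod σ y := fun y =>
    Function.minimalPeriod_pos_of_mem_periodicPts
      ((Function.mem_periodicPts).2 ⟨orderOf σ, orderOf_pos σ, by
        rw [Function.IsPeriodicPt, Function.IsFixedPt, ← Equiv.Perm.coe_pow, pow_orderOf_eq_one]
        rfl⟩)
  let d' : J' → ℕ+ := fun j => ⟨Function.minimalPeriod σ (r j), hper _⟩
  let u : ((j : J') × Fin (d' j)) → Y := fun p => σ^[(p.2 : ℕ)] (r p.1)
  have hu : Function.Bijective u := by
    constructor
    · rintro ⟨j, k⟩ ⟨j', k'⟩ h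
      have h1 : σ.SameCycle (r j) (r j') := by
        have h2 : σ.SameCycle (r j) (u ⟨j, k⟩) := ⟨(k : ℕ), by
          rw [zpow_natCast, Equiv.Perm.coe_pow]⟩
        have h3 : σ.SameCycle (r j') (u ⟨j', k'⟩) := ⟨(k' : ℕ), by
          rw [zpow_natCast, Equiv.Perm.coe_pow]⟩
        rw [← h] at h3
        exact h2.trans h3.symm
      obtain rfl : j = j' := by
        rw [← Quotient.out_eq j, ← Quotient.out_eq j']
        exact Quotient.sound h1
      have h4 := (Function.iterate_eq_iterate_iff_of_lt_minimalPeriod k.2 k'.2).1 h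
      rw [Fin.ext h4]
    · intro y
      have h1 : σ.SameCycle (r (Quotient.mk s y)) y :=
        @Quotient.exact Y s (r (Quotient.mk s y)) y (Quotient.out_eq _)
      obtain ⟨i, hi⟩ := h1.exists_nat_pow_eq
      refine ⟨⟨Quotient.mk s y, ⟨i % _, Nat.mod_lt _ (hper _)⟩⟩, ?_⟩
      rw [Equiv.Perm.coe_pow] at hi
      exact Function.iterate_mod_minimalPeriod_eq.trans hi
  let eJ := Fintype.equivFin J'
  let e' : ((j : Fin (Fintype.card J')) × Fin (d' (eJ.symm j))) ≃ ((j : J') × Fin (d' j)) :=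
    Equiv.sigmaCongrLeft (β := fun j => Fin (d' j)) eJ.symm
  refine ⟨Fin (Fintype.card J'), inferInstance, fun j => d' (eJ.symm j),
    e'.trans (Equiv.ofBijective u hu), fun j k => ?_⟩
  exact (finRotate_step (fun k => σ^[k] (r (eJ.symm j))) (Function.iterate_minimalPeriod)
    k).symm.trans (Function.iterate_succ_apply' _ _ _)

section Types

variable {I : Type*} [Fintype I]

/-- The label `(d_j, β_j)`. -/
def Multitype.key (ω : Multitype I) (j : ω.Block) : Lab I :=
  (⟨ω.d j, ω.d_pos j⟩, ⟨ω.β j, ω.β_ne_zero j⟩)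

/-- The semisimple type `(d₁, (1^{β₁}))⋯(d_r, (1^{β_r}))` of a multitype. -/
def Multitype.ss (ω : Multitype I) : SType I := famType ω.key

/-- The element `(d, (1^β))` of `ℕ × 𝒫^I`. -/
def Lab.toPair (x : Lab I) : ℕ × (I → Ptn) := ((x.1 : ℕ), oneMP x.2.1)

theorem msize_oneMP (α : I →₀ ℕ) : msize (oneMP α) = α := by
  ext i
  rfl

theorem Lab.toPair_injective : Function.Injective (Lab.toPair (I := I)) := by
  rintro ⟨d, β, hβ⟩ ⟨d', β', hβ'⟩ h
  have h1 : d = d' := PNat.coe_injective (congrArg Prod.fst h)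
  have h2 : β = β' := by
    rw [← msize_oneMP β, ← msize_oneMP β']
    exact congrArg (fun p => msize p.2) h
  subst h1 h2
  rfl

/-- A semisimple type as a multitype. -/
def SType.toMT (n : SType I) : Multitype I :=
  ⟨n.mapDomain Lab.toPair, by
    classical
    have key : ∀ y, n.mapDomain Lab.toPair y ≠ 0 → ∃ x : Lab I, x.toPair = y := by
      intro y hy
      have := Finsupp.mapDomain_support (Finsupp.mem_support_iff.2 hy)
      obtain ⟨x, -, rfl⟩ := Finset.mem_image.1 this
      exact ⟨x, rfl⟩
    constructor
    · intro l
      by_contra h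
      obtain ⟨x, hx⟩ := key _ h
      exact x.1.ne_zero (congrArg Prod.fst hx)
    · intro k l hl
      by_contra h
      obtain ⟨x, hx⟩ := key _ h
      exact x.2.2 (((msize_oneMP x.2.1).symm.trans
        (congrArg (fun p => msize p.2) hx)).trans hl)⟩

theorem SType.toMT_isSemisimple (n : SType I) : n.toMT.IsSemisimple := by
  classical
  intro x hx
  obtain ⟨y, -, rfl⟩ := Finset.mem_image.1 (Finsupp.mapDomain_support hx)
  exact ⟨_, rfl⟩

theorem Multitype.IsSemisimple.toMT_ss {ω : Multitype I} (h : ω.IsSemisimple) :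
    ω.ss.toMT = ω := by
  refine Subtype.ext ?_
  show ω.ss.mapDomain Lab.toPair = ω.1
  rw [ss, mapDomain_famType]
  conv_rhs => rw [← famType_sigma ω.1]
  congr 1
  funext b
  obtain ⟨α, hα⟩ := h b.1.1 b.1.2
  refine Prod.ext rfl ?_
  show oneMP (msize b.1.1.2) = b.1.1.2
  rw [hα, msize_oneMP]

theorem SType.ss_toMT (n : SType I) : n.toMT.ss = n :=
  Finsupp.mapDomain_injective Lab.toPair_injective
    (congrArg Subtype.val n.toMT_isSemisimple.toMT_ss)

theorem Multitype.size_eq_sum (ω : Multitype I) : ω.size = ∑ j, ω.d j • ω.β j := by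
  have h := famType_sum (fun b : ω.Block => b.1.1) (fun x => x.1 • msize x.2)
  rw [famType_sigma] at h
  refine Eq.trans ?_ h
  refine Finsupp.sum_congr fun x _ => ?_
  rw [smul_smul, mul_comm]

theorem Multitype.size_ss (ω : Multitype I) : SType.size ω.ss = ω.size := by
  rw [size_eq_sum, SType.size, ss, famType_sum]
  rfl

theorem SType.size_toMT (n : SType I) : n.toMT.size = n.size := by
  conv_rhs => rw [← n.ss_toMT]
  rw [Multitype.size_ss]

theorem SType.P_toMT (n : SType I) :
    n.toMT.P = n.prod fun x m => ((RatFunc.X : RatFunc ℚ) ^ (x.1 : ℕ) - 1) ^ m :=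
  Finsupp.prod_mapDomain_index_inj Lab.toPair_injective

theorem SType.isOfLevel_toMT (n : SType I) (V : Set (I →₀ ℕ)) :
    n.toMT.IsOfLevel V ↔ ∀ x ∈ n.support, x.2.1 ∈ V := by
  classical
  have hs : n.toMT.1.support = n.support.image Lab.toPair :=
    Finsupp.mapDomain_support_of_injective Lab.toPair_injective n
  rw [Multitype.IsOfLevel, hs]
  simp only [Finset.mem_image, forall_exists_index, and_imp, forall_apply_eq_imp_iff₂]
  refine forall₂_congr fun x _ => ?_
  rw [Lab.toPair, msize_oneMP]

/-- A family of labels is the family of labels of the multitype it defines. -/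
theorem exists_block_equiv {J : Type*} [Fintype J] (x : J → Lab I) :
    ∃ e : J ≃ (SType.toMT (famType x)).Block, ∀ j, (SType.toMT (famType x)).key (e j) = x j :=
  (famType_eq_iff _ _).1 (SType.ss_toMT (famType x)).symm

theorem Multitype.rot_apply (ω : Multitype I) (j : ω.Block) (k : Fin (ω.d j)) :
    ω.rot ⟨j, k⟩ = ⟨j, finRotate _ k⟩ := rfl

theorem Multitype.rot_pow_apply (ω : Multitype I) (m : ℕ) (j : ω.Block) (k : Fin (ω.d j)) :
    (ω.rot ^ m) ⟨j, k⟩ = ⟨j, (finRotate _ ^ m) k⟩ := by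
  induction m with
  | zero => rfl
  | succ m ih =>
    rw [pow_succ', Equiv.Perm.mul_apply, ih, rot_apply, pow_succ', Equiv.Perm.mul_apply]

theorem Multitype.rot_pow_eq_iff (ω : Multitype I) (m : ℕ) (x : ω.Pt) :
    (ω.rot ^ m) x = x ↔ ω.d x.1 ∣ m := by
  obtain ⟨j, k⟩ := x
  rw [rot_pow_apply, ← finRotate_pow_eq_iff m k]
  simp

theorem equivariant_pow {ω ν : Multitype I} {f : ω.Pt → ν.Pt}
    (hf : ∀ x, f (ω.rot x) = ν.rot (f x)) (m : ℕ) (x : ω.Pt) :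
    f ((ω.rot ^ m) x) = (ν.rot ^ m) (f x) := by
  induction m with
  | zero => rfl
  | succ m ih => rw [pow_succ', Equiv.Perm.mul_apply, hf, ih, pow_succ', Equiv.Perm.mul_apply]

theorem Multitype.sum_pt (ω : Multitype I) : ∑ x : ω.Pt, ω.β x.1 = ω.size := by
  rw [size_eq_sum, Fintype.sum_sigma]
  refine Finset.sum_congr rfl fun j _ => ?_
  refine (Finset.sum_const (ω.β j)).trans ?_
  rw [Finset.card_univ, Fintype.card_fin]

theorem IsLabelMap.size_eq {ω ν : Multitype I} {f : ω.Pt → ν.Pt} (hf : IsLabelMap ω ν f) :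
    ω.size = ν.size := by
  classical
  rw [← ω.sum_pt, ← ν.sum_pt, ← Finset.sum_fiberwise Finset.univ f]
  exact Finset.sum_congr rfl fun y _ => hf.sum_eq y

theorem isLabelMap_of_equiv {ω ν : Multitype I} (e : ω.Pt ≃ ν.Pt)
    (he : ∀ x, e (ω.rot x) = ν.rot (e x)) (hβ : ∀ x, ν.β (e x).1 = ω.β x.1) :
    IsLabelMap ω ν e := by
  classical
  refine ⟨he, fun y => ?_⟩
  have : (Finset.univ.filter fun x => e x = y) = {e.symm y} := by
    ext x
    simp [Equiv.eq_symm_apply]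
  rw [this, Finset.sum_singleton, ← hβ, Equiv.apply_symm_apply]

/-- Multitypes with the same semisimple type have isomorphic labelled permutations. -/
theorem exists_pt_equiv_of_ss_eq {ω ν : Multitype I} (h : ω.ss = ν.ss) :
    ∃ e : ω.Pt ≃ ν.Pt, IsLabelMap ω ν e := by
  obtain ⟨e, he⟩ := (famType_eq_iff _ _).1 h
  have hd : ∀ j, ω.d j = ν.d (e j) := fun j => (congrArg (fun x : Lab I => (x.1 : ℕ)) (he j)).symm
  have hβ : ∀ j, ν.β (e j) = ω.β j := fun j => congrArg (fun x : Lab I => x.2.1) (he j)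
  let E : ω.Pt ≃ ν.Pt := Equiv.sigmaCongr e fun j => finCongr (hd j)
  refine ⟨E, isLabelMap_of_equiv E ?_ fun x => hβ x.1⟩
  rintro ⟨j, k⟩
  have key : ∀ (a b : ℕ) (h : a = b) (k : Fin a), finCongr h (finRotate a k) =
      finRotate b (finCongr h k) := by
    rintro a _ rfl k
    rfl
  show (⟨e j, finCongr (hd j) (finRotate _ k)⟩ : ν.Pt) = ⟨e j, finRotate _ (finCongr (hd j) k)⟩
  rw [key]

theorem IsLabelMap.bijective_of_card_le {ω ν : Multitype I} {f : ω.Pt → ν.Pt}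
    (hf : IsLabelMap ω ν f) (h : Fintype.card ω.Pt ≤ Fintype.card ν.Pt) : Function.Bijective f :=
  (Fintype.bijective_iff_surjective_and_card f).2 ⟨hf.surjective,
    le_antisymm h (Fintype.card_le_of_surjective f hf.surjective)⟩

/-- The type can be read off from the labelled permutation. -/
theorem IsLabelMap.ss_eq {ω ν : Multitype I} {f : ω.Pt → ν.Pt}
    (hf : IsLabelMap ω ν f) (hb : Function.Bijective f) : ω.ss = ν.ss := by
  classical
  have hβ : ∀ x, ν.β (f x).1 = ω.β x.1 := by
    intro x
    rw [← hf.sum_eq (f x)]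
    have : (Finset.univ.filter fun x' => f x' = f x) = {x} := by
      ext x'
      simp [hb.1.eq_iff]
    rw [this, Finset.sum_singleton]
  have hd : ∀ x, ν.d (f x).1 = ω.d x.1 := by
    intro x
    refine Nat.dvd_antisymm ?_ ?_
    · rw [← Multitype.rot_pow_eq_iff, ← equivariant_pow hf.equivariant,
        (ω.rot_pow_eq_iff _ x).2 dvd_rfl]
    · rw [← Multitype.rot_pow_eq_iff]
      apply hb.1
      rw [equivariant_pow hf.equivariant, (ν.rot_pow_eq_iff _ _).2 dvd_rfl]
  have hkey : ∀ x, ν.key (f x).1 = ω.key x.1 := fun x =>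
    Prod.ext (PNat.coe_injective (hd x)) (Subtype.ext (hβ x))
  have hcount : ∀ (ω : Multitype I) (l : Lab I),
      Nat.card {x : ω.Pt // ω.key x.1 = l} = (l.1 : ℕ) * ω.ss l := by
    intro ω l
    rw [Multitype.ss, famType_apply, Nat.card_eq_fintype_card, Nat.card_eq_fintype_card,
      Fintype.card_subtype, Fintype.card_subtype, Finset.card_filter, Fintype.sum_sigma,
      Finset.card_filter, Finset.mul_sum]
    refine Finset.sum_congr rfl fun j _ => ?_
    refine (Finset.sum_const (if ω.key j = l then 1 else 0)).trans ?_
    rw [Finset.card_univ, Fintype.card_fin, smul_eq_mul]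
    split_ifs with hj
    · rw [← hj]
      rfl
    · simp
  ext l
  have h1 := hcount ω l
  rw [Nat.card_congr ((Equiv.ofBijective f hb).subtypeEquiv
    (q := fun y => ν.key y.1 = l) fun x => by
      rw [Equiv.ofBijective_apply, hkey]), hcount] at h1
  exact (Nat.eq_of_mul_eq_mul_left l.1.pos h1).symm

/-- Label maps compose. -/
theorem IsLabelMap.comp {ω ν μ : Multitype I} {f : ω.Pt → ν.Pt} {g : ν.Pt → μ.Pt}
    (hg : IsLabelMap ν μ g) (hf : IsLabelMap ω ν f) : IsLabelMap ω μ fun x => g (f x) := by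
  classical
  refine ⟨fun x => by rw [hf.equivariant, hg.equivariant], fun y => ?_⟩
  rw [← hg.sum_eq y, ← Finset.sum_congr rfl fun p _ => hf.sum_eq p,
    ← Finset.sum_fiberwise_of_maps_to (g := f) (t := Finset.univ.filter fun p => g p = y)
      (fun x hx => by simpa using hx)]
  refine Finset.sum_congr rfl fun p hp => ?_
  rw [Finset.filter_filter]
  refine Finset.sum_congr ?_ fun _ _ => rfl
  ext x
  simp only [Finset.mem_filter, Finset.mem_univ, true_and] at hp ⊢
  exact ⟨fun h => h.2, fun h => ⟨by rw [h, hp], h⟩⟩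

/-- Two label maps with the same fibres differ by a label map between their targets. -/
theorem IsLabelMap.exists_factor {ω ν μ : Multitype I} {f : ω.Pt → ν.Pt} {g : ω.Pt → μ.Pt}
    (hf : IsLabelMap ω ν f) (hg : IsLabelMap ω μ g) (h : ∀ x x', f x = f x' → g x = g x') :
    ∃ u, IsLabelMap ν μ u ∧ ∀ x, u (f x) = g x := by
  classical
  choose s hs using hf.surjective
  have hu : ∀ x, g (s (f x)) = g x := fun x => h _ _ (hs _)
  refine ⟨fun y => g (s y), ⟨fun y => ?_, fun y => ?_⟩, hu⟩
  · obtain ⟨x, rfl⟩ := hf.surjective y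
    rw [← hf.equivariant, hu, hu, hg.equivariant]
  · rw [← hg.sum_eq y, ← Finset.sum_congr rfl fun p _ => hf.sum_eq p,
      ← Finset.sum_fiberwise_of_maps_to (g := f) (s := Finset.univ.filter fun x => g x = y)
        (t := Finset.univ.filter fun p => g (s p) = y) (fun x hx => by simpa [hu] using hx)]
    refine Finset.sum_congr rfl fun p hp => ?_
    rw [Finset.filter_filter]
    refine Finset.sum_congr ?_ fun _ _ => rfl
    ext x
    simp only [Finset.mem_filter, Finset.mem_univ, true_and] at hp ⊢
    exact ⟨fun h => ⟨by rw [← hu, h, hp], h⟩, fun h => h.2⟩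

/-- An equivariant equivalence relation on `X_ω` is given by the fibres of a label map. -/
theorem exists_labelMap_of_kernel {Y : Type*} (ω : Multitype I) (f : ω.Pt → Y)
    (hf : ∀ x x', f x = f x' → f (ω.rot x) = f (ω.rot x')) :
    ∃ (n : SType I) (g : ω.Pt → n.toMT.Pt), IsLabelMap ω n.toMT g ∧
      ∀ x x', g x = g x' ↔ f x = f x' := by
  classical
  let X := Set.range f
  have hsurj : Function.Surjective (Set.rangeFactorization f) := Set.rangeFactorization_surjective
  have hfin : Finite X := Finite.of_surjective _ hsurj
  choose s hs using hsurj
  have hs' : ∀ y : X, f (s y) = y := fun y => congrArg Subtype.val (hs y)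
  let σ₀ : X → X := fun y => Set.rangeFactorization f (ω.rot (s y))
  have hσ₀ : ∀ x, σ₀ (Set.rangeFactorization f x) = Set.rangeFactorization f (ω.rot x) := fun x =>
    Subtype.ext (hf _ _ (hs' _))
  have hσ : Function.Bijective σ₀ := by
    refine Finite.injective_iff_bijective.1 (Finite.injective_iff_surjective.2 fun y => ?_)
    refine ⟨Set.rangeFactorization f (ω.rot.symm (s y)), ?_⟩
    rw [hσ₀, Equiv.apply_symm_apply, hs]
  obtain ⟨J, _, d, e, he⟩ := exists_cycle_decomposition (Equiv.ofBijective σ₀ hσ)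
  -- the sums of the labels over the fibres, which are constant along the cycles
  let γ : X → I →₀ ℕ := fun y => ∑ x with f x = y, ω.β x.1
  have hγσ : ∀ y, γ (σ₀ y) = γ y := by
    intro y
    refine (Finset.sum_equiv ω.rot (fun x => ?_) fun x _ => rfl).symm
    simp only [Finset.mem_filter, Finset.mem_univ, true_and]
    have h1 : σ₀ (Set.rangeFactorization f x) = σ₀ y ↔ f x = y := by
      rw [hσ.1.eq_iff, Subtype.ext_iff]
      rfl
    rw [← h1, hσ₀, Subtype.ext_iff]
    rfl
  have hγ0 : ∀ y, γ y ≠ 0 := by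
    intro y h0
    have h1 : ω.β (s y).1 ≤ γ y :=
      Finset.single_le_sum (f := fun x : ω.Pt => ω.β x.1) (fun _ _ => zero_le)
        (Finset.mem_filter.2 ⟨Finset.mem_univ _, hs' y⟩)
    rw [h0] at h1
    exact ω.β_ne_zero _ (le_antisymm h1 zero_le)
  have hγe : ∀ j k, γ (e ⟨j, k⟩) = γ (e ⟨j, ⟨0, (d j).pos⟩⟩) := by
    intro j k
    have h1 : ∀ m : ℕ, γ (e ⟨j, (finRotate _ ^ m) ⟨0, (d j).pos⟩⟩) =
        γ (e ⟨j, ⟨0, (d j).pos⟩⟩) := by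
      intro m
      induction m with
      | zero => rfl
      | succ m ih =>
        rw [pow_succ', Equiv.Perm.mul_apply, he, ← ih]
        exact hγσ _
    rw [← h1 k, finRotate_pow_zero]
  let lab : J → Lab I := fun j => (d j, ⟨γ (e ⟨j, ⟨0, (d j).pos⟩⟩), hγ0 _⟩)
  obtain ⟨n, E, hE⟩ : ∃ (n : SType I) (E : J ≃ n.toMT.Block), ∀ j, n.toMT.key (E j) = lab j :=
    ⟨famType lab, exists_block_equiv lab⟩
  have hd : ∀ j, (d j : ℕ) = n.toMT.d (E j) := fun j =>
    (congrArg (fun x : Lab I => (x.1 : ℕ)) (hE j)).symm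
  have hβ : ∀ j, n.toMT.β (E j) = γ (e ⟨j, ⟨0, (d j).pos⟩⟩) := fun j =>
    congrArg (fun x : Lab I => x.2.1) (hE j)
  let E' : ((j : J) × Fin (d j)) ≃ n.toMT.Pt := Equiv.sigmaCongr E fun j => finCongr (hd j)
  have key : ∀ (a b : ℕ) (h : a = b) (k : Fin a), finCongr h (finRotate a k) =
      finRotate b (finCongr h k) := by
    rintro a _ rfl k
    rfl
  have hE'rot : ∀ j k, E' ⟨j, finRotate _ k⟩ = n.toMT.rot (E' ⟨j, k⟩) := by
    intro j k
    show (⟨E j, finCongr (hd j) (finRotate _ k)⟩ : n.toMT.Pt) =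
      ⟨E j, finRotate _ (finCongr (hd j) k)⟩
    rw [key]
  let g : X ≃ n.toMT.Pt := e.symm.trans E'
  have hgσ : ∀ y, g (σ₀ y) = n.toMT.rot (g y) := by
    intro y
    obtain ⟨⟨j, k⟩, rfl⟩ := e.surjective y
    have := he j k
    rw [Equiv.ofBijective_apply] at this
    rw [← this]
    simp only [g, Equiv.trans_apply, Equiv.symm_apply_apply]
    exact hE'rot j k
  have hgβ : ∀ y, n.toMT.β (g y).1 = γ y := by
    intro y
    obtain ⟨⟨j, k⟩, rfl⟩ := e.surjective y
    simp only [g, Equiv.trans_apply, Equiv.symm_apply_apply]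
    rw [hγe]
    exact hβ j
  refine ⟨n, fun x => g (Set.rangeFactorization f x), ⟨fun x => ?_, fun y => ?_⟩,
    fun x x' => ?_⟩
  · rw [← hσ₀, hgσ]
  · obtain ⟨y, rfl⟩ := g.surjective y
    rw [hgβ]
    refine Finset.sum_congr ?_ fun _ _ => rfl
    ext x
    simp only [Finset.mem_filter, Finset.mem_univ, true_and, g.apply_eq_iff_eq]
    rw [Subtype.ext_iff]
    rfl
  · rw [g.apply_eq_iff_eq, Subtype.ext_iff]
    rfl

end Types

/-! ### Counting label maps -/

section Counting

variable {I : Type*} [Fintype I]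

/-- The label maps from `X_ω` to `X_ν`. -/
abbrev LabelMap (ω ν : Multitype I) : Type _ := {f : ω.Pt → ν.Pt // IsLabelMap ω ν f}

/-- The maps of index sets underlying label maps: the length of the image of a cycle divides the
length of the cycle, and the total dimensions agree. -/
structure IsIndexMap (ω ν : Multitype I) (τ : ω.Block → ν.Block) : Prop where
  dvd : ∀ b, ν.d (τ b) ∣ ω.d b
  sum_eq : ∀ j, (open scoped Classical in ∑ b with τ b = j, ω.d b • ω.β b) = ν.d j • ν.β j

/-- The first point of a cycle. -/
def Multitype.base (ω : Multitype I) (b : ω.Block) : ω.Pt := ⟨b, ⟨0, ω.d_pos b⟩⟩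

theorem Multitype.rot_pow_base (ω : Multitype I) (b : ω.Block) (k : Fin (ω.d b)) :
    (ω.rot ^ (k : ℕ)) (ω.base b) = ⟨b, k⟩ := by
  rw [base, rot_pow_apply, finRotate_pow_zero]

theorem Multitype.rot_pow_fst (ω : Multitype I) (m : ℕ) (x : ω.Pt) : ((ω.rot ^ m) x).1 = x.1 := by
  obtain ⟨j, k⟩ := x
  rw [rot_pow_apply]

theorem equivariant_eq {ω ν : Multitype I} {f : ω.Pt → ν.Pt}
    (hf : ∀ x, f (ω.rot x) = ν.rot (f x)) (b : ω.Block) (k : Fin (ω.d b)) :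
    f ⟨b, k⟩ = (ν.rot ^ (k : ℕ)) (f (ω.base b)) := by
  rw [← ω.rot_pow_base, equivariant_pow hf]

/-- The fibre sums of an equivariant map are constant along cycles, so that only the total
dimensions have to be compared. -/
theorem isLabelMap_iff {ω ν : Multitype I} {f : ω.Pt → ν.Pt}
    (hf : ∀ x, f (ω.rot x) = ν.rot (f x)) :
    IsLabelMap ω ν f ↔ IsIndexMap ω ν fun b => (f (ω.base b)).1 := by
  classical
  -- the fibre sums
  let s : ν.Pt → I →₀ ℕ := fun y => ∑ x with f x = y, ω.β x.1
  have hfst : ∀ x : ω.Pt, (f x).1 = (f (ω.base x.1)).1 := by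
    rintro ⟨b, k⟩
    rw [equivariant_eq hf, Multitype.rot_pow_fst]
  have hdvd : ∀ b, ν.d (f (ω.base b)).1 ∣ ω.d b := by
    intro b
    have h1 : (ω.rot ^ ω.d b) (ω.base b) = ω.base b := (ω.rot_pow_eq_iff _ _).2 dvd_rfl
    rw [← Multitype.rot_pow_eq_iff, ← equivariant_pow hf, h1]
  have hrot : ∀ y, s (ν.rot y) = s y := by
    intro y
    refine (Finset.sum_equiv ω.rot (fun x => ?_) fun x _ => rfl).symm
    simp only [Finset.mem_filter, Finset.mem_univ, true_and]
    rw [hf, ν.rot.apply_eq_iff_eq]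
  have hconst : ∀ j k, s ⟨j, k⟩ = s (ν.base j) := by
    intro j k
    rw [← ν.rot_pow_base]
    have : ∀ m : ℕ, s ((ν.rot ^ m) (ν.base j)) = s (ν.base j) := by
      intro m
      induction m with
      | zero => rfl
      | succ m ih => rw [pow_succ', Equiv.Perm.mul_apply, hrot, ih]
    exact this _
  have hsum : ∀ j, ∑ b with (f (ω.base b)).1 = j, ω.d b • ω.β b = ν.d j • s (ν.base j) := by
    intro j
    have h1 : ∑ x : ω.Pt with (f x).1 = j, ω.β x.1 =
        ∑ b with (f (ω.base b)).1 = j, ω.d b • ω.β b := by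
      rw [Finset.sum_filter, Finset.sum_filter, Fintype.sum_sigma]
      refine Finset.sum_congr rfl fun b _ => ?_
      rw [Finset.sum_congr rfl fun k _ => by rw [hfst ⟨b, k⟩]]
      refine (Finset.sum_const (if (f (ω.base b)).1 = j then ω.β b else 0)).trans ?_
      rw [Finset.card_univ, Fintype.card_fin]
      split_ifs
      · rfl
      · simp
    have h2 : ∑ x : ω.Pt with (f x).1 = j, ω.β x.1 = ∑ k : Fin (ν.d j), s ⟨j, k⟩ := by
      rw [← Finset.sum_fiberwise_of_maps_to (s := Finset.univ.filter fun x => (f x).1 = j)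
        (t := Finset.univ.image (Sigma.mk j)) (g := f) (fun x hx => by
          obtain rfl := (Finset.mem_filter.1 hx).2
          exact Finset.mem_image.2 ⟨(f x).2, Finset.mem_univ _, rfl⟩), Finset.sum_image (by
            intro k _ k' _ h
            simpa using h)]
      refine Finset.sum_congr rfl fun k _ => ?_
      rw [Finset.filter_filter]
      refine Finset.sum_congr ?_ fun _ _ => rfl
      ext x
      simp only [Finset.mem_filter, Finset.mem_univ, true_and]
      exact ⟨fun h => h.2, fun h => ⟨by rw [h], h⟩⟩
    rw [← h1, h2, Finset.sum_congr rfl fun k _ => hconst j k, Finset.sum_const, Finset.card_univ,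
      Fintype.card_fin]
  constructor
  · intro h
    refine ⟨hdvd, fun j => ?_⟩
    rw [hsum]
    exact congrArg _ (h.sum_eq _)
  · intro h
    refine ⟨hf, ?_⟩
    rintro ⟨j, k⟩
    refine (hconst j k).trans ?_
    have := (hsum j).symm.trans (h.sum_eq j)
    exact smul_right_injective _ (ν.d_pos j).ne' this

/-- A label map is determined by its values at the first points of the cycles. -/
def labelMapEquiv (ω ν : Multitype I) :
    LabelMap ω ν ≃ {y : ω.Block → ν.Pt // IsIndexMap ω ν fun b => (y b).1} where
  toFun f := ⟨fun b => f.1 (ω.base b), (isLabelMap_iff f.2.equivariant).1 f.2⟩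
  invFun y :=
    have hrot : ∀ x : ω.Pt, (fun x : ω.Pt => (ν.rot ^ (x.2 : ℕ)) (y.1 x.1)) (ω.rot x) =
        ν.rot ((ν.rot ^ (x.2 : ℕ)) (y.1 x.1)) := by
      rintro ⟨b, k⟩
      have h := finRotate_step (fun m => (ν.rot ^ m) (y.1 b))
        ((ν.rot_pow_eq_iff _ _).2 (y.2.dvd b)) k
      simp only [pow_succ', Equiv.Perm.mul_apply] at h
      exact h.symm
    ⟨fun x => (ν.rot ^ (x.2 : ℕ)) (y.1 x.1), (isLabelMap_iff hrot).2 y.2⟩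
  left_inv f := Subtype.ext (funext fun ⟨b, k⟩ => (equivariant_eq f.2.equivariant b k).symm)
  right_inv y := rfl

open scoped Classical in
/-- Over an index map `τ`, a label map is given by an arbitrary choice, for each `b`, of the image
of the first point of the cycle `b` in the cycle `τ b`. -/
theorem card_labelMap (ω ν : Multitype I) :
    Fintype.card (LabelMap ω ν) = ∑ τ with IsIndexMap ω ν τ, ∏ b, ν.d (τ b) := by
  rw [Fintype.card_congr (labelMapEquiv ω ν), Fintype.card_subtype,
    Finset.card_eq_sum_card_fiberwise (f := fun (y : ω.Block → ν.Pt) b => (y b).1)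
      (t := Finset.univ.filter fun τ => IsIndexMap ω ν τ) (fun y hy => by simpa using hy)]
  refine Finset.sum_congr rfl fun τ hτ => ?_
  have h1 : ((Finset.univ.filter fun y : ω.Block → ν.Pt => IsIndexMap ω ν fun b => (y b).1).filter
      fun y => (fun b => (y b).1) = τ) =
      Fintype.piFinset fun b => Finset.univ.map
        (Function.Embedding.sigmaMk (β := fun j => Fin (ν.d j)) (τ b)) := by
    ext y
    simp only [Finset.mem_filter, Finset.mem_univ, true_and, Fintype.mem_piFinset, Finset.mem_map,
      Function.Embedding.sigmaMk_apply] at hτ ⊢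
    constructor
    · rintro ⟨-, rfl⟩ b
      exact ⟨(y b).2, rfl⟩
    · intro h
      have : (fun b => (y b).1) = τ := by
        funext b
        obtain ⟨k, hk⟩ := h b
        rw [← hk]
      exact ⟨this ▸ hτ, this⟩
  rw [h1, Fintype.card_piFinset]
  simp

omit [Fintype I] in
theorem SType.W_ne_zero (n : SType I) : n.W ≠ 0 :=
  Finset.prod_ne_zero_iff.2 fun x _ =>
    mul_ne_zero (pow_ne_zero _ x.1.ne_zero) (Nat.factorial_ne_zero _)

/-- The index maps from `ω` to itself are the permutations preserving the labels. -/
theorem isIndexMap_self_iff (ω : Multitype I) (τ : ω.Block → ω.Block) :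
    IsIndexMap ω ω τ ↔ Function.Bijective τ ∧ ∀ b, ω.key (τ b) = ω.key b := by
  classical
  have hsingle : Function.Injective τ → ∀ b, ∑ b' with τ b' = τ b, ω.d b' • ω.β b' =
      ω.d b • ω.β b := by
    intro hinj b
    have : (Finset.univ.filter fun b' => τ b' = τ b) = {b} := by
      ext b'
      simp [hinj.eq_iff]
    rw [this, Finset.sum_singleton]
  constructor
  · intro h
    have hsurj : Function.Surjective τ := by
      intro j
      by_contra hcon
      push Not at hcon
      have := h.sum_eq j
      rw [Finset.filter_false_of_mem fun b _ => hcon b, Finset.sum_empty] at this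
      exact smul_ne_zero (ω.d_pos j).ne' (ω.β_ne_zero j) this.symm
    have hb : Function.Bijective τ := Finite.surjective_iff_bijective.1 hsurj
    refine ⟨hb, fun b => ?_⟩
    have hle : ∀ b, ω.d (τ b) ≤ ω.d b := fun b => Nat.le_of_dvd (ω.d_pos b) (h.dvd b)
    -- `d ∘ τ ≤ d`, while both functions have the same sum
    have hd : ω.d (τ b) = ω.d b :=
      (Finset.sum_eq_sum_iff_of_le fun b _ => hle b).1
        (hb.sum_comp fun b => ω.d b) b (Finset.mem_univ b)
    refine Prod.ext (PNat.coe_injective hd) (Subtype.ext ?_)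
    have h1 := (hsingle hb.1 b).symm.trans (h.sum_eq (τ b))
    rw [hd] at h1
    exact (smul_right_injective _ (ω.d_pos b).ne' h1).symm
  · rintro ⟨hb, hkey⟩
    have hd : ∀ b, ω.d (τ b) = ω.d b := fun b => congrArg (fun x : Lab I => (x.1 : ℕ)) (hkey b)
    have hβ : ∀ b, ω.β (τ b) = ω.β b := fun b => congrArg (fun x : Lab I => x.2.1) (hkey b)
    refine ⟨fun b => (hd b).dvd, fun j => ?_⟩
    obtain ⟨b, rfl⟩ := hb.2 j
    rw [hd, hβ]
    exact hsingle hb.1 b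

/-- The label maps from `X_ω` to itself are its automorphisms, and there are `w` of them. -/
theorem card_labelMap_self (ω : Multitype I) [Fintype (LabelMap ω ω)] :
    Fintype.card (LabelMap ω ω) = ω.ss.W := by
  classical
  have : DecidableEq ω.Block := Classical.decEq _
  have h1 : Fintype.card (LabelMap ω ω) = ∑ τ with IsIndexMap ω ω τ, ∏ b, ω.d (τ b) := by
    convert card_labelMap ω ω
  have h2 : ∀ τ ∈ Finset.univ.filter fun τ => IsIndexMap ω ω τ, ∏ b, ω.d (τ b) = ∏ b, ω.d b := by
    intro τ hτ
    exact ((isIndexMap_self_iff ω τ).1 (Finset.mem_filter.1 hτ).2).1.prod_comp fun b => ω.d b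
  rw [Finset.sum_congr rfl h2, Finset.sum_const, smul_eq_mul] at h1
  have h3 : (Finset.univ.filter fun τ => IsIndexMap ω ω τ).card =
      (Finset.univ.filter fun g : Equiv.Perm ω.Block => (fun b => ω.key (g b)) = ω.key).card := by
    symm
    refine Finset.card_bij (fun g _ b => g b) ?_ ?_ ?_
    · intro g hg
      rw [Finset.mem_filter] at hg ⊢
      exact ⟨Finset.mem_univ _, (isIndexMap_self_iff ω g).2 ⟨g.bijective, congrFun hg.2⟩⟩
    · intro g _ g' _ h
      exact DFunLike.coe_injective h
    · intro τ hτ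
      obtain ⟨hb, hk⟩ := (isIndexMap_self_iff ω τ).1 (Finset.mem_filter.1 hτ).2
      exact ⟨Equiv.ofBijective τ hb, Finset.mem_filter.2 ⟨Finset.mem_univ _, funext hk⟩, rfl⟩
  rw [h3, card_perm_comp_eq] at h1
  have h4 : ω.ss.W = (ω.ss.prod fun x m => (x.1 : ℕ) ^ m) * facto ω.ss := by
    rw [SType.W, facto, Finsupp.prod, Finsupp.prod, Finsupp.prod, Finset.prod_mul_distrib]
  have h5 : (ω.ss.prod fun x m => (x.1 : ℕ) ^ m) = ∏ b, ω.d b := famType_prod ω.key _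
  rw [h4, h5, h1, mul_comm]
  rfl

end Counting

/-! ### Counting the subtori of `S_ω` -/

section Tori

variable {I : Type*} [Fintype I] [DecidableEq I]
variable {Fq K : Type*} [Field Fq] [Fintype Fq] [Field K] [Algebra Fq K] [IsAlgClosed K]

omit [DecidableEq I] in
theorem labelTorus_eq_iff {α : I →₀ ℕ} (ω : Multitype I) (h : ω.size = α) {Y Y' : Type*}
    [Countable Y] [Countable Y'] (f : ω.Pt → Y) (f' : ω.Pt → Y') :
    labelTorus Fq K ω h f = labelTorus Fq K ω h f' ↔ ∀ x x', f x = f x' ↔ f' x = f' x' := by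
  rw [Set.Subset.antisymm_iff, labelTorus_subset_iff, labelTorus_subset_iff]
  exact ⟨fun h x x' => ⟨h.2 x x', h.1 x x'⟩,
    fun h => ⟨fun x x' => (h x x').2, fun x x' => (h x x').1⟩⟩

/-- The torus `S_ω` depends only on the semisimple type of `ω`. -/
theorem rationallyConj_of_ss_eq {α : I →₀ ℕ} {ω ν : Multitype I} (h : ω.size = α)
    (h' : ν.size = α) (hs : ω.ss = ν.ss) :
    RationallyConj Fq K (stdTorus Fq K ν h').1 (stdTorus Fq K ω h).1 := by
  obtain ⟨e, he⟩ := exists_pt_equiv_of_ss_eq hs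
  obtain ⟨T, hT, hmem⟩ := he.exists_torus (Fq := Fq) (K := K) h h'
  have : (stdTorus Fq K ω h).1 = T.1 := by
    ext x
    rw [hmem, mem_stdTorus, (labelTorus_eq_iff ω h id e).2 fun x x' => by simp]
  rwa [this]

/-- Rationally conjugate standard tori have the same semisimple type: there are label maps in both
directions, so these are bijective. -/
theorem ss_eq_of_rationallyConj {α : I →₀ ℕ} {ω ν : Multitype I} (h : ω.size = α)
    (h' : ν.size = α) (hc : RationallyConj Fq K (stdTorus Fq K ν h').1 (stdTorus Fq K ω h).1) :
    ω.ss = ν.ss := by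
  obtain ⟨f, hf, -⟩ := exists_labelMap_of_rationallyConj ω ν h h' _ hc le_rfl
  obtain ⟨g, hg, -⟩ := exists_labelMap_of_rationallyConj ν ω h' h _ hc.symm le_rfl
  exact hf.ss_eq (hf.bijective_of_card_le (Fintype.card_le_of_surjective g hg.surjective))

/-- Every torus contained in `S_ω` is conjugate to `S_ν` for a semisimple `ν`. -/
theorem exists_stype_of_le {α : I →₀ ℕ} (ω : Multitype I) (h : ω.size = α) (T : AdmTori Fq K α)
    (hle : T ≤ stdTorus Fq K ω h) : ∃ (n : SType I) (hn : n.toMT.size = α),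
      RationallyConj Fq K (stdTorus Fq K n.toMT hn).1 T.1 := by
  obtain ⟨f, hmem, hf⟩ := exists_label_of_le_stdTorus ω h T hle
  obtain ⟨n, g, hg, hker⟩ := exists_labelMap_of_kernel ω f hf
  have hn : n.toMT.size = α := hg.size_eq.symm.trans h
  obtain ⟨T', hT', hmem'⟩ := hg.exists_torus (Fq := Fq) (K := K) h hn
  have : T' = T := by
    refine Subtype.ext (Subgroup.ext fun x => ?_)
    rw [hmem, hmem', (labelTorus_eq_iff ω h g f).2 hker]
  exact ⟨n, hn, this ▸ hT'⟩

/-- The multitype of a torus is the semisimple multitype to which it is conjugate. -/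
theorem multitype_eq_of_rationallyConj {α : I →₀ ℕ} (n : SType I) (hn : n.toMT.size = α)
    (T : AdmTori Fq K α) (hT : RationallyConj Fq K (stdTorus Fq K n.toMT hn).1 T.1) :
    T.multitype = n.toMT := by
  classical
  have H : ∃ ν : Multitype I, ν.IsSemisimple ∧ ∃ h : ν.size = α,
      RationallyConj Fq K (stdTorus Fq K ν h).1 T.1 := ⟨_, n.toMT_isSemisimple, hn, hT⟩
  have e : T.multitype = H.choose := dif_pos H
  obtain ⟨h1, h2, h3⟩ := H.choose_spec
  rw [e, ← h1.toMT_ss, ss_eq_of_rationallyConj h2 hn (hT.trans h3.symm), SType.ss_toMT]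

open scoped Classical in
/-- The number of tori in `S_ω` conjugate to `S_ν`: the label maps `X_ω → X_ν` defining a given
torus form a torsor under the automorphisms of `X_ν`. -/
theorem card_tori_mul {α : I →₀ ℕ} (ω ν : Multitype I) (h : ω.size = α) (h' : ν.size = α) :
    ((stdTorus Fq K ω h).finite_Iic.toFinset.filter fun T =>
      RationallyConj Fq K (stdTorus Fq K ν h').1 T.1).card * Fintype.card (LabelMap ν ν) =
      Fintype.card (LabelMap ω ν) := by
  choose tor htor hmem using fun f : LabelMap ω ν => f.2.exists_torus (Fq := Fq) (K := K) h h'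
  have hmaps : ∀ f ∈ (Finset.univ : Finset (LabelMap ω ν)), tor f ∈
      (stdTorus Fq K ω h).finite_Iic.toFinset.filter fun T =>
        RationallyConj Fq K (stdTorus Fq K ν h').1 T.1 := by
    intro f _
    rw [Finset.mem_filter, mem_Iic_toFinset]
    refine ⟨fun x hx => ?_, htor f⟩
    exact (mem_stdTorus ω h x).2 (labelTorus_subset ω h _ ((hmem f x).1 hx))
  rw [← Finset.card_univ (α := LabelMap ω ν), Finset.card_eq_sum_card_fiberwise hmaps,
    Finset.sum_const_nat]
  intro T hT
  rw [Finset.mem_filter, mem_Iic_toFinset] at hT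
  obtain ⟨f₀, hf₀, hT₀⟩ := exists_labelMap_of_rationallyConj ω ν h h' T.1 hT.2 hT.1
  have htor_iff : ∀ f : LabelMap ω ν, tor f = T ↔ ∀ x x', f.1 x = f.1 x' ↔ f₀ x = f₀ x' := by
    intro f
    rw [← labelTorus_eq_iff (Fq := Fq) (K := K) ω h]
    constructor
    · rintro rfl
      ext x
      rw [← hmem, hT₀]
    · intro heq
      refine Subtype.ext (Subgroup.ext fun x => ?_)
      rw [hmem, hT₀, heq]
  rw [← Finset.card_univ (α := LabelMap ν ν)]
  -- the label maps with the same torus as `f₀` are the composites of `f₀` with automorphisms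
  refine (Finset.card_bij (fun u _ => (⟨fun x => u.1 (f₀ x), u.2.comp hf₀⟩ : LabelMap ω ν))
    ?_ ?_ ?_).symm
  · intro u _
    rw [Finset.mem_filter, htor_iff]
    exact ⟨Finset.mem_univ _, fun x x' => (u.2.bijective_of_card_le le_rfl).1.eq_iff⟩
  · intro u _ u' _ heq
    refine Subtype.ext (funext fun y => ?_)
    obtain ⟨x, rfl⟩ := hf₀.surjective y
    exact congrFun (congrArg Subtype.val heq) x
  · intro f hf
    rw [Finset.mem_filter, htor_iff] at hf
    obtain ⟨u, hu, hux⟩ := hf₀.exists_factor f.2 fun x x' => (hf.2 x x').2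
    exact ⟨⟨u, hu⟩, Finset.mem_univ _, Subtype.ext (funext hux)⟩

variable (Fq K) in
/-- The value of `levelMu` at the tori of semisimple type `n`. -/
def levelCoeff (V : Set (I →₀ ℕ)) (n : SType I) : RatFunc ℚ :=
  levelMu V (stdTorus Fq K n.toMT rfl)

theorem levelMu_of_rationallyConj (V : Set (I →₀ ℕ)) {α : I →₀ ℕ} (n : SType I)
    (hn : n.toMT.size = α) (T : AdmTori Fq K α)
    (hT : RationallyConj Fq K (stdTorus Fq K n.toMT hn).1 T.1) :
    levelMu V T = levelCoeff Fq K V n := by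
  subst hn
  exact (levelMu_congr V hT).symm

theorem levelMu_stdTorus (V : Set (I →₀ ℕ)) {α : I →₀ ℕ} (ω : Multitype I) (h : ω.size = α) :
    levelMu V (stdTorus Fq K ω h) = levelCoeff Fq K V ω.ss :=
  levelMu_of_rationallyConj V ω.ss ((SType.size_toMT _).trans (ω.size_ss.trans h)) _
    (rationallyConj_of_ss_eq h _ (SType.ss_toMT _).symm)

open scoped Classical in
/-- Möbius inversion on `𝒵_α` in terms of label maps. -/
theorem levelP_eq_sum (V : Set (I →₀ ℕ)) {α : I →₀ ℕ} (ω : Multitype I) (h : ω.size = α) :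
    levelP V (stdTorus Fq K ω h) = ∑ n ∈ stypes α,
      levelCoeff Fq K V n / n.W * Fintype.card (LabelMap ω n.toMT) := by
  rw [← sum_levelMu]
  have hex : ∀ T ∈ (stdTorus Fq K ω h).finite_Iic.toFinset, ∃ (n : SType I)
      (hn : n.toMT.size = α), RationallyConj Fq K (stdTorus Fq K n.toMT hn).1 T.1 :=
    fun T hT => exists_stype_of_le ω h T (mem_Iic_toFinset.1 hT)
  have hss : ∀ T : AdmTori Fq K α, ∀ (n : SType I) (hn : n.toMT.size = α),
      RationallyConj Fq K (stdTorus Fq K n.toMT hn).1 T.1 → T.multitype.ss = n := by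
    intro T n hn hT
    rw [multitype_eq_of_rationallyConj n hn T hT, SType.ss_toMT]
  rw [← Finset.sum_fiberwise_of_maps_to (g := fun T => T.multitype.ss) (t := stypes α)
    (fun T hT => by
      obtain ⟨n, hn, hc⟩ := hex T hT
      rw [hss T n hn hc, mem_stypes, ← n.size_toMT, hn])]
  refine Finset.sum_congr rfl fun n hn => ?_
  have hn' : n.toMT.size = α := n.size_toMT.trans (mem_stypes.1 hn)
  have hfil : ((stdTorus Fq K ω h).finite_Iic.toFinset.filter fun T => T.multitype.ss = n) =
      (stdTorus Fq K ω h).finite_Iic.toFinset.filter fun T =>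
        RationallyConj Fq K (stdTorus Fq K n.toMT hn').1 T.1 := by
    refine Finset.filter_congr fun T hT => ⟨?_, hss T n hn'⟩
    rintro rfl
    obtain ⟨n', hn'', hc⟩ := hex T hT
    obtain rfl := hss T n' hn'' hc
    exact hc
  rw [hfil, Finset.sum_congr rfl fun T hT =>
    levelMu_of_rationallyConj V n hn' T (Finset.mem_filter.1 hT).2, Finset.sum_const,
    ← card_tori_mul (Fq := Fq) (K := K) ω n.toMT h hn', card_labelMap_self, SType.ss_toMT,
    nsmul_eq_mul]
  have := n.W_ne_zero
  push_cast
  field_simp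

theorem levelP_stdTorus_toMT (V : Set (I →₀ ℕ)) {α : I →₀ ℕ} (n : SType I)
    (hn : n.toMT.size = α) : levelP V (stdTorus Fq K n.toMT hn) =
      open scoped Classical in if ∀ x ∈ n.support, x.2.1 ∈ V then
        n.prod fun x m => ((RatFunc.X : RatFunc ℚ) ^ (x.1 : ℕ) - 1) ^ m else 0 := by
  rw [levelP, multitype_eq_of_rationallyConj n hn _ (RationallyConj.refl _), SType.P_toMT]
  by_cases hl : n.toMT.IsOfLevel V
  · rw [if_pos hl, if_pos ((n.isOfLevel_toMT V).1 hl)]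
  · rw [if_neg hl, if_neg fun h => hl ((n.isOfLevel_toMT V).2 h)]

end Tori

/-! ### Label maps and plethystic exponentials -/

section Slices

variable {J L : Type*} [Fintype J]

/-- The restriction of a finitely supported function on `J × L` to `{j} × L`. -/
def slice (n : ((_ : J) × L) →₀ ℕ) (j : J) : L →₀ ℕ := Finsupp.sigmaFinsuppEquivPiFinsupp n j

theorem slice_symm (s : J → L →₀ ℕ) (j : J) :
    slice (Finsupp.sigmaFinsuppEquivPiFinsupp.symm s) j = s j :=
  congrFun (Equiv.apply_symm_apply _ s) j

@[to_additive]
theorem prod_slice {R : Type*} [CommMonoid R] (n : ((_ : J) × L) →₀ ℕ) (g : (_ : J) × L → ℕ → R)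
    (hg : ∀ x, g x 0 = 1) : n.prod g = ∏ j, (slice n j).prod fun l m => g ⟨j, l⟩ m := by
  rw [n.prod_of_support_subset (s := Finset.univ.sigma fun j => (slice n j).support) _ g
    fun i _ => hg i, Finset.prod_sigma]
  · rfl
  · rintro ⟨j, l⟩ h
    simpa [slice] using h

theorem facto_eq_prod_slice (n : ((_ : J) × L) →₀ ℕ) : facto n = ∏ j, facto (slice n j) :=
  prod_slice n _ fun _ => rfl

theorem size_slice {I : Type*} [DecidableEq J] (n : ((_ : J) × Lab I) →₀ ℕ) (j : J) :
    SType.size (slice n j) = n.sum fun l m => m • if l.1 = j then l.2.size else 0 := by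
  rw [sum_slice n (fun l m => m • if l.1 = j then l.2.size else 0) fun _ => zero_smul _ _,
    Finset.sum_eq_single j]
  · simp [SType.size]
  · intro j' _ hj
    simp [hj, Finsupp.sum]
  · simp

end Slices

section Identity

variable {I : Type*} [Fintype I]

/-- The map `(j, (e, β)) ↦ (d_j e, β)`. A cycle `(d, β)` of `X_m` mapping to the cycle `j` of `X_ν`
is encoded by `(j, (d / d_j, β))`. -/
def liftMap (ν : Multitype I) (l : (_ : ν.Block) × Lab I) : Lab I :=
  ((ν.key l.1).1 * l.2.1, l.2.2)

theorem liftMap_injective {ν : Multitype I} {l l' : (_ : ν.Block) × Lab I} (h : l.1 = l'.1)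
    (h' : liftMap ν l = liftMap ν l') : l = l' := by
  obtain ⟨j, e, β⟩ := l
  obtain ⟨j', e', β'⟩ := l'
  obtain rfl : j = j' := h
  have h1 : e = e' := mul_left_cancel (congrArg Prod.fst h')
  have h2 : β = β' := congrArg Prod.snd h'
  rw [h1, h2]

theorem size_liftMap (ν : Multitype I) (l : (_ : ν.Block) × Lab I) :
    (liftMap ν l).size = ν.d l.1 • l.2.size := by
  rw [liftMap, Lab.size, Lab.size, smul_smul, PNat.mul_coe]
  rfl

theorem finite_liftMap_eq (ν : Multitype I) (x : Lab I) : {l | liftMap ν l = x}.Finite :=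
  Set.Finite.of_injOn (f := fun l : (_ : ν.Block) × Lab I => l.1) (t := Set.univ)
    (fun _ _ => Set.mem_univ _)
    (fun _ h _ h' e => liftMap_injective e (Eq.trans h (Eq.symm h'))) Set.finite_univ

/-- The finite fibres of `liftMap`. -/
def liftFib (ν : Multitype I) (x : Lab I) : Finset ((_ : ν.Block) × Lab I) :=
  (finite_liftMap_eq ν x).toFinset

theorem mem_liftFib {ν : Multitype I} {x : Lab I} {l : (_ : ν.Block) × Lab I} :
    l ∈ liftFib ν x ↔ liftMap ν l = x :=
  (finite_liftMap_eq ν x).mem_toFinset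

/-- The weight of the label `(e, β)` in the `j`-th factor of `∏_j ψ_{d_j}(pexp f β_j)`. -/
def liftWeight (ν : Multitype I) (f : (I →₀ ℕ) → RatFunc ℚ) (l : (_ : ν.Block) × Lab I) :
    RatFunc ℚ :=
  ((l.2.1 : ℕ) : RatFunc ℚ)⁻¹ * adams (liftMap ν l).1 (f l.2.2.1)

theorem adams_term (ν : Multitype I) (f : (I →₀ ℕ) → RatFunc ℚ) (j : ν.Block) (n : SType I) :
    adams (ν.key j).1 (n.Theta f / n.W) =
      (n.prod fun x m => liftWeight ν f ⟨j, x⟩ ^ m) / facto n := by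
  rw [SType.Theta_div_W, map_div₀, map_natCast]
  congr 1
  rw [Finsupp.prod, map_prod]
  refine Finset.prod_congr rfl fun x _ => ?_
  rw [map_pow, map_mul, map_inv₀, map_natCast, ← adams_mul]
  rfl

open scoped Classical in
/-- The families of labels lifting the labels of `m` along `liftMap` correspond to the index maps.
-/
theorem sum_index_maps (m : SType I) (ν : Multitype I) (f : (I →₀ ℕ) → RatFunc ℚ)
    (S : Finset (((_ : ν.Block) × Lab I) →₀ ℕ)) (hS : ∀ n, n ∈ S ↔ n.mapDomain (liftMap ν) = m) :
    m.Theta f / m.W * Fintype.card (LabelMap m.toMT ν) =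
      ∑ n ∈ S, (if ∀ j, SType.size (slice n j) = ν.β j then n.prod fun l k => liftWeight ν f l ^ k
          else 0) / facto n := by
  have hm : famType m.toMT.key = m := m.ss_toMT
  have hlift := sum_lifts (R := RatFunc ℚ) m.toMT.key (liftMap ν) (liftFib ν)
    (fun l l' => mem_liftFib.1) fun n =>
      if ∀ j, SType.size (slice n j) = ν.β j then n.prod fun l k => liftWeight ν f l ^ k else 0
  refine Eq.trans ?_ ((Finset.sum_congr (Finset.ext fun n => (hS n).trans
    ((Eq.congr_right hm).symm.trans (mem_image_famType m.toMT.key (liftMap ν) (liftFib ν)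
      (fun l l' => mem_liftFib) n).symm)) fun _ _ => rfl).trans hlift).symm
  rw [hm, SType.Theta_div_W, div_mul_eq_mul_div]
  congr 1
  rw [← Finset.sum_filter, card_labelMap]
  push_cast
  rw [Finset.mul_sum]
  have hprod : (m.prod fun x k => (((x.1 : ℕ) : RatFunc ℚ)⁻¹ * adams x.1 (f x.2.1)) ^ k) =
      ∏ b, ((m.toMT.d b : RatFunc ℚ)⁻¹ * adams (m.toMT.key b).1 (f (m.toMT.β b))) := by
    conv_lhs => rw [← hm]
    exact famType_prod _ _
  have hsize : ∀ (y : m.toMT.Block → (_ : ν.Block) × Lab I) j,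
      SType.size (slice (famType y) j) = ∑ b with (y b).1 = j, (y b).2.size := by
    intro y j
    rw [size_slice, famType_sum, Finset.sum_filter]
  have hcond : ∀ y : m.toMT.Block → (_ : ν.Block) × Lab I,
      (∀ b, liftMap ν (y b) = m.toMT.key b) →
      ((∀ j, SType.size (slice (famType y) j) = ν.β j) ↔
        IsIndexMap m.toMT ν fun b => (y b).1) := by
    intro y hy
    have h1 : ∀ j, ∑ b with (y b).1 = j, m.toMT.d b • m.toMT.β b =
        ν.d j • ∑ b with (y b).1 = j, (y b).2.size := by
      intro j
      rw [Finset.smul_sum]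
      refine Finset.sum_congr rfl fun b hb => ?_
      have h2 := size_liftMap ν (y b)
      rw [hy, (Finset.mem_filter.1 hb).2] at h2
      exact h2
    constructor
    · intro h
      refine ⟨fun b => ?_, fun j => ?_⟩
      · have h2 := congrArg (fun x : Lab I => (x.1 : ℕ)) (hy b)
        exact Dvd.intro _ h2
      · rw [h1, ← hsize, h]
    · intro h j
      rw [hsize]
      exact smul_right_injective _ (ν.d_pos j).ne' ((h1 j).symm.trans (h.sum_eq j))
  symm
  refine Finset.sum_bij (fun y _ b => (y b).1) ?_ ?_ ?_ ?_
  · intro y hy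
    simp only [Finset.mem_filter, Fintype.mem_piFinset, mem_liftFib, Finset.mem_univ,
      true_and] at hy ⊢
    exact (hcond y hy.1).1 hy.2
  · intro y hy y' hy' h
    simp only [Finset.mem_filter, Fintype.mem_piFinset, mem_liftFib] at hy hy'
    exact funext fun b => liftMap_injective (congrFun h b) ((hy.1 b).trans (hy'.1 b).symm)
  · intro τ hτ
    have hτ' : IsIndexMap m.toMT ν τ := (Finset.mem_filter.1 hτ).2
    choose q hq using hτ'.dvd
    have hq0 : ∀ b, 0 < q b := fun b => Nat.pos_of_ne_zero fun h0 =>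
      (m.toMT.d_pos b).ne' (by rw [hq, h0, mul_zero])
    let y : m.toMT.Block → (_ : ν.Block) × Lab I := fun b =>
      ⟨τ b, (⟨q b, hq0 b⟩, (m.toMT.key b).2)⟩
    have hy : ∀ b, liftMap ν (y b) = m.toMT.key b := fun b =>
      Prod.ext (PNat.coe_injective (hq b).symm) rfl
    refine ⟨y, ?_, rfl⟩
    simp only [Finset.mem_filter, Fintype.mem_piFinset, mem_liftFib]
    exact ⟨hy, (hcond y hy).2 hτ'⟩
  · intro y hy
    simp only [Finset.mem_filter, Fintype.mem_piFinset, mem_liftFib] at hy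
    rw [famType_prod, hprod, ← Finset.prod_mul_distrib]
    refine Finset.prod_congr rfl fun b _ => ?_
    have h1 : ((m.toMT.d b : ℕ) : RatFunc ℚ) = (ν.d (y b).1 : RatFunc ℚ) *
        (((y b).2.1 : ℕ) : RatFunc ℚ) := by
      rw [← Nat.cast_mul]
      exact congrArg (fun x : Lab I => ((x.1 : ℕ) : RatFunc ℚ)) (hy.1 b).symm
    have h2 : (y b).2.2.1 = m.toMT.β b := congrArg (fun x : Lab I => x.2.1) (hy.1 b)
    have h3 : (ν.d (y b).1 : RatFunc ℚ) ≠ 0 := Nat.cast_ne_zero.2 (ν.d_pos _).ne'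
    have h4 : (((y b).2.1 : ℕ) : RatFunc ℚ) ≠ 0 := Nat.cast_ne_zero.2 (PNat.ne_zero _)
    rw [liftWeight, hy.1, h2, h1]
    field_simp

open scoped Classical in
/-- The generating function of the label maps to `ν` is the product `∏_j ψ_{d_j}(pexp f β_j)`. -/
theorem sum_card_labelMap (ν : Multitype I) (f : (I →₀ ℕ) → RatFunc ℚ) :
    ∑ m ∈ stypes ν.size, m.Theta f / m.W * Fintype.card (LabelMap m.toMT ν) =
      ∏ j, adams (ν.key j).1 (pexp f (ν.β j)) := by
  -- the types on the disjoint union of copies of the set of labels are the families of types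
  let Φ := Finsupp.sigmaFinsuppEquivPiFinsupp (α := ℕ) (η := ν.Block) (ιs := fun _ => Lab I)
  let c : (((_ : ν.Block) × Lab I) →₀ ℕ) → RatFunc ℚ := fun n =>
    (n.prod fun l k => liftWeight ν f l ^ k) / facto n
  have hc : ∀ s : ν.Block → SType I, ∏ j, adams (ν.key j).1 ((s j).Theta f / (s j).W) =
      c (Φ.symm s) := by
    intro s
    simp only [c]
    rw [prod_slice _ _ fun _ => pow_zero _, facto_eq_prod_slice, Nat.cast_prod,
      ← Finset.prod_div_distrib]
    refine Finset.prod_congr rfl fun j _ => ?_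
    rw [slice_symm, adams_term]
  have hsize : ∀ s ∈ Fintype.piFinset fun j => stypes (ν.β j),
      (Φ.symm s).mapDomain (liftMap ν) ∈ stypes ν.size := by
    intro s hs
    rw [mem_stypes, SType.size, Finsupp.sum_mapDomain_index (by simp) (by simp [add_smul]),
      sum_slice _ (fun l m => m • (liftMap ν l).size) fun _ => zero_smul _ _, ν.size_eq_sum]
    refine Finset.sum_congr rfl fun j _ => ?_
    rw [slice_symm, ← mem_stypes.1 (Fintype.mem_piFinset.1 hs j), SType.size, Finsupp.smul_sum]
    refine Finsupp.sum_congr fun x _ => ?_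
    rw [size_liftMap, smul_comm]
  simp only [pexp, map_sum]
  rw [Finset.prod_univ_sum, Finset.sum_congr rfl fun s _ => hc s,
    ← Finset.sum_fiberwise_of_maps_to hsize]
  refine Finset.sum_congr rfl fun m _ => ?_
  obtain ⟨S, hS⟩ : ∃ S : Finset (((_ : ν.Block) × Lab I) →₀ ℕ),
      ∀ n, n ∈ S ↔ n.mapDomain (liftMap ν) = m :=
    ⟨_, fun n => (mem_image_famType m.toMT.key (liftMap ν) (liftFib ν)
      (fun l l' => mem_liftFib) n).trans (Eq.congr_right m.ss_toMT)⟩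
  rw [sum_index_maps m ν f S hS]
  simp only [ite_div, zero_div]
  rw [← Finset.sum_filter]
  refine Finset.sum_nbij' (fun n => Φ n) (fun s => Φ.symm s) ?_ ?_
    (fun n _ => Φ.symm_apply_apply n)
    (fun s _ => Φ.apply_symm_apply s) (fun n _ => by rw [Φ.symm_apply_apply])
  · intro n hn
    rw [Finset.mem_filter, hS] at hn
    rw [Finset.mem_filter, Fintype.mem_piFinset, Φ.symm_apply_apply]
    exact ⟨fun j => mem_stypes.2 (hn.2 j), hn.1⟩
  · intro s hs
    rw [Finset.mem_filter, Fintype.mem_piFinset] at hs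
    rw [Finset.mem_filter, hS]
    refine ⟨hs.2, fun j => ?_⟩
    rw [slice_symm]
    exact mem_stypes.1 (hs.1 j)

end Identity

/-! ### The sums over multitypes of a given size -/

section LevelSums

variable {I : Type*} [Fintype I] [DecidableEq I]
variable (Fq K : Type*) [Field Fq] [Fintype Fq] [Field K] [Algebra Fq K] [IsAlgClosed K]

/-- The key identity: Möbius inversion combined with the generating function of the label maps. -/
theorem sum_levelCoeff_pexp (V : Set (I →₀ ℕ)) (f : (I →₀ ℕ) → RatFunc ℚ) (α : I →₀ ℕ) :
    ∑ n ∈ stypes α, levelCoeff Fq K V n * (n.Theta (pexp f) / n.W) =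
      pexp (open scoped Classical in fun β => if β ∈ V then (RatFunc.X - 1) * f β else 0) α := by
  classical
  have h1 : ∀ n ∈ stypes α, levelCoeff Fq K V n * (n.Theta (pexp f) / n.W) =
      ∑ m ∈ stypes α, m.Theta f / m.W *
        (levelCoeff Fq K V n / n.W * Fintype.card (LabelMap m.toMT n.toMT)) := by
    intro n hn
    have h2 := sum_card_labelMap n.toMT f
    rw [n.size_toMT, mem_stypes.1 hn] at h2
    have h3 : n.Theta (pexp f) = ∏ j, adams (n.toMT.key j).1 (pexp f (n.toMT.β j)) := by
      conv_lhs => rw [← n.ss_toMT]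
      exact famType_prod n.toMT.key fun x => adams x.1 (pexp f x.2.1)
    rw [h3, ← h2, mul_div_assoc', Finset.mul_sum, Finset.sum_div]
    refine Finset.sum_congr rfl fun m _ => ?_
    ring
  rw [Finset.sum_congr rfl h1, Finset.sum_comm, pexp]
  refine Finset.sum_congr rfl fun m hm => ?_
  have hm' : m.toMT.size = α := m.size_toMT.trans (mem_stypes.1 hm)
  rw [← Finset.mul_sum, ← levelP_eq_sum V m.toMT hm', levelP_stdTorus_toMT, div_mul_eq_mul_div]
  congr 1
  split_ifs with hV
  · rw [SType.Theta, SType.Theta, Finsupp.prod, Finsupp.prod, Finsupp.prod,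
      ← Finset.prod_mul_distrib]
    refine Finset.prod_congr rfl fun x hx => ?_
    rw [if_pos (hV x hx), map_mul, map_sub, adams_X, map_one, mul_pow, mul_comm]
  · push Not at hV
    obtain ⟨x, hx, hxV⟩ := hV
    rw [mul_zero]
    refine (Finset.prod_eq_zero hx ?_).symm
    simp only
    rw [if_neg hxV, map_zero, zero_pow (Finsupp.mem_support_iff.1 hx)]

/-- The multitype `(1, 𝛌)`. -/
def Multitype.unit (l : I → Ptn) (h : msize l ≠ 0) : Multitype I :=
  ⟨Finsupp.single (1, l) 1, fun l' => by simp, fun d l' h' => Finsupp.single_eq_of_ne (by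
    rintro ⟨-, -⟩
    exact h h')⟩

omit [DecidableEq I] in
theorem finite_msize_eq (β : I →₀ ℕ) : {l : I → Ptn | msize l = β}.Finite := by
  have h1 : ∀ n : ℕ, {p : Ptn | p.1 = n}.Finite := by
    intro n
    refine (Set.finite_range fun p : n.Partition => (⟨n, p⟩ : Ptn)).subset ?_
    rintro ⟨_, p⟩ rfl
    exact ⟨p, rfl⟩
  refine (Set.Finite.pi fun i => h1 (β i)).subset fun l hl i _ => ?_
  exact DFunLike.congr_fun hl i

/-- The multipartitions of size `β`. -/
def multipartitions (β : I →₀ ℕ) : Finset (I → Ptn) := (finite_msize_eq β).toFinset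

omit [DecidableEq I] in
theorem mem_multipartitions {β : I →₀ ℕ} {l : I → Ptn} :
    l ∈ multipartitions β ↔ msize l = β :=
  (finite_msize_eq β).mem_toFinset

/-- The sum of `F` over the multitypes `(1, 𝛌)` with `|𝛌| = β`; the value at `β = 0` is `0`. -/
def unitSum (F : Multitype I → RatFunc ℚ) (β : I →₀ ℕ) : RatFunc ℚ :=
  ∑ l ∈ multipartitions β, if h : msize l ≠ 0 then F (Multitype.unit l h) else 0

omit [DecidableEq I] in
/-- A Log compatible family is determined by its values at the multitypes `(1, 𝛌)`. -/
theorem LogCompatible.eq_prod {F : Multitype I → RatFunc ℚ} (hF : LogCompatible F)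
    (ω : Multitype I) : F ω = ∏ b : ω.Block, adams (ω.key b).1
      (F (Multitype.unit b.1.1.2 (ω.β_ne_zero b))) := by
  -- `ω` is the sum of the `ψ_{d_j}(1, 𝛌_j)`
  let e := (Fintype.equivFin ω.Block).symm
  have h := hF _ (fun j => Multitype.unit (e j).1.1.2 (ω.β_ne_zero (e j)))
    (fun j => (ω.key (e j)).1)
  rw [e.prod_comp fun b : ω.Block => adams (ω.key b).1
    (F (Multitype.unit b.1.1.2 (ω.β_ne_zero b)))] at h
  rw [h]
  congr 1
  rw [e.sum_comp fun b : ω.Block =>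
    (Multitype.unit b.1.1.2 (ω.β_ne_zero b)).psi (ω.key b).1]
  refine Subtype.ext ?_
  rw [AddSubmonoid.coe_finsetSum]
  conv_lhs => rw [← famType_sigma ω.1, famType]
  refine Finset.sum_congr rfl fun b _ => ?_
  refine (Finsupp.mapDomain_single.trans ?_).symm
  rw [mul_one]
  rfl

/-- The label `(d, |𝛌|)`. -/
def pairSize (x : ℕ × (I → Ptn)) : ℕ × (I →₀ ℕ) := (x.1, msize x.2)

/-- The label `(d, β)` without its side conditions. -/
def Lab.forget (x : Lab I) : ℕ × (I →₀ ℕ) := ((x.1 : ℕ), x.2.1)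

omit [Fintype I] [DecidableEq I] in
theorem Lab.forget_injective : Function.Injective (Lab.forget (I := I)) := by
  rintro ⟨d, β⟩ ⟨d', β'⟩ h
  exact Prod.ext (PNat.coe_injective (congrArg Prod.fst h)) (Subtype.ext (congrArg Prod.snd h))

omit [DecidableEq I] in
theorem Multitype.mapDomain_pairSize (ω : Multitype I) :
    ω.1.mapDomain pairSize = ω.ss.mapDomain Lab.forget := by
  conv_lhs => rw [← famType_sigma ω.1]
  rw [mapDomain_famType, ss, mapDomain_famType]
  rfl

/-- The factor of `F_ω / w(ω)` at `(d, 𝛌)`, apart from the factorials; it is `0` for the pairs that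
do not occur in a multitype. -/
def unitWeight (F : Multitype I → RatFunc ℚ) (x : ℕ × (I → Ptn)) : RatFunc ℚ :=
  if h : 0 < x.1 ∧ msize x.2 ≠ 0 then
    (x.1 : RatFunc ℚ)⁻¹ * adams ⟨x.1, h.1⟩ (F (Multitype.unit x.2 h.2)) else 0

theorem LogCompatible.div_w {F : Multitype I → RatFunc ℚ} (hF : LogCompatible F)
    (ω : Multitype I) :
    F ω / (ω.w : RatFunc ℚ) = (ω.1.prod fun x m => unitWeight F x ^ m) / facto ω.1 := by
  have h1 : (ω.w : RatFunc ℚ) =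
      (ω.1.prod fun x m => (x.1 : RatFunc ℚ) ^ m) * (facto ω.1 : RatFunc ℚ) := by
    rw [Multitype.w, facto, Finsupp.prod, Finsupp.prod, Finsupp.prod, Finset.prod_mul_distrib]
    push_cast
    rfl
  have h2 : ∀ g : ℕ × (I → Ptn) → RatFunc ℚ, (ω.1.prod fun x m => g x ^ m) =
      ∏ b : ω.Block, g b.1.1 := by
    intro g
    conv_lhs => rw [← famType_sigma ω.1]
    exact famType_prod _ _
  rw [h1, h2, h2, ← div_div, hF.eq_prod ω]
  congr 1
  rw [← Finset.prod_div_distrib]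
  refine Finset.prod_congr rfl fun b _ => ?_
  rw [unitWeight, dif_pos ⟨ω.d_pos b, ω.β_ne_zero b⟩, div_eq_inv_mul]
  rfl

/-- The sum of `F_ω / w(ω)` over the multitypes of a given semisimple type. -/
theorem LogCompatible.sum_ss_eq {F : Multitype I → RatFunc ℚ} (hF : LogCompatible F)
    {α : I →₀ ℕ} (n : SType I) (hn : n ∈ stypes α) :
    (open scoped Classical in ∑ ω : {ω : Multitype I // ω.size = α} with ω.1.ss = n,
      F ω.1 / (ω.1.w : RatFunc ℚ)) = n.Theta (unitSum F) / n.W := by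
  classical
  let x : n.toMT.Block → ℕ × (I →₀ ℕ) := fun b => (n.toMT.key b).forget
  let fib : ℕ × (I →₀ ℕ) → Finset (ℕ × (I → Ptn)) := fun y =>
    (multipartitions y.2).image (Prod.mk y.1)
  have hfib : ∀ l l', l' ∈ fib l ↔ pairSize l' = l := by
    rintro ⟨d, β⟩ ⟨d', l⟩
    simp only [fib, Finset.mem_image, mem_multipartitions, pairSize,
      Prod.mk.injEq]
    constructor
    · rintro ⟨l, hl, rfl, rfl⟩
      exact ⟨rfl, hl⟩
    · rintro ⟨rfl, hl⟩
      exact ⟨l, hl, rfl, rfl⟩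
  have hx : famType x = n.mapDomain Lab.forget := by
    conv_rhs => rw [← n.ss_toMT]
    rw [Multitype.ss, mapDomain_famType]
  have hfac : facto (famType x) = facto n := by
    rw [hx]
    exact Finsupp.prod_mapDomain_index_inj Lab.forget_injective
  have hmain := sum_prod_pow_lifts x pairSize fib (fun l l' => (hfib l l').1) (unitWeight F)
  have hb : ∀ b, ∑ l ∈ fib (x b), unitWeight F l =
      ((n.toMT.d b : ℕ) : RatFunc ℚ)⁻¹ * adams (n.toMT.key b).1 (unitSum F (n.toMT.β b)) := by
    intro b
    rw [Finset.sum_image (fun _ _ _ _ h => congrArg Prod.snd h), unitSum, map_sum,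
      Finset.mul_sum]
    refine Finset.sum_congr rfl fun l hl => ?_
    have hl' : msize l = n.toMT.β b := mem_multipartitions.1 hl
    have hl0 : msize l ≠ 0 := hl' ▸ n.toMT.β_ne_zero b
    rw [unitWeight, dif_pos ⟨n.toMT.d_pos b, hl0⟩, dif_pos hl0]
    rfl
  rw [hfac, Finset.prod_congr rfl fun b _ => hb b] at hmain
  have hprod : (n.prod fun y m =>
      (((y.1 : ℕ) : RatFunc ℚ)⁻¹ * adams y.1 (unitSum F y.2.1)) ^ m) =
      ∏ b, (((n.toMT.d b : ℕ) : RatFunc ℚ)⁻¹ *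
        adams (n.toMT.key b).1 (unitSum F (n.toMT.β b))) := by
    conv_lhs => rw [← n.ss_toMT]
    exact famType_prod n.toMT.key fun y => ((y.1 : ℕ) : RatFunc ℚ)⁻¹ * adams y.1 (unitSum F y.2.1)
  rw [SType.Theta_div_W, hprod, ← hmain]
  refine Finset.sum_bij (fun ω _ => ω.1.1) ?_ ?_ ?_ ?_
  · intro ω hω
    rw [mem_image_famType x pairSize fib hfib, hx, Multitype.mapDomain_pairSize,
      (Finset.mem_filter.1 hω).2]
  · intro ω _ ω' _ h
    exact Subtype.ext (Subtype.ext h)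
  · intro m hm
    have hm' := (mem_image_famType x pairSize fib hfib m).1 hm
    obtain ⟨y, hy, rfl⟩ := Finset.mem_image.1 hm
    have hy' : ∀ b, pairSize (y b) = x b := fun b => (hfib _ _).1 (Fintype.mem_piFinset.1 hy b)
    have hsupp : ∀ z, famType y z ≠ 0 → ∃ b, y b = z := by
      intro z hz
      rw [famType_apply, Nat.card_ne_zero] at hz
      obtain ⟨⟨b, hb⟩⟩ := hz.1
      exact ⟨b, hb⟩
    -- the labels of `y` have the nonzero components of the labels of `n`
    let ω : Multitype I := ⟨famType y, by
      constructor
      · intro l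
        by_contra h0
        obtain ⟨b, hb⟩ := hsupp _ h0
        have h1 := congrArg Prod.fst (hy' b)
        rw [hb] at h1
        exact (n.toMT.d_pos b).ne h1
      · intro d l hl
        by_contra h0
        obtain ⟨b, hb⟩ := hsupp _ h0
        have h1 := congrArg Prod.snd (hy' b)
        rw [hb] at h1
        exact n.toMT.β_ne_zero b (h1.symm.trans hl)⟩
    have hss : ω.ss = n := by
      refine Finsupp.mapDomain_injective Lab.forget_injective ?_
      rw [← ω.mapDomain_pairSize, ← hx]
      exact hm'
    exact ⟨⟨ω, by rw [← ω.size_ss, hss, mem_stypes.1 hn]⟩,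
      Finset.mem_filter.2 ⟨Finset.mem_univ _, hss⟩, rfl⟩
  · intro ω _
    exact hF.div_w ω.1

theorem LogCompatible.levelSum_eq_sum {F : Multitype I → RatFunc ℚ} (hF : LogCompatible F)
    (V : Set (I →₀ ℕ)) (α : I →₀ ℕ) :
    levelSum Fq K F V α =
      ∑ n ∈ stypes α, levelCoeff Fq K V n * (n.Theta (unitSum F) / n.W) := by
  classical
  rw [levelSum_eq, ← Finset.sum_fiberwise_of_maps_to (t := stypes α)
    (g := fun ω : {ω : Multitype I // ω.size = α} => ω.1.ss)
    fun ω _ => mem_stypes.2 (ω.1.size_ss.trans ω.2)]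
  refine Finset.sum_congr rfl fun n hn => ?_
  rw [← hF.sum_ss_eq n hn, Finset.mul_sum]
  refine Finset.sum_congr rfl fun ω hω => ?_
  rw [levelMu_stdTorus, (Finset.mem_filter.1 hω).2, mul_comm]

/-- The sums `F_{α,V}` in terms of the plethystic logarithm `f` of `∑_β (unitSum F β) y^β`. -/
theorem LogCompatible.levelSum_eq_pexp {F : Multitype I → RatFunc ℚ} (hF : LogCompatible F)
    {f : (I →₀ ℕ) → RatFunc ℚ} (hf : ∀ β, β ≠ 0 → pexp f β = unitSum F β)
    (V : Set (I →₀ ℕ)) (α : I →₀ ℕ) :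
    levelSum Fq K F V α =
      pexp (open scoped Classical in fun β => if β ∈ V then (RatFunc.X - 1) * f β else 0) α := by
  rw [hF.levelSum_eq_sum Fq K, ← sum_levelCoeff_pexp Fq K]
  refine Finset.sum_congr rfl fun n _ => ?_
  rw [Theta_congr n fun x _ => hf _ x.2.2]

/-- In `F_{β,gen}` only the summand of `pexp` indexed by the type `(1, β)` is left. -/
theorem LogCompatible.genSum_eq {F : Multitype I → RatFunc ℚ} (hF : LogCompatible F)
    {f : (I →₀ ℕ) → RatFunc ℚ} (hf : ∀ β, β ≠ 0 → pexp f β = unitSum F β)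
    {β : I →₀ ℕ} (hβ : β ≠ 0) : genSum Fq K F β = (RatFunc.X - 1) * f β := by
  classical
  rw [genSum, hF.levelSum_eq_pexp Fq K hf, pexp, Finset.sum_eq_single (SType.one hβ)]
  · rw [SType.one_term, if_pos (Set.mem_singleton β)]
  · intro n hn hne
    obtain rfl := mem_stypes.1 hn
    have hn0 : n ≠ 0 := by
      rintro rfl
      exact hβ Finsupp.sum_zero_index
    obtain ⟨x, hx⟩ := Finsupp.support_nonempty_iff.2 hn0
    rw [SType.Theta, Finsupp.prod, Finset.prod_eq_zero hx, zero_div]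
    have hlt := SType.lt_of_mem_support hx hβ hne
    rw [if_neg fun h : x.2.1 ∈ ({n.size} : Set _) => hlt.ne (Set.mem_singleton_iff.1 h), map_zero,
      zero_pow (Finsupp.mem_support_iff.1 hx)]
  · exact fun h => absurd (SType.one_mem hβ) h

end LevelSums

end LogCompat

end

theorem mainTheorem2 {I : Type*} [Fintype I] [DecidableEq I]
    (Fq K : Type*) [Field Fq] [Fintype Fq] [Field K] [Algebra Fq K] [IsAlgClosed K]
    [Algebra.IsAlgebraic Fq K]
    (F : LogCompat.Multitype I → RatFunc ℚ) (hF : LogCompat.LogCompatible F)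
    (V : Set (I →₀ ℕ)) :
    LogCompat.Plexp (I := I) (open scoped Classical in
        fun β => if β ∈ V ∧ β ≠ 0 then LogCompat.genSum Fq K F β else 0) =
      fun α => LogCompat.levelSum Fq K F V α := by
  classical
  obtain ⟨f, hf⟩ := LogCompat.exists_pexp_eq (LogCompat.unitSum F)
  refine MvPowerSeries.ext fun α => ?_
  refine (LogCompat.coeff_Plexp _ (if_neg fun h => h.2 rfl) α).trans ?_
  refine Eq.trans (LogCompat.pexp_congr (fun β hβ => ?_) α)
    (hF.levelSum_eq_pexp Fq K hf V α).symm
  refine (if_congr (and_iff_left hβ) rfl rfl).trans ?_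
  rw [hF.genSum_eq Fq K hf hβ]
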